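/- Conventions. Let $n\ge 2$. A convex $n$-gon $T=T(\alpha_1,\dots,\alpha_n)$ is a sequence of $n$ distinct complex numbers (indices modulo $n$) for which the edge arguments have real representatives $\theta_j\equiv\arg(\alpha_{j+1}-\alpha_j) \pmod{2\pi}$ with $\theta_1\le\theta_2\le\cdots\le\theta_n\le\theta_1+2\pi$ (counterclockwise order, possibly degenerate); $\Theta_n$ denotes the set of all of them. For a uniformly distributed direction $\omega\in(-\pi,\pi]$, the width of $T$ is $$X_T(\omega)=\sum_{j=1}^n|\alpha_{j+1}-\alpha_j|\,\max\{\sin(\arg(\alpha_{j+1}-\alpha_j)-\omega),0\},$$ and its deviation rate is $\delta(X_T)=\sqrt{\mathbb E(X_T^2)-\mathbb E(X_T)^2}\,/\,\mathbb E(X_T)$. A polygon $T\in\Theta_n$ is called $\delta$-minimizing if $\delta(X_T)\le\delta(X_S)$ for all $S\in\Theta_n$. A Reuleaux body is a planar convex body of constant width $r>0$ whose boundary is a finite union of circular arcs of radius $r$ with centers on that boundary. A boundary point at which two consecutive boundary arcs with different centers meet is called an essential endpoint. A Reinhardt $n$-gon is an equilateral convex $n$-gon whose vertices all lie on the boundary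 of some Reuleaux body and include all the essential endpoints of that body. Theorem. Let $n>1$ be an integer. (1) If $n$ is not a power of $2$, then a convex $n$-gon $T\in\Theta_n$ is $\delta$-minimizing if and only if it is a Reinhardt $n$-gon. (2) A Reinhardt $n$-gon exists if and only if $n$ is not a power of $2$. -/

import Mathlib

open MeasureTheory

namespace WidthDeviation

noncomputable section

/-! ### Random directions, shadows of polygons, deviation rate -/

/-- Expectation of a random variable on `(-π, π]` with normalized Lebesgue measure. -/
def expectation (X : ℝ → ℝ) : ℝ :=
  (2 * Real.pi)⁻¹ * ∫ ω in (-Real.pi)..Real.pi, X ω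

/-- The deviation rate `√(E(X²) - E(X)²) / E(X)`. -/
def deviationRate (X : ℝ → ℝ) : ℝ :=
  Real.sqrt (expectation (fun ω => X ω ^ 2) - expectation X ^ 2) / expectation X

/-- The one-sided shadow `|z| sin(arg z - ω)₊` of the vector `z` in the direction `ω`. -/
def vectorShadow (z : ℂ) (ω : ℝ) : ℝ :=
  ‖z‖ * max (Real.sin (z.arg - ω)) 0

/-- The `j`-th edge vector `α_{j+1} - α_j`, indices being cyclic. -/
def edge {n : ℕ} (α : Fin n → ℂ) (j : Fin n) : ℂ :=
  α (finRotate n j) - α j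

/-- The width (length of the shadow) `X_T(ω)` of the polygon with vertices `α`. -/
def polygonWidth {n : ℕ} (α : Fin n → ℂ) (ω : ℝ) : ℝ :=
  ∑ j, vectorShadow (edge α j) ω

/-- `α` is the sequence of vertices of a (possibly degenerate) convex `n`-gon in counterclockwise
order: the vertices are distinct, and modulo `2π` the arguments of the edges satisfy
`arg e₁ ≤ arg e₂ ≤ ⋯ ≤ arg eₙ ≤ arg e₁ + 2π`. -/
structure IsConvexNGon {n : ℕ} (α : Fin n → ℂ) : Prop where
  two_le : 2 ≤ n
  injective : Function.Injective α
  counterclockwise : ∃ θ : Fin n → ℝ,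
    (∀ j, (θ j : Real.Angle) = ((edge α j).arg : Real.Angle)) ∧
    Monotone θ ∧ ∀ j k, θ j ≤ θ k + 2 * Real.pi

/-- The convex `n`-gon `α` minimizes the deviation rate of the width among all convex `n`-gons. -/
def IsMinimizingNGon {n : ℕ} (α : Fin n → ℂ) : Prop :=
  IsConvexNGon α ∧ ∀ β : Fin n → ℂ, IsConvexNGon β →
    deviationRate (polygonWidth α) ≤ deviationRate (polygonWidth β)

/-! ### Reuleaux bodies and Reinhardt polygons -/

/-- The width of a planar set along the unit vector `exp(iω)`. -/
def setWidth (D : Set ℂ) (ω : ℝ) : ℝ :=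
  sSup ((fun z : ℂ => (z * Complex.exp (-(ω * Complex.I))).re) '' D) -
    sInf ((fun z : ℂ => (z * Complex.exp (-(ω * Complex.I))).re) '' D)

/-- The circular arc `{c + r exp(iθ) : a ≤ θ ≤ b}`. -/
def circularArc (c : ℂ) (r a b : ℝ) : Set ℂ :=
  circleMap c r '' Set.Icc a b

/-- A Reuleaux body of width `r`: a planar convex body of constant width `r > 0` whose boundary is
a finite union of nondegenerate circular arcs of radius `r` centered at boundary points. -/
structure IsReuleauxBody (D : Set ℂ) (r : ℝ) : Prop where
  convex : Convex ℝ D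
  isCompact : IsCompact D
  nonempty_interior : (interior D).Nonempty
  width_pos : 0 < r
  constant_width : ∀ ω : ℝ, setWidth D ω = r
  arcs : ∃ (m : ℕ) (c : Fin m → ℂ) (a b : Fin m → ℝ),
    (∀ i, a i < b i) ∧ (∀ i, c i ∈ frontier D) ∧
    frontier D = ⋃ i, circularArc (c i) r (a i) (b i)

/-- `z` is an essential endpoint of the boundary arcs of `D` (radius `r`): a boundary arc ends at
`z`, the next boundary arc in counterclockwise order starts at `z`, and their centers differ. -/
def IsEssentialEndpoint (D : Set ℂ) (r : ℝ) (z : ℂ) : Prop :=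
  ∃ (c₁ c₂ : ℂ) (a₁ b₁ a₂ b₂ : ℝ), c₁ ≠ c₂ ∧ a₁ < b₁ ∧ a₂ < b₂ ∧
    circularArc c₁ r a₁ b₁ ⊆ frontier D ∧ circularArc c₂ r a₂ b₂ ⊆ frontier D ∧
    z = circleMap c₁ r b₁ ∧ z = circleMap c₂ r a₂

/-- A Reinhardt `n`-gon: an equilateral convex `n`-gon inscribed in a Reuleaux body (all vertices
on its boundary) and having all the essential endpoints among its vertices. -/
structure IsReinhardtNGon {n : ℕ} (α : Fin n → ℂ) : Prop where
  convex : IsConvexNGon α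
  equilateral : ∀ j k, ‖edge α j‖ = ‖edge α k‖
  inscribed : ∃ (D : Set ℂ) (r : ℝ), IsReuleauxBody D r ∧
    (∀ j, α j ∈ frontier D) ∧ ∀ z, IsEssentialEndpoint D r z → z ∈ Set.range α

end

end WidthDeviation

/-! Since the edges sum to zero, the width is `X(ω) = ½ ∑ rⱼ |sin (θⱼ - ω)|`. It is `π`-periodic,
and it is a sinusoid on each of the `n` pieces into which the edge directions modulo `π` cut a
period. Because `δ² = E(X²) / E(X)² - 1`, the task is to bound `(∫ X)² / ∫ X²` from above. On a
piece of length `ℓ` this ratio is at most `pieceGain ℓ`; by Cauchy–Schwarz the gains add up over the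
pieces, and by strict concavity of `pieceGain` their sum is at most `n * pieceGain (π / n)`.
Equality forces pieces of equal length and a cosine of the same amplitude on each, hence edges of
equal length whose directions modulo `π` are equally spaced: `IsEquidirected`
(`halfAbsSinSum_bound`, `momentRatio_bound`). Wherever equidirected convex polygons exist, they are
therefore exactly the minimizers.

Equidirected is the same as Reinhardt. Given an equidirected polygon, replace every edge by a
circular arc of angle `π / n` around a common radius `A`. As a function of the outer normal, the
radius of curvature takes the values `A` and `0`, and opposite normals always get one of each; so
the closed curve has constant width (`isReinhardtNGon_of_isEquidirected`). Conversely, parametrize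
the boundary of a Reuleaux body by its outer normal. Every edge of a Reinhardt polygon cuts off one
arc centered at a vertex; equal edges give equal arcs, and their intervals of normals, taken modulo
`π`, tile the line (`IsReinhardtNGon.isEquidirected`).

Existence is arithmetic. If `n = 2 ^ k * p` with `p ≥ 3` odd, the `p` rotations of a block of `2 ^
k` consecutive directions cancel. If `n = 2 ^ k`, closing up would be a relation with coefficients
`±1` between the first `2 ^ k` powers of a primitive `2 ^ (k + 1)`-th root of unity, and these are
linearly independent over `ℚ`. -/

namespace WidthDeviation

noncomputable section

/-! ### The gain of a sinusoidal piece -/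

/-- The maximum of `(∫ f)² / ∫ f²` over the sinusoids `f` on an interval of length `ℓ`. -/
def pieceGain (ℓ : ℝ) : ℝ := 4 * (1 - Real.cos ℓ) / (ℓ + Real.sin ℓ)

lemma add_sin_pos {x : ℝ} (hx : 0 < x) (hx' : x ≤ Real.pi) : 0 < x + Real.sin x := by
  have := Real.sin_nonneg_of_nonneg_of_le_pi hx.le hx'
  linarith

/-- Strict concavity of the sine between `0` and `y` makes `sin x / x` strictly decreasing. -/
lemma mul_sin_lt_mul_sin {x y : ℝ} (hx : 0 < x) (hxy : x < y) (hy : y ≤ Real.pi) :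
    x * Real.sin y < y * Real.sin x := by
  have h0 : 0 < y := hx.trans hxy
  have ha : 0 < 1 - x / y := by rw [sub_pos, div_lt_one h0]; exact hxy
  have hb : 0 < x / y := by positivity
  have h := strictConcaveOn_sin_Icc.2 (⟨le_rfl, Real.pi_pos.le⟩ : (0 : ℝ) ∈ Set.Icc 0 Real.pi)
    (⟨h0.le, hy⟩ : y ∈ Set.Icc 0 Real.pi) h0.ne ha hb (by ring)
  simp only [smul_eq_mul, Real.sin_zero, mul_zero, zero_add] at h
  rw [div_mul_cancel₀ _ h0.ne'] at h
  calc x * Real.sin y = y * (x / y * Real.sin y) := by field_simp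
    _ < y * Real.sin x := by gcongr

lemma hasDerivAt_pieceGain {x : ℝ} (hx : 0 < x) (hx' : x ≤ Real.pi) :
    HasDerivAt pieceGain (4 * (x * Real.sin x) / (x + Real.sin x) ^ 2) x := by
  have h0 := add_sin_pos hx hx'
  have h1 : HasDerivAt (fun x => 4 * (1 - Real.cos x)) (4 * Real.sin x) x := by
    simpa using ((Real.hasDerivAt_cos x).const_sub 1).const_mul 4
  have h2 : HasDerivAt (fun x => x + Real.sin x) (1 + Real.cos x) x :=
    (hasDerivAt_id x).add (Real.hasDerivAt_sin x)
  refine (h1.div h2 h0.ne').congr_deriv ?_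
  congr 1
  linear_combination 4 * Real.sin_sq_add_cos_sq x

lemma pieceGain_zero : pieceGain 0 = 0 := by simp [pieceGain]

/-- At `0` the quotient is `0 / 0`, which evaluates to `0`; this is the true limit, by squeezing
between `0` and `2 * x`. -/
lemma continuousOn_pieceGain : ContinuousOn pieceGain (Set.Icc 0 Real.pi) := by
  intro x hx
  rcases hx.1.eq_or_lt with rfl | h
  · rw [ContinuousWithinAt, pieceGain_zero]
    have hlim : Filter.Tendsto (fun x : ℝ => 2 * x) (nhdsWithin 0 (Set.Icc 0 Real.pi)) (nhds 0) := by
      have : Continuous fun x : ℝ => 2 * x := by fun_prop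
      simpa using (this.tendsto 0).mono_left nhdsWithin_le_nhds
    refine tendsto_of_tendsto_of_tendsto_of_le_of_le' tendsto_const_nhds hlim ?_ ?_
    · filter_upwards [self_mem_nhdsWithin] with x hx
      have := Real.sin_nonneg_of_nonneg_of_le_pi hx.1 hx.2
      have h1 := Real.cos_le_one x
      have h2 := hx.1
      exact div_nonneg (by linarith) (by linarith)
    · filter_upwards [self_mem_nhdsWithin] with x hx
      have := Real.sin_nonneg_of_nonneg_of_le_pi hx.1 hx.2
      have h1 := Real.one_sub_sq_div_two_le_cos (x := x)
      have h2 := hx.1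
      refine div_le_of_le_mul₀ (by linarith) (by linarith) ?_
      nlinarith [mul_nonneg h2 this]
  · exact (hasDerivAt_pieceGain h hx.2).continuousAt.continuousWithinAt

/-- The derivative `4 x sin x / (x + sin x)²` is strictly decreasing: after cross-multiplication the
difference at `x < y` factors as `(y sin x - x sin y) (x y - sin x sin y)`, up to the constant `4`,
and both factors are positive. -/
lemma strictConcaveOn_pieceGain : StrictConcaveOn ℝ (Set.Icc 0 Real.pi) pieceGain := by
  refine StrictAntiOn.strictConcaveOn_of_deriv (convex_Icc _ _) continuousOn_pieceGain ?_
  rw [interior_Icc]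
  intro x hx y hy hxy
  rw [(hasDerivAt_pieceGain hx.1 hx.2.le).deriv, (hasDerivAt_pieceGain hy.1 hy.2.le).deriv]
  have h1 := add_sin_pos hx.1 hx.2.le
  have h2 := add_sin_pos hy.1 hy.2.le
  rw [div_lt_div_iff₀ (by positivity) (by positivity)]
  have h3 := mul_sin_lt_mul_sin hx.1 hxy hy.2.le
  have h5 := Real.sin_pos_of_pos_of_lt_pi hy.1 hy.2
  have h6 : Real.sin x * Real.sin y < x * y :=
    mul_lt_mul (Real.sin_lt hx.1) (Real.sin_lt hy.1).le h5 hx.1.le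
  nlinarith [mul_pos (sub_pos.2 h3) (sub_pos.2 h6)]

lemma pieceGain_pos {x : ℝ} (hx : 0 < x) (hx' : x ≤ Real.pi) : 0 < pieceGain x := by
  refine div_pos ?_ (add_sin_pos hx hx')
  have : Real.cos x < Real.cos 0 := Real.cos_lt_cos_of_nonneg_of_le_pi le_rfl hx' hx
  rw [Real.cos_zero] at this
  linarith

lemma sum_pieceGain_le {n : ℕ} (hn : 0 < n) {ℓ : ℕ → ℝ}
    (h0 : ∀ i < n, ℓ i ∈ Set.Icc 0 Real.pi) (hsum : ∑ i ∈ Finset.range n, ℓ i = Real.pi) :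
    ∑ i ∈ Finset.range n, pieceGain (ℓ i) ≤ n * pieceGain (Real.pi / n) ∧
    (∑ i ∈ Finset.range n, pieceGain (ℓ i) = n * pieceGain (Real.pi / n) →
      ∀ i < n, ℓ i = Real.pi / n) := by
  have hn' : (0 : ℝ) < n := by exact_mod_cast hn
  have hw : ∑ i ∈ Finset.range n, (n : ℝ)⁻¹ = 1 := by
    rw [Finset.sum_const, Finset.card_range, nsmul_eq_mul, mul_inv_cancel₀ hn'.ne']
  have hmean : ∑ i ∈ Finset.range n, (n : ℝ)⁻¹ • ℓ i = Real.pi / n := by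
    simp only [smul_eq_mul, ← Finset.mul_sum, hsum]
    field_simp
  have hval : ∑ i ∈ Finset.range n, (n : ℝ)⁻¹ • pieceGain (ℓ i) =
      (n : ℝ)⁻¹ * ∑ i ∈ Finset.range n, pieceGain (ℓ i) := by
    simp only [smul_eq_mul, ← Finset.mul_sum]
  constructor
  · have := strictConcaveOn_pieceGain.concaveOn.le_map_sum (t := Finset.range n)
      (w := fun _ => (n : ℝ)⁻¹) (p := ℓ) (fun _ _ => by positivity) hw
      (fun i hi => h0 i (Finset.mem_range.1 hi))
    rw [hmean, hval, inv_mul_le_iff₀ hn'] at this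
    exact this
  · intro heq i hi
    have := (strictConcaveOn_pieceGain.map_sum_eq_iff_of_pos (t := Finset.range n)
      (w := fun _ => (n : ℝ)⁻¹) (p := ℓ) (fun _ _ => by positivity) hw
      (fun i hi => h0 i (Finset.mem_range.1 hi))).1
      (by rw [hmean, hval, heq]; field_simp)
    have h2 : ∑ k ∈ Finset.range n, ℓ k = ∑ k ∈ Finset.range n, ℓ i :=
      Finset.sum_congr rfl fun k hk => this hk (Finset.mem_range.2 hi)
    rw [hsum, Finset.sum_const, Finset.card_range, nsmul_eq_mul] at h2
    rw [h2]
    field_simp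

/-! ### Piecewise sinusoidal functions -/

/-- `f` is a sinusoid on `[u, v]`, written in terms of the midpoint. -/
def IsSinusoidOn (f : ℝ → ℝ) (u v : ℝ) : Prop :=
  ∃ a b : ℝ, ∀ ω ∈ Set.Icc u v,
    f ω = a * Real.cos (ω - (u + v) / 2) + b * Real.sin (ω - (u + v) / 2)

lemma integral_sinusoid (a b u v : ℝ) :
    ∫ ω in u..v, (a * Real.cos (ω - (u + v) / 2) + b * Real.sin (ω - (u + v) / 2)) =
      2 * a * Real.sin ((v - u) / 2) := by
  rw [intervalIntegral.integral_comp_sub_right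
    (fun x => a * Real.cos x + b * Real.sin x) ((u + v) / 2)]
  rw [intervalIntegral.integral_add (Continuous.intervalIntegrable (by fun_prop) _ _)
    (Continuous.intervalIntegrable (by fun_prop) _ _)]
  simp only [intervalIntegral.integral_const_mul, integral_cos, integral_sin]
  rw [show u - (u + v) / 2 = -((v - u) / 2) by ring, show v - (u + v) / 2 = (v - u) / 2 by ring,
    Real.sin_neg, Real.cos_neg]
  ring

lemma integral_sinusoid_sq (a b u v : ℝ) :
    ∫ ω in u..v, (a * Real.cos (ω - (u + v) / 2) + b * Real.sin (ω - (u + v) / 2)) ^ 2 =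
      a ^ 2 * ((v - u) + Real.sin (v - u)) / 2 + b ^ 2 * ((v - u) - Real.sin (v - u)) / 2 := by
  rw [intervalIntegral.integral_comp_sub_right
    (fun x => (a * Real.cos x + b * Real.sin x) ^ 2) ((u + v) / 2)]
  have h : ∀ x : ℝ, (a * Real.cos x + b * Real.sin x) ^ 2 =
      a ^ 2 * Real.cos x ^ 2 + b ^ 2 * Real.sin x ^ 2 + 2 * a * b * (Real.sin x * Real.cos x) :=
    fun x => by ring
  simp only [h]
  rw [intervalIntegral.integral_add (Continuous.intervalIntegrable (by fun_prop) _ _)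
    (Continuous.intervalIntegrable (by fun_prop) _ _),
    intervalIntegral.integral_add (Continuous.intervalIntegrable (by fun_prop) _ _)
    (Continuous.intervalIntegrable (by fun_prop) _ _)]
  simp only [intervalIntegral.integral_const_mul, integral_cos_sq, integral_sin_sq,
    integral_sin_mul_cos₁]
  rw [show u - (u + v) / 2 = -((v - u) / 2) by ring, show v - (u + v) / 2 = (v - u) / 2 by ring,
    Real.sin_neg, Real.cos_neg]
  have := Real.sin_two_mul ((v - u) / 2)
  rw [show 2 * ((v - u) / 2) = v - u by ring] at this
  rw [this]
  ring

/-- About the midpoint the cosine part is even and the sine part odd. So only the cosine contributes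
to `∫ f`, the two are orthogonal in `∫ f²`, and the expression is a sum of two squares, one in `a`
and one in `b`. The parameter `c` is a multiplier that will be shared by all the pieces, which is
what gives them a common amplitude in the case of equality. -/
lemma sinusoid_piece {f : ℝ → ℝ} {u v : ℝ} (hf : IsSinusoidOn f u v) (huv : u ≤ v)
    (hv : v ≤ u + Real.pi) (c : ℝ) :
    0 ≤ (∫ ω in u..v, f ω ^ 2) - 2 * c * (∫ ω in u..v, f ω) + c ^ 2 * pieceGain (v - u) ∧
    ((∫ ω in u..v, f ω ^ 2) - 2 * c * (∫ ω in u..v, f ω) + c ^ 2 * pieceGain (v - u) = 0 → u < v →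
      ∀ ω ∈ Set.Icc u v, f ω = c * (4 * Real.sin ((v - u) / 2) / ((v - u) + Real.sin (v - u))) *
        Real.cos (ω - (u + v) / 2)) := by
  obtain ⟨a, b, hab⟩ := hf
  have h1 : ∫ ω in u..v, f ω = 2 * a * Real.sin ((v - u) / 2) := by
    rw [← integral_sinusoid a b u v]
    refine intervalIntegral.integral_congr fun ω hω => ?_
    rw [Set.uIcc_of_le huv] at hω
    exact hab ω hω
  have h2 : ∫ ω in u..v, f ω ^ 2 =
      a ^ 2 * ((v - u) + Real.sin (v - u)) / 2 + b ^ 2 * ((v - u) - Real.sin (v - u)) / 2 := by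
    rw [← integral_sinusoid_sq a b u v]
    refine intervalIntegral.integral_congr fun ω hω => ?_
    rw [Set.uIcc_of_le huv] at hω
    simp only [hab ω hω]
  rcases huv.eq_or_lt with rfl | huv
  · simp [pieceGain_zero]
  have hℓ : 0 < v - u := by linarith
  have hs := add_sin_pos hℓ (by linarith)
  have hs' : 0 < v - u - Real.sin (v - u) := by linarith [Real.sin_lt hℓ]
  have hcos : 1 - Real.cos (v - u) = 2 * Real.sin ((v - u) / 2) ^ 2 := by
    have := Real.cos_two_mul ((v - u) / 2)
    rw [show 2 * ((v - u) / 2) = v - u by ring] at this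
    have h3 := Real.sin_sq_add_cos_sq ((v - u) / 2)
    linear_combination -this - 2 * h3
  have key : (∫ ω in u..v, f ω ^ 2) - 2 * c * (∫ ω in u..v, f ω) + c ^ 2 * pieceGain (v - u) =
      ((v - u) + Real.sin (v - u)) / 2 *
        (a - c * (4 * Real.sin ((v - u) / 2) / ((v - u) + Real.sin (v - u)))) ^ 2 +
      (v - u - Real.sin (v - u)) / 2 * b ^ 2 := by
    rw [h1, h2, pieceGain, hcos]
    field_simp
    ring
  rw [key]
  refine ⟨by positivity, fun h0 _ ω hω => ?_⟩
  have h3 : 0 ≤ ((v - u) + Real.sin (v - u)) / 2 *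
        (a - c * (4 * Real.sin ((v - u) / 2) / ((v - u) + Real.sin (v - u)))) ^ 2 := by positivity
  have h4 : 0 ≤ (v - u - Real.sin (v - u)) / 2 * b ^ 2 := by positivity
  have h5 : b ^ 2 = 0 := by
    have : (v - u - Real.sin (v - u)) / 2 * b ^ 2 = 0 := by linarith
    rcases mul_eq_zero.1 this with h | h
    · linarith
    · exact h
  have h6 : (a - c * (4 * Real.sin ((v - u) / 2) / ((v - u) + Real.sin (v - u)))) ^ 2 = 0 := by
    have : ((v - u) + Real.sin (v - u)) / 2 *
        (a - c * (4 * Real.sin ((v - u) / 2) / ((v - u) + Real.sin (v - u)))) ^ 2 = 0 := by linarith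
    rcases mul_eq_zero.1 this with h | h
    · linarith
    · exact h
  rw [hab ω hω, sq_eq_zero_iff.1 h5, sub_eq_zero.1 (sq_eq_zero_iff.1 h6)]
  ring

/-- Cauchy–Schwarz for a continuous function that is sinusoidal on `n` pieces of total length `π`,
with the case of equality. -/
lemma piecewise_sinusoid {n : ℕ} (hn : 0 < n) {f : ℝ → ℝ} (hf : Continuous f) {t : ℕ → ℝ}
    (ht : ∀ i < n, t i ≤ t (i + 1)) (hπ : t n = t 0 + Real.pi)
    (hs : ∀ i < n, IsSinusoidOn f (t i) (t (i + 1))) (hpos : 0 < ∫ ω in t 0..t n, f ω) :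
    (∫ ω in t 0..t n, f ω) ^ 2 ≤ n * pieceGain (Real.pi / n) * ∫ ω in t 0..t n, f ω ^ 2 ∧
    ((∫ ω in t 0..t n, f ω) ^ 2 = n * pieceGain (Real.pi / n) * (∫ ω in t 0..t n, f ω ^ 2) →
      (∀ i < n, t (i + 1) = t i + Real.pi / n) ∧
      ∃ A, ∀ i < n, ∀ ω ∈ Set.Icc (t i) (t (i + 1)),
        f ω = A * Real.cos (ω - (t i + t (i + 1)) / 2)) := by
  have hn' : (0 : ℝ) < n := by exact_mod_cast hn
  have hn1 : (1 : ℝ) ≤ n := by exact_mod_cast hn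
  have hG : 0 < n * pieceGain (Real.pi / n) :=
    mul_pos hn' (pieceGain_pos (by positivity) (div_le_self Real.pi_pos.le hn1))
  set G := n * pieceGain (Real.pi / n)
  set S := ∫ ω in t 0..t n, f ω
  set Q := ∫ ω in t 0..t n, f ω ^ 2
  have hSsum : ∑ i ∈ Finset.range n, ∫ ω in t i..t (i + 1), f ω = S :=
    intervalIntegral.sum_integral_adjacent_intervals fun i _ => hf.intervalIntegrable _ _
  have hQsum : ∑ i ∈ Finset.range n, ∫ ω in t i..t (i + 1), f ω ^ 2 = Q :=
    intervalIntegral.sum_integral_adjacent_intervals fun i _ => (hf.pow 2).intervalIntegrable _ _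
  have hmono : ∀ i j, i ≤ j → j ≤ n → t i ≤ t j := by
    intro i j hij
    induction j, hij using Nat.le_induction with
    | base => intro _; exact le_rfl
    | succ k _ ih => intro hk; exact (ih (by omega)).trans (ht k (by omega))
  have hlen : ∀ i < n, t (i + 1) - t i ∈ Set.Icc 0 Real.pi := fun i hi =>
    ⟨sub_nonneg.2 (ht i hi), by
      have h1 := hmono 0 i (by omega) (by omega)
      have h2 := hmono (i + 1) n (by omega) le_rfl
      linarith⟩
  have hlsum : ∑ i ∈ Finset.range n, (t (i + 1) - t i) = Real.pi := by
    rw [Finset.sum_range_sub, hπ]; ring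
  obtain ⟨hg, hgeq⟩ := sum_pieceGain_le hn hlen hlsum
  -- This value minimizes `Q - 2 * c * S + c ^ 2 * G`, with minimum `Q - S ^ 2 / G`.
  set c := S / G with hc
  have hpiece := fun i (hi : i < n) => sinusoid_piece (hs i hi) (ht i hi)
    (by linarith [(hlen i hi).2]) c
  have hsum : ∑ i ∈ Finset.range n, ((∫ ω in t i..t (i + 1), f ω ^ 2) -
      2 * c * (∫ ω in t i..t (i + 1), f ω) + c ^ 2 * pieceGain (t (i + 1) - t i)) =
      Q - 2 * c * S + c ^ 2 * ∑ i ∈ Finset.range n, pieceGain (t (i + 1) - t i) := by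
    rw [Finset.sum_add_distrib, Finset.sum_sub_distrib, ← Finset.mul_sum, ← Finset.mul_sum,
      hSsum, hQsum]
  have hnonneg : 0 ≤ Q - 2 * c * S +
      c ^ 2 * ∑ i ∈ Finset.range n, pieceGain (t (i + 1) - t i) := by
    rw [← hsum]
    exact Finset.sum_nonneg fun i hi => (hpiece i (Finset.mem_range.1 hi)).1
  have hcomp : Q - 2 * c * S + c ^ 2 * G = Q - S ^ 2 / G := by
    rw [hc]; field_simp; ring
  have hle : c ^ 2 * ∑ i ∈ Finset.range n, pieceGain (t (i + 1) - t i) ≤ c ^ 2 * G := by gcongr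
  constructor
  · have : S ^ 2 / G ≤ Q := by linarith
    rwa [div_le_iff₀ hG, mul_comm] at this
  · intro heq
    have h0 : Q - 2 * c * S + c ^ 2 * G = 0 := by
      rw [hcomp, heq]; field_simp; ring
    -- The nonnegative sum over the pieces is squeezed between `0` and `Q - 2 * c * S + c ^ 2 * G =
    -- 0`. Both Jensen and every piece are then in the case of equality.
    have h1 : c ^ 2 * ∑ i ∈ Finset.range n, pieceGain (t (i + 1) - t i) = c ^ 2 * G := by linarith
    have h2 := hgeq (mul_left_cancel₀ (by positivity) h1)
    refine ⟨fun i hi => by linarith [h2 i hi], c * (4 * Real.sin (Real.pi / n / 2) /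
      (Real.pi / n + Real.sin (Real.pi / n))), fun i hi ω hω => ?_⟩
    have h3 : ∑ i ∈ Finset.range n, ((∫ ω in t i..t (i + 1), f ω ^ 2) -
      2 * c * (∫ ω in t i..t (i + 1), f ω) + c ^ 2 * pieceGain (t (i + 1) - t i)) = 0 := by
      rw [hsum, h1, h0]
    have h4 := (Finset.sum_eq_zero_iff_of_nonneg
      (fun i hi => (hpiece i (Finset.mem_range.1 hi)).1)).1 h3 i (Finset.mem_range.2 hi)
    have h5 := (hpiece i hi).2 h4 (by
      have := h2 i hi
      have : 0 < Real.pi / n := by positivity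
      linarith) ω hω
    rw [h2 i hi] at h5
    exact h5

/-! ### Sums of `|sin|` -/

lemma abs_sin_add_int_mul_pi (x : ℝ) (m : ℤ) : |Real.sin (x + m * Real.pi)| = |Real.sin x| := by
  rw [Real.sin_add_int_mul_pi, abs_mul, abs_zpow, abs_neg, abs_one, one_zpow, one_mul]

/-- `½ ∑ rⱼ |sin (θⱼ - ω)|`. -/
def halfAbsSinSum {n : ℕ} (r θ : Fin n → ℝ) (ω : ℝ) : ℝ :=
  1 / 2 * ∑ j, r j * |Real.sin (θ j - ω)|

lemma continuous_halfAbsSinSum {n : ℕ} (r θ : Fin n → ℝ) : Continuous (halfAbsSinSum r θ) := by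
  unfold halfAbsSinSum
  fun_prop

lemma periodic_halfAbsSinSum {n : ℕ} (r θ : Fin n → ℝ) :
    Function.Periodic (halfAbsSinSum r θ) Real.pi := by
  intro ω
  unfold halfAbsSinSum
  congr 2
  ext j
  rw [show θ j - (ω + Real.pi) = θ j - ω + ((-1 : ℤ) : ℝ) * Real.pi by push_cast; ring,
    abs_sin_add_int_mul_pi]

lemma integral_abs_sin_sub (θ : ℝ) : ∫ ω in (0 : ℝ)..Real.pi, |Real.sin (θ - ω)| = 2 := by
  rw [intervalIntegral.integral_comp_sub_left (fun x => |Real.sin x|) θ]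
  have hper : Function.Periodic (fun x => |Real.sin x|) Real.pi := fun x => by
    simp
  have := hper.intervalIntegral_add_eq (θ - Real.pi) 0
  rw [sub_add_cancel, zero_add] at this
  rw [sub_zero, this]
  have h2 : ∫ x in (0 : ℝ)..Real.pi, Real.sin x = 2 := by
    rw [integral_sin, Real.cos_zero, Real.cos_pi]; norm_num
  rw [← h2]
  refine intervalIntegral.integral_congr fun x hx => ?_
  rw [Set.uIcc_of_le Real.pi_pos.le] at hx
  exact abs_of_nonneg (Real.sin_nonneg_of_mem_Icc hx)

lemma integral_halfAbsSinSum {n : ℕ} (r θ : Fin n → ℝ) :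
    ∫ ω in (0 : ℝ)..Real.pi, halfAbsSinSum r θ ω = ∑ j, r j := by
  unfold halfAbsSinSum
  rw [intervalIntegral.integral_const_mul, intervalIntegral.integral_finsetSum
    (fun j _ => Continuous.intervalIntegrable (by fun_prop) _ _)]
  simp only [intervalIntegral.integral_const_mul, integral_abs_sin_sub]
  rw [← Finset.sum_mul]
  ring

lemma exists_sorted_directions {n : ℕ} (hn : 0 < n) (θ : Fin n → ℝ) :
    ∃ (t : ℕ → ℝ) (σ : Equiv.Perm (Fin n)), (∀ i < n, t i ≤ t (i + 1)) ∧
      t n = t 0 + Real.pi ∧ ∀ j, ∃ m : ℤ, θ j = t (σ j) + m * Real.pi := by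
  set τ : Fin n → ℝ := fun j => toIcoMod Real.pi_pos 0 (θ j)
  have hmem : ∀ j, τ j ∈ Set.Ico 0 Real.pi := fun j => by
    simpa using toIcoMod_mem_Ico Real.pi_pos 0 (θ j)
  have hmono := Tuple.monotone_sort τ
  set ρ := Tuple.sort τ
  -- The directions reduced to `[0, π)` are sorted, and the first one plus `π` is appended to close
  -- the period.
  refine ⟨fun i => if h : i < n then τ (ρ ⟨i, h⟩) else τ (ρ ⟨0, hn⟩) + Real.pi, ρ.symm,
    fun i hi => ?_, by simp [hn], fun j => ⟨toIcoDiv Real.pi_pos 0 (θ j), ?_⟩⟩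
  · simp only [hi, dif_pos]
    split_ifs with h
    · exact hmono (Fin.mk_le_mk.2 (by omega))
    · linarith [(hmem (ρ ⟨i, hi⟩)).2, (hmem (ρ ⟨0, hn⟩)).1]
  · have := toIcoMod_add_toIcoDiv_zsmul Real.pi_pos 0 (θ j)
    rw [zsmul_eq_mul] at this
    simp only [Fin.is_lt, dif_pos, Fin.eta, Equiv.apply_symm_apply]
    exact this.symm

lemma isSinusoidOn_sum {ι : Type*} (s : Finset ι) {f : ι → ℝ → ℝ} {u v : ℝ}
    (h : ∀ i ∈ s, IsSinusoidOn (f i) u v) : IsSinusoidOn (fun ω => ∑ i ∈ s, f i ω) u v := by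
  classical
  induction s using Finset.induction_on with
  | empty => exact ⟨0, 0, by simp⟩
  | insert i s hi ih =>
    obtain ⟨a, b, hab⟩ := ih fun j hj => h j (Finset.mem_insert_of_mem hj)
    obtain ⟨a', b', hab'⟩ := h i (Finset.mem_insert_self i s)
    refine ⟨a' + a, b' + b, fun ω hω => ?_⟩
    have h1 := hab ω hω
    simp only at h1 ⊢
    rw [Finset.sum_insert hi, h1, hab' ω hω]
    ring

lemma isSinusoidOn_const_mul_sin {f : ℝ → ℝ} {u v c p : ℝ}
    (h : ∀ ω ∈ Set.Icc u v, f ω = c * Real.sin (p - ω)) : IsSinusoidOn f u v := by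
  refine ⟨c * Real.sin (p - (u + v) / 2), -(c * Real.cos (p - (u + v) / 2)), fun ω hω => ?_⟩
  rw [h ω hω, show p - ω = (p - (u + v) / 2) - (ω - (u + v) / 2) by ring, Real.sin_sub]
  ring

/-- No direction lies strictly inside a piece, so every `sin (θⱼ - ω)` keeps its sign there; the
sign is decided by whether `σ j` comes after `i`. -/
lemma isSinusoidOn_halfAbsSinSum {n : ℕ} (r : Fin n → ℝ) {θ : Fin n → ℝ} {t : ℕ → ℝ}
    {σ : Equiv.Perm (Fin n)} (ht : ∀ i < n, t i ≤ t (i + 1)) (hπ : t n = t 0 + Real.pi)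
    (hθ : ∀ j, ∃ m : ℤ, θ j = t (σ j) + m * Real.pi) {i : ℕ} (hi : i < n) :
    IsSinusoidOn (halfAbsSinSum r θ) (t i) (t (i + 1)) := by
  have hmono : ∀ i j, i ≤ j → j ≤ n → t i ≤ t j := by
    intro i j hij
    induction j, hij using Nat.le_induction with
    | base => intro _; exact le_rfl
    | succ k _ ih => intro hk; exact (ih (by omega)).trans (ht k (by omega))
  have : halfAbsSinSum r θ = fun ω => ∑ j, 1 / 2 * (r j * |Real.sin (θ j - ω)|) := by
    ext ω; rw [halfAbsSinSum, Finset.mul_sum]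
  rw [this]
  refine isSinusoidOn_sum _ fun j _ => ?_
  obtain ⟨m, hm⟩ := hθ j
  have hlo := hmono 0 i (by omega) (by omega)
  have hhi := hmono (i + 1) n (by omega) le_rfl
  have hs0 := hmono 0 (σ j) (by omega) (σ j).2.le
  have hsn := hmono (σ j) n (σ j).2.le le_rfl
  rcases Nat.lt_or_ge i (σ j) with h | h
  · refine isSinusoidOn_const_mul_sin (c := 1 / 2 * r j) (p := t (σ j)) fun ω hω => ?_
    rw [hm, show t (σ j) + m * Real.pi - ω = t (σ j) - ω + m * Real.pi by ring,
      abs_sin_add_int_mul_pi, abs_of_nonneg (Real.sin_nonneg_of_nonneg_of_le_pi ?_ ?_)]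
    · ring
    · linarith [hmono (i + 1) (σ j) h (σ j).2.le, hω.2]
    · linarith [hω.1]
  · refine isSinusoidOn_const_mul_sin (c := -(1 / 2 * r j)) (p := t (σ j)) fun ω hω => ?_
    rw [hm, show t (σ j) + m * Real.pi - ω = t (σ j) - ω + m * Real.pi by ring,
      abs_sin_add_int_mul_pi, ← abs_neg, ← Real.sin_neg,
      abs_of_nonneg (Real.sin_nonneg_of_nonneg_of_le_pi ?_ ?_), Real.sin_neg]
    · ring
    · linarith [hmono (σ j) i h hi.le, hω.1]
    · linarith [hω.2]

/-- Equally spaced directions: the second difference at a direction only sees its own term. -/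
lemma abs_sin_sub_add_abs_sin_add {n : ℕ} {d : ℤ} (hd : d ≠ 0) (hd' : |d| < n) :
    |Real.sin (d * (Real.pi / n) - Real.pi / n / 2)| +
      |Real.sin (d * (Real.pi / n) + Real.pi / n / 2)| =
      2 * Real.cos (Real.pi / n / 2) * |Real.sin (d * (Real.pi / n))| := by
  have hn : (0 : ℝ) < n := by
    have : (0 : ℤ) < n := (abs_nonneg d).trans_lt hd'
    exact_mod_cast this
  have key : ∀ e : ℤ, 0 < e → e < n → |Real.sin (e * (Real.pi / n) - Real.pi / n / 2)| +
      |Real.sin (e * (Real.pi / n) + Real.pi / n / 2)| =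
      2 * Real.cos (Real.pi / n / 2) * |Real.sin (e * (Real.pi / n))| := by
    intro e he hen
    have h1 : (1 : ℝ) ≤ e := by exact_mod_cast he
    have h2 : (e : ℝ) + 1 ≤ n := by exact_mod_cast hen
    have hp : 0 < Real.pi / n := by positivity
    have h3 : n * (Real.pi / n) = Real.pi := by field_simp
    have h4 : 1 * (Real.pi / n) ≤ e * (Real.pi / n) := by gcongr
    have h5 : (e + 1) * (Real.pi / n) ≤ n * (Real.pi / n) := by gcongr
    rw [abs_of_nonneg (Real.sin_nonneg_of_nonneg_of_le_pi (by linarith) (by linarith)),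
      abs_of_nonneg (Real.sin_nonneg_of_nonneg_of_le_pi (by linarith) (by linarith)),
      abs_of_nonneg (Real.sin_nonneg_of_nonneg_of_le_pi (by linarith) (by linarith)),
      Real.sin_sub, Real.sin_add]
    ring
  rcases lt_or_gt_of_ne hd with h | h
  · have := key (-d) (by omega) (by rw [abs_of_neg h] at hd'; exact hd')
    push_cast at this
    rw [show -(d : ℝ) * (Real.pi / n) - Real.pi / n / 2 =
      -(d * (Real.pi / n) + Real.pi / n / 2) by ring,
      show -(d : ℝ) * (Real.pi / n) + Real.pi / n / 2 =
      -(d * (Real.pi / n) - Real.pi / n / 2) by ring, neg_mul, Real.sin_neg, Real.sin_neg,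
      Real.sin_neg, abs_neg, abs_neg, abs_neg, add_comm] at this
    exact this
  · exact key d h (by rwa [abs_of_pos h] at hd')

/-- In the case of equality the breakpoints are equally spaced with step `ℓ = π / n`, and the sum is
`A` times a cosine about each midpoint. The second difference `f (t + ℓ/2) + f (t - ℓ/2) - 2 cos
(ℓ/2) f t` at the breakpoint of `θⱼ` annihilates every term but the `j`-th, which contributes `rⱼ
sin (ℓ/2)`. For the cosines it equals `2 A sin² (ℓ/2)`; hence `rⱼ = 2 A sin (ℓ/2)` for all `j`. -/
lemma halfAbsSinSum_bound {n : ℕ} (hn : 0 < n) {r θ : Fin n → ℝ} (hr : ∀ j, 0 < r j) :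
    (∫ ω in (0 : ℝ)..Real.pi, halfAbsSinSum r θ ω) ^ 2 ≤
      n * pieceGain (Real.pi / n) * ∫ ω in (0 : ℝ)..Real.pi, halfAbsSinSum r θ ω ^ 2 ∧
    ((∫ ω in (0 : ℝ)..Real.pi, halfAbsSinSum r θ ω) ^ 2 =
      n * pieceGain (Real.pi / n) * (∫ ω in (0 : ℝ)..Real.pi, halfAbsSinSum r θ ω ^ 2) →
      ∃ (s β : ℝ) (σ : Equiv.Perm (Fin n)), 0 < s ∧
        ∀ j, r j = s ∧ ∃ m : ℤ, θ j = β + (σ j : ℕ) * (Real.pi / n) + m * Real.pi) := by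
  obtain ⟨t, σ, ht, hπ, hθ⟩ := exists_sorted_directions hn θ
  have hper := periodic_halfAbsSinSum r θ
  have hper2 : Function.Periodic (fun ω => halfAbsSinSum r θ ω ^ 2) Real.pi := fun ω => by
    simp only [hper ω]
  have e1 : ∫ ω in (0 : ℝ)..Real.pi, halfAbsSinSum r θ ω =
      ∫ ω in t 0..t n, halfAbsSinSum r θ ω := by
    have := hper.intervalIntegral_add_eq 0 (t 0)
    rwa [zero_add, ← hπ] at this
  have e2 : ∫ ω in (0 : ℝ)..Real.pi, halfAbsSinSum r θ ω ^ 2 =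
      ∫ ω in t 0..t n, halfAbsSinSum r θ ω ^ 2 := by
    have := hper2.intervalIntegral_add_eq 0 (t 0)
    rwa [zero_add, ← hπ] at this
  have hpos : 0 < ∫ ω in t 0..t n, halfAbsSinSum r θ ω := by
    rw [← e1, integral_halfAbsSinSum]
    have : Nonempty (Fin n) := ⟨⟨0, hn⟩⟩
    exact Finset.sum_pos (fun j _ => hr j) Finset.univ_nonempty
  obtain ⟨hle, heq⟩ := piecewise_sinusoid hn (continuous_halfAbsSinSum r θ) ht hπ
    (fun i hi => isSinusoidOn_halfAbsSinSum r ht hπ hθ hi) hpos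
  rw [e1, e2]
  refine ⟨hle, fun h => ?_⟩
  obtain ⟨hstep, A, hA⟩ := heq h
  have hℓ : 0 < Real.pi / n := by positivity
  have hℓ' : Real.pi / n ≤ Real.pi := div_le_self Real.pi_pos.le (by exact_mod_cast hn)
  have htn : ∀ i ≤ n, t i = t 0 + i * (Real.pi / n) := by
    intro i
    induction i with
    | zero => simp
    | succ k ih => intro hk; rw [hstep k (by omega), ih (by omega)]; push_cast; ring
  have hsin : 0 < Real.sin (Real.pi / n / 2) :=
    Real.sin_pos_of_pos_of_lt_pi (by linarith) (by linarith)
  have hright : ∀ i < n, halfAbsSinSum r θ (t i + Real.pi / n / 2) = A := by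
    intro i hi
    rw [hA i hi _ ⟨by linarith, by linarith [hstep i hi]⟩, hstep i hi,
      show t i + Real.pi / n / 2 - (t i + (t i + Real.pi / n)) / 2 = 0 by ring, Real.cos_zero,
      mul_one]
  have hleft : ∀ i < n, halfAbsSinSum r θ (t i - Real.pi / n / 2) = A := by
    intro i hi
    rcases Nat.eq_zero_or_pos i with rfl | h0
    -- To the left of the first breakpoint, periodicity leads back to the last piece.
    · rw [← hper, ← hright (n - 1) (by omega)]
      congr 1
      have := hstep (n - 1) (by omega)
      rw [Nat.sub_add_cancel hn] at this
      linarith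
    · rw [← hright (i - 1) (by omega)]
      congr 1
      have := hstep (i - 1) (by omega)
      rw [Nat.sub_add_cancel h0] at this
      linarith
  have hat : ∀ i < n, halfAbsSinSum r θ (t i) = A * Real.cos (Real.pi / n / 2) := by
    intro i hi
    rw [hA i hi _ ⟨le_rfl, ht i hi⟩, hstep i hi,
      show t i - (t i + (t i + Real.pi / n)) / 2 = -(Real.pi / n / 2) by ring, Real.cos_neg]
  have hr2 : ∀ j, r j = 2 * A * Real.sin (Real.pi / n / 2) := by
    intro j
    have h1 := hright (σ j) (σ j).2
    have h2 := hleft (σ j) (σ j).2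
    have h3 := hat (σ j) (σ j).2
    have hterm : ∀ k ≠ j, r k * |Real.sin (θ k - (t (σ j) + Real.pi / n / 2))| +
        r k * |Real.sin (θ k - (t (σ j) - Real.pi / n / 2))| -
        2 * Real.cos (Real.pi / n / 2) * (r k * |Real.sin (θ k - t (σ j))|) = 0 := by
      intro k hk
      obtain ⟨m, hm⟩ := hθ k
      have hne : ((σ k : ℕ) : ℤ) - (σ j : ℕ) ≠ 0 := by
        intro h
        exact hk (σ.injective (Fin.ext (by omega)))
      have hlt : |((σ k : ℕ) : ℤ) - (σ j : ℕ)| < n := by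
        rw [abs_lt]; omega
      have := abs_sin_sub_add_abs_sin_add hne hlt
      push_cast at this
      rw [hm, htn _ (σ k).2.le, htn _ (σ j).2.le,
        show t 0 + (σ k : ℕ) * (Real.pi / n) + m * Real.pi -
          (t 0 + (σ j : ℕ) * (Real.pi / n) + Real.pi / n / 2) =
          (((σ k : ℕ) : ℝ) - (σ j : ℕ)) * (Real.pi / n) - Real.pi / n / 2 + m * Real.pi by ring,
        show t 0 + (σ k : ℕ) * (Real.pi / n) + m * Real.pi -
          (t 0 + (σ j : ℕ) * (Real.pi / n) - Real.pi / n / 2) =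
          (((σ k : ℕ) : ℝ) - (σ j : ℕ)) * (Real.pi / n) + Real.pi / n / 2 + m * Real.pi by ring,
        show t 0 + (σ k : ℕ) * (Real.pi / n) + m * Real.pi -
          (t 0 + (σ j : ℕ) * (Real.pi / n)) =
          (((σ k : ℕ) : ℝ) - (σ j : ℕ)) * (Real.pi / n) + m * Real.pi by ring,
        abs_sin_add_int_mul_pi, abs_sin_add_int_mul_pi, abs_sin_add_int_mul_pi]
      linear_combination r k * this
    have hself : r j * |Real.sin (θ j - (t (σ j) + Real.pi / n / 2))| +
        r j * |Real.sin (θ j - (t (σ j) - Real.pi / n / 2))| -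
        2 * Real.cos (Real.pi / n / 2) * (r j * |Real.sin (θ j - t (σ j))|) =
        2 * r j * Real.sin (Real.pi / n / 2) := by
      obtain ⟨m, hm⟩ := hθ j
      rw [hm, show t (σ j) + m * Real.pi - (t (σ j) + Real.pi / n / 2) =
          -(Real.pi / n / 2) + m * Real.pi by ring,
        show t (σ j) + m * Real.pi - (t (σ j) - Real.pi / n / 2) =
          Real.pi / n / 2 + m * Real.pi by ring,
        show t (σ j) + m * Real.pi - t (σ j) = 0 + m * Real.pi by ring,
        abs_sin_add_int_mul_pi, abs_sin_add_int_mul_pi, abs_sin_add_int_mul_pi, Real.sin_neg,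
        abs_neg, abs_of_pos hsin, Real.sin_zero, abs_zero]
      ring
    have hsum := Finset.sum_eq_single_of_mem (s := Finset.univ)
      (f := fun k => r k * |Real.sin (θ k - (t (σ j) + Real.pi / n / 2))| +
        r k * |Real.sin (θ k - (t (σ j) - Real.pi / n / 2))| -
        2 * Real.cos (Real.pi / n / 2) * (r k * |Real.sin (θ k - t (σ j))|)) j
      (Finset.mem_univ j) (fun k _ hk => hterm k hk)
    rw [hself, Finset.sum_sub_distrib, Finset.sum_add_distrib, ← Finset.mul_sum] at hsum
    simp only [halfAbsSinSum] at h1 h2 h3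
    have h4 := Real.sin_sq_add_cos_sq (Real.pi / n / 2)
    refine mul_right_cancel₀ hsin.ne' ?_
    linear_combination (-1 / 2) * hsum + h1 + h2 - 2 * Real.cos (Real.pi / n / 2) * h3 -
      2 * A * h4
  have j0 : Fin n := ⟨0, hn⟩
  refine ⟨_, t 0, σ, (hr2 j0) ▸ hr j0, fun j => ⟨hr2 j, ?_⟩⟩
  obtain ⟨m, hm⟩ := hθ j
  exact ⟨m, by rw [hm, htn _ (σ j).2.le]⟩

/-! ### Equally spaced directions -/

/-- Modulo `π` the direction `k = 0` may be replaced by `k = n`; then all the sines are nonnegative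
on the interval, and multiplying by `sin (π / (2n))` makes the sum telescope. -/
lemma sum_abs_sin_equally_spaced {n : ℕ} (hn : 0 < n) (β : ℝ) {ω : ℝ}
    (hω : ω ∈ Set.Icc β (β + Real.pi / n)) :
    Real.sin (Real.pi / n / 2) * ∑ k ∈ Finset.range n, |Real.sin (β + k * (Real.pi / n) - ω)| =
      Real.cos (ω - (β + (β + Real.pi / n)) / 2) := by
  have hn' : (0 : ℝ) < n := by exact_mod_cast hn
  have hp : 0 < Real.pi / n := by positivity
  have h3 : n * (Real.pi / n) = Real.pi := by field_simp
  have h1 : ∑ k ∈ Finset.range n, |Real.sin (β + k * (Real.pi / n) - ω)| =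
      ∑ k ∈ Finset.range n, Real.sin (β + (k + 1 : ℕ) * (Real.pi / n) - ω) := by
    obtain ⟨m, rfl⟩ := Nat.exists_eq_succ_of_ne_zero hn.ne'
    rw [Finset.sum_range_succ', Finset.sum_range_succ]
    congr 1
    · refine Finset.sum_congr rfl fun k hk => abs_of_nonneg ?_
      rw [Finset.mem_range] at hk
      have h4 : (k : ℝ) + 1 + 1 ≤ (m + 1 : ℕ) := by exact_mod_cast Nat.succ_le_succ hk
      have h5 := mul_le_mul_of_nonneg_right h4 hp.le
      have h6 : 0 ≤ (k : ℝ) * (Real.pi / (m + 1 : ℕ)) := by positivity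
      refine Real.sin_nonneg_of_nonneg_of_le_pi ?_ ?_
      · push_cast at *; linarith [hω.2]
      · push_cast at *; linarith [hω.1]
    · rw [h3, show β + ((0 : ℕ) : ℝ) * (Real.pi / (m + 1 : ℕ)) - ω = -(ω - β) by push_cast; ring,
        show β + Real.pi - ω = Real.pi - (ω - β) by ring, Real.sin_pi_sub, Real.sin_neg, abs_neg,
        abs_of_nonneg]
      refine Real.sin_nonneg_of_nonneg_of_le_pi (by linarith [hω.1]) ?_
      have : Real.pi / (m + 1 : ℕ) ≤ Real.pi :=
        div_le_self Real.pi_pos.le (by exact_mod_cast Nat.succ_pos m)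
      linarith [hω.2]
  have h2 : ∀ k ∈ Finset.range n, Real.sin (Real.pi / n / 2) *
      Real.sin (β + (k + 1 : ℕ) * (Real.pi / n) - ω) =
      (-1 / 2 * Real.cos (β - ω + ((k + 1 : ℕ) : ℝ) * (Real.pi / n) + Real.pi / n / 2)) -
      (-1 / 2 * Real.cos (β - ω + (k : ℝ) * (Real.pi / n) + Real.pi / n / 2)) := by
    intro k _
    rw [show β - ω + (k : ℝ) * (Real.pi / n) + Real.pi / n / 2 =
      (β + (k + 1 : ℕ) * (Real.pi / n) - ω) - Real.pi / n / 2 by push_cast; ring,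
      show β - ω + ((k + 1 : ℕ) : ℝ) * (Real.pi / n) + Real.pi / n / 2 =
      (β + (k + 1 : ℕ) * (Real.pi / n) - ω) + Real.pi / n / 2 by ring]
    generalize β + (k + 1 : ℕ) * (Real.pi / n) - ω = x
    rw [Real.cos_add, Real.cos_sub]
    ring
  rw [h1, Finset.mul_sum, Finset.sum_congr rfl h2, Finset.sum_range_sub
    (fun k : ℕ => -1 / 2 * Real.cos (β - ω + (k : ℝ) * (Real.pi / n) + Real.pi / n / 2)), h3,
    show β - ω + Real.pi + Real.pi / n / 2 = (β - ω + Real.pi / n / 2) + Real.pi by ring,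
    Real.cos_add_pi, show ω - (β + (β + Real.pi / n)) / 2 = -(β - ω + Real.pi / n / 2) by ring,
    Real.cos_neg]
  simp
  ring

lemma periodic_sum_abs_sin_equally_spaced {n : ℕ} (hn : 0 < n) (β : ℝ) :
    Function.Periodic
      (fun ω => ∑ k ∈ Finset.range n, |Real.sin (β + k * (Real.pi / n) - ω)|) (Real.pi / n) := by
  intro ω
  have hn' : (0 : ℝ) < n := by exact_mod_cast hn
  have h3 : n * (Real.pi / n) = Real.pi := by field_simp
  obtain ⟨m, rfl⟩ := Nat.exists_eq_succ_of_ne_zero hn.ne'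
  simp only
  rw [Finset.sum_range_succ', Finset.sum_range_succ]
  congr 1
  · refine Finset.sum_congr rfl fun k _ => ?_
    congr 2
    push_cast
    ring
  · rw [← abs_sin_add_int_mul_pi _ 1]
    congr 2
    push_cast at h3 ⊢
    linarith

/-- Converse of the case of equality: the sum is `π / n`-periodic and a pure cosine on one period,
so no inequality above loses anything. -/
lemma halfAbsSinSum_equally_spaced {n : ℕ} (hn : 0 < n) {r θ : Fin n → ℝ} {s β : ℝ}
    {σ : Equiv.Perm (Fin n)}
    (h : ∀ j, r j = s ∧ ∃ m : ℤ, θ j = β + (σ j : ℕ) * (Real.pi / n) + m * Real.pi) :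
    (∫ ω in (0 : ℝ)..Real.pi, halfAbsSinSum r θ ω) ^ 2 =
      n * pieceGain (Real.pi / n) * ∫ ω in (0 : ℝ)..Real.pi, halfAbsSinSum r θ ω ^ 2 := by
  have hn' : (0 : ℝ) < n := by exact_mod_cast hn
  have hℓ : 0 < Real.pi / n := by positivity
  have hℓ' : Real.pi / n ≤ Real.pi := div_le_self Real.pi_pos.le (by exact_mod_cast hn)
  have hsin : 0 < Real.sin (Real.pi / n / 2) :=
    Real.sin_pos_of_pos_of_lt_pi (by linarith) (by linarith)
  have hX : ∀ ω, halfAbsSinSum r θ ω =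
      1 / 2 * s * ∑ k ∈ Finset.range n, |Real.sin (β + k * (Real.pi / n) - ω)| := by
    intro ω
    have : ∑ j, r j * |Real.sin (θ j - ω)| =
        ∑ j, s * |Real.sin (β + (σ j : ℕ) * (Real.pi / n) - ω)| := by
      refine Finset.sum_congr rfl fun j _ => ?_
      obtain ⟨h1, m, h2⟩ := h j
      rw [h1, h2, show β + (σ j : ℕ) * (Real.pi / n) + m * Real.pi - ω =
        β + (σ j : ℕ) * (Real.pi / n) - ω + m * Real.pi by ring, abs_sin_add_int_mul_pi]
    rw [halfAbsSinSum, this, Equiv.sum_comp σ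
      (fun k : Fin n => s * |Real.sin (β + (k : ℕ) * (Real.pi / n) - ω)|), ← Finset.mul_sum,
      Fin.sum_univ_eq_sum_range (fun k : ℕ => |Real.sin (β + k * (Real.pi / n) - ω)|)]
    ring
  have hper : Function.Periodic (halfAbsSinSum r θ) (Real.pi / n) := fun ω => by
    rw [hX, hX]
    exact congrArg _ (periodic_sum_abs_sin_equally_spaced hn β ω)
  have hper2 : Function.Periodic (fun ω => halfAbsSinSum r θ ω ^ 2) (Real.pi / n) := fun ω => by
    simp only [hper ω]
  set a := 1 / 2 * s / Real.sin (Real.pi / n / 2) with ha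
  have hpiece : ∀ ω ∈ Set.Icc β (β + Real.pi / n), halfAbsSinSum r θ ω =
      a * Real.cos (ω - (β + (β + Real.pi / n)) / 2) +
      0 * Real.sin (ω - (β + (β + Real.pi / n)) / 2) := by
    intro ω hω
    rw [hX, ← sum_abs_sin_equally_spaced hn β hω, ha, zero_mul, add_zero, ← mul_assoc,
      div_mul_cancel₀ _ hsin.ne']
  have shift : ∀ f : ℝ → ℝ, Continuous f → Function.Periodic f (Real.pi / n) →
      ∫ ω in (0 : ℝ)..Real.pi, f ω = n * ∫ ω in β..β + Real.pi / n, f ω := by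
    intro f hc hf
    have := hf.intervalIntegral_add_zsmul_eq n 0
    rw [zero_add, natCast_zsmul, nsmul_eq_mul, mul_div_cancel₀ _ hn'.ne', natCast_zsmul,
      nsmul_eq_mul] at this
    rw [this fun _ _ => hc.intervalIntegrable _ _, hf.intervalIntegral_add_eq 0 β]
  have i1 : ∫ ω in β..β + Real.pi / n, halfAbsSinSum r θ ω =
      2 * a * Real.sin (Real.pi / n / 2) := by
    have := integral_sinusoid a 0 β (β + Real.pi / n)
    rw [add_sub_cancel_left] at this
    rw [← this]
    refine intervalIntegral.integral_congr fun ω hω => ?_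
    rw [Set.uIcc_of_le (by linarith)] at hω
    exact hpiece ω hω
  have i2 : ∫ ω in β..β + Real.pi / n, halfAbsSinSum r θ ω ^ 2 =
      a ^ 2 * (Real.pi / n + Real.sin (Real.pi / n)) / 2 := by
    have := integral_sinusoid_sq a 0 β (β + Real.pi / n)
    rw [add_sub_cancel_left] at this
    rw [show a ^ 2 * (Real.pi / n + Real.sin (Real.pi / n)) / 2 =
      a ^ 2 * (Real.pi / n + Real.sin (Real.pi / n)) / 2 +
        0 ^ 2 * (Real.pi / n - Real.sin (Real.pi / n)) / 2 by ring, ← this]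
    refine intervalIntegral.integral_congr fun ω hω => ?_
    rw [Set.uIcc_of_le (by linarith)] at hω
    simp only [hpiece ω hω]
  have hc := continuous_halfAbsSinSum r θ
  rw [shift _ hc hper, shift (fun ω => halfAbsSinSum r θ ω ^ 2) (hc.pow 2) hper2, i1, i2, pieceGain]
  have hcos : 1 - Real.cos (Real.pi / n) = 2 * Real.sin (Real.pi / n / 2) ^ 2 := by
    have := Real.cos_two_mul (Real.pi / n / 2)
    rw [show 2 * (Real.pi / n / 2) = Real.pi / n by ring] at this
    have h3 := Real.sin_sq_add_cos_sq (Real.pi / n / 2)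
    linear_combination -this - 2 * h3
  have hs := add_sin_pos hℓ hℓ'
  rw [hcos]
  generalize Real.sin (Real.pi / n / 2) = S at *
  generalize Real.pi / n + Real.sin (Real.pi / n) = T at *
  field_simp
  ring

/-! ### The deviation rate of a polygon -/

lemma sum_edge {n : ℕ} (α : Fin n → ℂ) : ∑ j, edge α j = 0 := by
  unfold edge
  rw [Finset.sum_sub_distrib, Equiv.sum_comp (finRotate n) α, sub_self]

lemma norm_mul_sin_arg_sub (z : ℂ) (ω : ℝ) :
    ‖z‖ * Real.sin (z.arg - ω) = z.im * Real.cos ω - z.re * Real.sin ω := by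
  rw [Real.sin_sub]
  linear_combination Real.cos ω * Complex.norm_mul_sin_arg z -
    Real.sin ω * Complex.norm_mul_cos_arg z

/-- Write `max x 0 = (|x| + x) / 2`; the linear parts cancel because the polygon closes up. -/
lemma polygonWidth_eq {n : ℕ} (α : Fin n → ℂ) :
    polygonWidth α = halfAbsSinSum (fun j => ‖edge α j‖) (fun j => (edge α j).arg) := by
  ext ω
  have h0 : ∑ j, ‖edge α j‖ * Real.sin ((edge α j).arg - ω) = 0 := by
    simp only [norm_mul_sin_arg_sub]
    rw [Finset.sum_sub_distrib, ← Finset.sum_mul, ← Finset.sum_mul, ← Complex.im_sum,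
      ← Complex.re_sum, sum_edge]
    simp
  have h1 : ∀ j, vectorShadow (edge α j) ω =
      1 / 2 * (‖edge α j‖ * |Real.sin ((edge α j).arg - ω)|) +
      1 / 2 * (‖edge α j‖ * Real.sin ((edge α j).arg - ω)) := by
    intro j
    have : ∀ x : ℝ, max x 0 = 1 / 2 * |x| + 1 / 2 * x := fun x => by
      rcases le_total 0 x with h | h
      · rw [max_eq_left h, abs_of_nonneg h]; ring
      · rw [max_eq_right h, abs_of_nonpos h]; ring
    rw [vectorShadow, this]
    ring
  rw [polygonWidth, Finset.sum_congr rfl fun j _ => h1 j, Finset.sum_add_distrib,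
    ← Finset.mul_sum, ← Finset.mul_sum, h0, mul_zero, add_zero, halfAbsSinSum]

lemma IsConvexNGon.edge_ne_zero {n : ℕ} {α : Fin n → ℂ} (h : IsConvexNGon α) (j : Fin n) :
    edge α j ≠ 0 := by
  obtain ⟨m, rfl⟩ : ∃ m, n = m + 2 := ⟨n - 2, by have := h.two_le; omega⟩
  intro h0
  have h1 := h.injective (sub_eq_zero.1 h0)
  rw [finRotate_apply] at h1
  simp at h1

/-- All edges have the same length, and their directions modulo `π` are equally spaced. -/
def IsEquidirected {n : ℕ} (α : Fin n → ℂ) : Prop :=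
  ∃ (s β : ℝ) (σ : Equiv.Perm (Fin n)), 0 < s ∧ ∀ j, ∃ m : ℤ,
    edge α j = s * Complex.exp (((β + (σ j : ℕ) * (Real.pi / n) + m * Real.pi : ℝ) : ℂ) *
      Complex.I)

lemma eq_norm_and_arg {z : ℂ} {s x : ℝ} (hs : 0 < s)
    (h : z = s * Complex.exp ((x : ℂ) * Complex.I)) :
    ‖z‖ = s ∧ ∃ m : ℤ, z.arg = x + m * (2 * Real.pi) := by
  have hn : ‖z‖ = s := by
    rw [h, norm_mul, Complex.norm_exp_ofReal_mul_I, mul_one, Complex.norm_real, Real.norm_eq_abs,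
      abs_of_pos hs]
  refine ⟨hn, ?_⟩
  have h2 := Complex.norm_mul_exp_arg_mul_I z
  rw [hn] at h2
  have h3 : Complex.exp (z.arg * Complex.I) = Complex.exp (x * Complex.I) :=
    mul_left_cancel₀ (Complex.ofReal_ne_zero.2 hs.ne') (h2.trans h)
  obtain ⟨m, hm⟩ := Complex.exp_eq_exp_iff_exists_int.1 h3
  refine ⟨m, ?_⟩
  have h4 := congrArg Complex.im hm
  simpa using h4

lemma isEquidirected_iff {n : ℕ} (α : Fin n → ℂ) :
    IsEquidirected α ↔ ∃ (s β : ℝ) (σ : Equiv.Perm (Fin n)), 0 < s ∧ ∀ j, ‖edge α j‖ = s ∧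
      ∃ m : ℤ, (edge α j).arg = β + (σ j : ℕ) * (Real.pi / n) + m * Real.pi := by
  constructor
  · rintro ⟨s, β, σ, hs, h⟩
    refine ⟨s, β, σ, hs, fun j => ?_⟩
    obtain ⟨m, hm⟩ := h j
    obtain ⟨h1, k, hk⟩ := eq_norm_and_arg hs hm
    exact ⟨h1, m + 2 * k, by rw [hk]; push_cast; ring⟩
  · rintro ⟨s, β, σ, hs, h⟩
    refine ⟨s, β, σ, hs, fun j => ?_⟩
    obtain ⟨h1, m, hm⟩ := h j
    exact ⟨m, by rw [← hm, ← h1, Complex.norm_mul_exp_arg_mul_I]⟩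

lemma expectation_of_periodic {f : ℝ → ℝ} (hf : Continuous f)
    (hper : Function.Periodic f Real.pi) :
    expectation f = Real.pi⁻¹ * ∫ ω in (0 : ℝ)..Real.pi, f ω := by
  have h := hper.intervalIntegral_add_zsmul_eq 2 (-Real.pi) fun _ _ => hf.intervalIntegrable _ _
  rw [hper.intervalIntegral_add_eq (-Real.pi) 0, zero_add] at h
  have h2 : -Real.pi + (2 : ℤ) • Real.pi = Real.pi := by simp; ring
  rw [h2] at h
  rw [expectation, h]
  have := Real.pi_pos
  simp
  field_simp

lemma sq_expectation_le {f : ℝ → ℝ} (hf : Continuous f) :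
    expectation f ^ 2 ≤ expectation (fun ω => f ω ^ 2) := by
  have hpi := Real.pi_pos
  set c := expectation f with hc
  have hI : ∫ ω in (-Real.pi)..Real.pi, f ω = 2 * Real.pi * c := by
    rw [hc, expectation]; field_simp
  have h1 : 0 ≤ ∫ ω in (-Real.pi)..Real.pi, (f ω - c) ^ 2 :=
    intervalIntegral.integral_nonneg (by linarith) fun _ _ => sq_nonneg _
  have h2 : ∫ ω in (-Real.pi)..Real.pi, (f ω - c) ^ 2 =
      (∫ ω in (-Real.pi)..Real.pi, f ω ^ 2) - 2 * Real.pi * c ^ 2 := by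
    have : ∀ ω, (f ω - c) ^ 2 = f ω ^ 2 - (2 * c * f ω - c ^ 2) := fun ω => by ring
    simp only [this]
    rw [intervalIntegral.integral_sub (Continuous.intervalIntegrable (by fun_prop) _ _)
      (Continuous.intervalIntegrable (by fun_prop) _ _),
      intervalIntegral.integral_sub (Continuous.intervalIntegrable (by fun_prop) _ _)
      (Continuous.intervalIntegrable (by fun_prop) _ _), intervalIntegral.integral_const_mul, hI,
      intervalIntegral.integral_const]
    simp
    ring
  rw [expectation, le_inv_mul_iff₀ (by positivity)]
  linarith

lemma deviationRate_eq {f : ℝ → ℝ} (hpos : 0 < expectation f) :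
    deviationRate f =
      Real.sqrt (expectation (fun ω => f ω ^ 2) / expectation f ^ 2 - 1) := by
  have h1 : expectation (fun ω => f ω ^ 2) / expectation f ^ 2 - 1 =
      (expectation (fun ω => f ω ^ 2) - expectation f ^ 2) / expectation f ^ 2 := by field_simp
  rw [deviationRate, h1, Real.sqrt_div' _ (sq_nonneg _), Real.sqrt_sq hpos.le]

/-- The extremal value of `E(X²) / E(X)²`. -/
def minMomentRatio (n : ℕ) : ℝ := Real.pi / (n * pieceGain (Real.pi / n))

lemma momentRatio_bound {n : ℕ} {α : Fin n → ℂ} (hn : 0 < n) (h : ∀ j, edge α j ≠ 0) :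
    0 < expectation (polygonWidth α) ∧ minMomentRatio n ≤
      expectation (fun ω => polygonWidth α ω ^ 2) / expectation (polygonWidth α) ^ 2 ∧
    (minMomentRatio n =
      expectation (fun ω => polygonWidth α ω ^ 2) / expectation (polygonWidth α) ^ 2 ↔
      IsEquidirected α) := by
  have hpi := Real.pi_pos
  have hn' : (0 : ℝ) < n := by exact_mod_cast hn
  have hG : 0 < n * pieceGain (Real.pi / n) :=
    mul_pos hn' (pieceGain_pos (by positivity)
      (div_le_self hpi.le (by exact_mod_cast hn)))
  have hr : ∀ j, 0 < ‖edge α j‖ := fun j => norm_pos_iff.2 (h j)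
  obtain ⟨hle, heq⟩ := halfAbsSinSum_bound hn (θ := fun j => (edge α j).arg) hr
  rw [isEquidirected_iff, polygonWidth_eq]
  have hpos := integral_halfAbsSinSum (fun j => ‖edge α j‖) (fun j => (edge α j).arg)
  have hc := continuous_halfAbsSinSum (fun j => ‖edge α j‖) (fun j => (edge α j).arg)
  have hper := periodic_halfAbsSinSum (fun j => ‖edge α j‖) (fun j => (edge α j).arg)
  have hc2 : Continuous (fun ω => halfAbsSinSum (fun j => ‖edge α j‖)
      (fun j => (edge α j).arg) ω ^ 2) := hc.pow 2
  have hper2 : Function.Periodic (fun ω => halfAbsSinSum (fun j => ‖edge α j‖)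
      (fun j => (edge α j).arg) ω ^ 2) Real.pi := fun ω => by simp only [hper ω]
  have hconv := fun s β σ => halfAbsSinSum_equally_spaced hn (r := fun j => ‖edge α j‖)
    (θ := fun j => (edge α j).arg) (s := s) (β := β) (σ := σ)
  rw [expectation_of_periodic hc hper, expectation_of_periodic hc2 hper2]
  have hpos' : 0 < ∑ j, ‖edge α j‖ := by
    have : Nonempty (Fin n) := ⟨⟨0, hn⟩⟩
    exact Finset.sum_pos (fun j _ => hr j) Finset.univ_nonempty
  rw [← hpos] at hpos'
  set I := ∫ ω in (0 : ℝ)..Real.pi, halfAbsSinSum (fun j => ‖edge α j‖)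
      (fun j => (edge α j).arg) ω
  set Q := ∫ ω in (0 : ℝ)..Real.pi, halfAbsSinSum (fun j => ‖edge α j‖)
      (fun j => (edge α j).arg) ω ^ 2
  have hratio : Real.pi⁻¹ * Q / (Real.pi⁻¹ * I) ^ 2 = Real.pi * Q / I ^ 2 := by field_simp
  rw [hratio, minMomentRatio]
  refine ⟨by positivity, ?_, ?_⟩
  · rw [div_le_div_iff₀ hG (by positivity)]
    nlinarith
  · rw [div_eq_div_iff hG.ne' (by positivity)]
    constructor
    · intro h1
      exact heq (mul_left_cancel₀ hpi.ne' (by linarith))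
    · rintro ⟨s, β, σ, -, h2⟩
      rw [hconv s β σ h2]; ring

lemma deviationRate_le_of_isEquidirected {n : ℕ} {α β : Fin n → ℂ} (hα : IsConvexNGon α)
    (he : IsEquidirected α) (hβ : IsConvexNGon β) :
    deviationRate (polygonWidth α) ≤ deviationRate (polygonWidth β) := by
  have hn : 0 < n := by have := hα.two_le; omega
  obtain ⟨h1, -, h2⟩ := momentRatio_bound hn hα.edge_ne_zero
  obtain ⟨h3, h4, -⟩ := momentRatio_bound hn hβ.edge_ne_zero
  rw [deviationRate_eq h1, deviationRate_eq h3, ← h2.2 he]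
  exact Real.sqrt_le_sqrt (by linarith)

lemma isEquidirected_of_deviationRate_le {n : ℕ} {α β : Fin n → ℂ} (hα : IsConvexNGon α)
    (he : IsEquidirected α) (hβ : IsConvexNGon β)
    (hle : deviationRate (polygonWidth β) ≤ deviationRate (polygonWidth α)) :
    IsEquidirected β := by
  have hn : 0 < n := by have := hα.two_le; omega
  obtain ⟨h1, -, h2⟩ := momentRatio_bound hn hα.edge_ne_zero
  obtain ⟨h3, h4, h5⟩ := momentRatio_bound hn hβ.edge_ne_zero
  rw [deviationRate_eq h1, deviationRate_eq h3, Real.sqrt_le_sqrt_iff, ← h2.2 he] at hle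
  · exact h5.1 (by linarith)
  -- Cancelling the square roots needs a nonnegative radicand, which is the inequality `E(X)² ≤
  -- E(X²)`.
  · have hc : Continuous (polygonWidth α) := by
      rw [polygonWidth_eq]; exact continuous_halfAbsSinSum _ _
    have := sq_expectation_le hc
    rw [sub_nonneg, one_le_div (by positivity)]
    exact this

/-! ### Components in a direction -/

/-- The component of `z` along the unit vector `exp(iφ)`. -/
def component (z : ℂ) (φ : ℝ) : ℝ := z.re * Real.cos φ + z.im * Real.sin φ

lemma re_mul_exp_neg (z : ℂ) (φ : ℝ) :
    (z * Complex.exp (-(φ * Complex.I))).re = component z φ := by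
  rw [← neg_mul, ← Complex.ofReal_neg, Complex.mul_re, Complex.exp_ofReal_mul_I_re,
    Complex.exp_ofReal_mul_I_im, Real.cos_neg, Real.sin_neg, component]
  ring

lemma component_add (z w : ℂ) (φ : ℝ) : component (z + w) φ = component z φ + component w φ := by
  simp only [component, Complex.add_re, Complex.add_im]; ring

lemma component_sub (z w : ℂ) (φ : ℝ) : component (z - w) φ = component z φ - component w φ := by
  simp only [component, Complex.sub_re, Complex.sub_im]; ring

lemma component_add_pi (z : ℂ) (φ : ℝ) : component z (φ + Real.pi) = -component z φ := by
  simp only [component, Real.cos_add_pi, Real.sin_add_pi]; ring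

lemma component_add_int_mul_two_pi (z : ℂ) (φ : ℝ) (m : ℤ) :
    component z (φ + m * (2 * Real.pi)) = component z φ := by
  simp only [component, Real.cos_add_int_mul_two_pi, Real.sin_add_int_mul_two_pi]

lemma component_smul (a : ℝ) (z : ℂ) (φ : ℝ) : component (a • z) φ = a * component z φ := by
  simp only [component, Complex.smul_re, Complex.smul_im, smul_eq_mul]; ring

@[simp] lemma re_circleMap (c : ℂ) (r φ : ℝ) : (circleMap c r φ).re = c.re + r * Real.cos φ := by
  simp [circleMap, Complex.exp_ofReal_mul_I_re, Complex.exp_ofReal_mul_I_im]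

@[simp] lemma im_circleMap (c : ℂ) (r φ : ℝ) : (circleMap c r φ).im = c.im + r * Real.sin φ := by
  simp [circleMap, Complex.exp_ofReal_mul_I_re, Complex.exp_ofReal_mul_I_im]

lemma component_circleMap (c : ℂ) (r x φ : ℝ) :
    component (circleMap c r x) φ = component c φ + r * Real.cos (x - φ) := by
  simp only [component, re_circleMap, im_circleMap, Real.cos_sub]; ring

lemma norm_sq_eq_re_im (z : ℂ) : ‖z‖ ^ 2 = z.re ^ 2 + z.im ^ 2 := by
  rw [Complex.sq_norm, Complex.normSq_apply]; ring

lemma component_eq_norm_mul_cos (z : ℂ) (φ : ℝ) :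
    component z φ = ‖z‖ * Real.cos (z.arg - φ) := by
  rw [Real.cos_sub, component]
  linear_combination -Real.cos φ * Complex.norm_mul_cos_arg z -
    Real.sin φ * Complex.norm_mul_sin_arg z

lemma component_le_norm (z : ℂ) (φ : ℝ) : component z φ ≤ ‖z‖ := by
  rw [component_eq_norm_mul_cos]
  exact mul_le_of_le_one_right (norm_nonneg z) (Real.cos_le_one _)

lemma component_arg (z : ℂ) : component z z.arg = ‖z‖ := by
  rw [component_eq_norm_mul_cos, sub_self, Real.cos_zero, mul_one]

/-- For `x` between `φ` and `ψ`, less than `π` apart, this makes the `x`-component a nonnegative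
combination of the other two. -/
lemma component_mul_sin (z : ℂ) (φ ψ x : ℝ) :
    component z x * Real.sin (ψ - φ) =
      component z φ * Real.sin (ψ - x) + component z ψ * Real.sin (x - φ) := by
  simp only [component, Real.sin_sub]
  ring

lemma component_rotate (z : ℂ) (φ ψ : ℝ) :
    component z ψ = component z φ * Real.cos (ψ - φ) +
      component z (φ + Real.pi / 2) * Real.sin (ψ - φ) := by
  have h1 := Real.sin_sq_add_cos_sq φ
  simp only [component, Real.sin_sub, Real.cos_sub, Real.cos_add_pi_div_two,
    Real.sin_add_pi_div_two]
  linear_combination (-(z.re * Real.cos ψ) - z.im * Real.sin ψ) * h1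

lemma norm_sq_eq_component (z : ℂ) (φ : ℝ) :
    ‖z‖ ^ 2 = component z φ ^ 2 + component z (φ + Real.pi / 2) ^ 2 := by
  have h1 := Real.sin_sq_add_cos_sq φ
  rw [norm_sq_eq_re_im]
  simp only [component, Real.cos_add_pi_div_two, Real.sin_add_pi_div_two]
  linear_combination (-(z.re ^ 2) - z.im ^ 2) * h1

/-- A disc has a single point at maximal height in a given direction. -/
lemma eq_circleMap_of_norm_le {z c : ℂ} {r φ : ℝ} (h1 : ‖z - c‖ ≤ r)
    (h2 : r ≤ component (z - c) φ) : z = circleMap c r φ := by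
  have h3 : ‖z - c‖ ^ 2 ≤ r ^ 2 := pow_le_pow_left₀ (norm_nonneg _) h1 2
  have h4 : component (z - c) φ = r := le_antisymm ((component_le_norm _ _).trans h1) h2
  have h5 : ‖z - circleMap c r φ‖ ^ 2 ≤ 0 := by
    have hs := Real.sin_sq_add_cos_sq φ
    rw [norm_sq_eq_re_im] at h3 ⊢
    simp only [component, Complex.sub_re, Complex.sub_im, re_circleMap, im_circleMap] at *
    have : (z.re - (c.re + r * Real.cos φ)) ^ 2 + (z.im - (c.im + r * Real.sin φ)) ^ 2 =
      (z.re - c.re) ^ 2 + (z.im - c.im) ^ 2 -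
        2 * r * ((z.re - c.re) * Real.cos φ + (z.im - c.im) * Real.sin φ) + r ^ 2 := by
      linear_combination r ^ 2 * hs
    rw [this, h4]
    linarith
  exact sub_eq_zero.1 (norm_eq_zero.1 (pow_eq_zero_iff two_ne_zero |>.1
    (le_antisymm h5 (sq_nonneg _))))

lemma continuous_component : Continuous fun p : ℂ × ℝ => component p.1 p.2 := by
  unfold component
  fun_prop

/-! ### Boundary curves of bodies of constant width -/

/-- `γ φ` is the point with outer normal `exp(iφ)` on the boundary of a body of constant
width `r`. -/
structure IsSupportCurve (γ : ℝ → ℂ) (r : ℝ) : Prop where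
  pos : 0 < r
  antipodal : ∀ φ, γ φ = circleMap (γ (φ + Real.pi)) r φ
  support : ∀ φ ψ, component (γ ψ - γ φ) φ ≤ 0

/-- The intersection of the half planes bounded by the support lines. -/
def supportBody (γ : ℝ → ℂ) : Set ℂ := {z | ∀ φ, component (z - γ φ) φ ≤ 0}

namespace IsSupportCurve

variable {γ : ℝ → ℂ} {r : ℝ}

lemma mem_body (h : IsSupportCurve γ r) (ψ : ℝ) : γ ψ ∈ supportBody γ := fun φ => h.support φ ψ

lemma add_two_pi (h : IsSupportCurve γ r) (φ : ℝ) : γ (φ + 2 * Real.pi) = γ φ := by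
  have h1 := h.antipodal φ
  have h2 := h.antipodal (φ + Real.pi)
  rw [show φ + Real.pi + Real.pi = φ + 2 * Real.pi by ring] at h2
  rw [h1, h2]
  apply Complex.ext <;> simp [Real.cos_add_pi, Real.sin_add_pi]

lemma periodic (h : IsSupportCurve γ r) : Function.Periodic γ (2 * Real.pi) := h.add_two_pi

lemma add_int_mul (h : IsSupportCurve γ r) (φ : ℝ) (m : ℤ) :
    γ (φ + m * (2 * Real.pi)) = γ φ := h.periodic.int_mul m φ

lemma component_antipodal (h : IsSupportCurve γ r) (φ : ℝ) :
    component (γ φ) φ = component (γ (φ + Real.pi)) φ + r := by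
  conv_lhs => rw [h.antipodal φ]
  rw [component_circleMap, sub_self, Real.cos_zero, mul_one]

/-- In the direction of `z - w` both points lie between two parallel support lines at distance `r`.
-/
lemma norm_sub_le (h : IsSupportCurve γ r) {z w : ℂ} (hz : z ∈ supportBody γ)
    (hw : w ∈ supportBody γ) : ‖z - w‖ ≤ r := by
  rw [← component_arg]
  set η := (z - w).arg
  have h1 := hz η
  have h2 := hw (η + Real.pi)
  rw [component_add_pi] at h2
  rw [component_sub] at *
  linarith [h.component_antipodal η]

/-- Strict convexity: a point on the support line has height `r` above `γ (φ + π)` and distance at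
most `r` from it, which leaves only `γ φ`. -/
lemma eq_of_component_eq (h : IsSupportCurve γ r) {z : ℂ} (hz : z ∈ supportBody γ) {φ : ℝ}
    (h0 : 0 ≤ component (z - γ φ) φ) : z = γ φ := by
  rw [h.antipodal φ]
  refine eq_circleMap_of_norm_le (h.norm_sub_le hz (h.mem_body (φ + Real.pi))) ?_
  have := h.component_antipodal φ
  rw [component_sub] at *
  linarith

lemma ne_antipodal (h : IsSupportCurve γ r) (φ : ℝ) : γ φ ≠ γ (φ + Real.pi) := by
  intro h0
  have := h.component_antipodal φ
  rw [h0] at this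
  linarith [h.pos]

/-- The normals at a point form a convex cone: by `component_mul_sin`, being extremal in the
directions `φ` and `ψ` implies being extremal in between. -/
lemma eq_of_mem_Icc (h : IsSupportCurve γ r) {φ ψ x : ℝ} (he : γ φ = γ ψ)
    (hx : x ∈ Set.Icc φ ψ) (hψ : ψ < φ + Real.pi) : γ x = γ φ := by
  rcases (hx.1.trans hx.2).eq_or_lt with rfl | hlt
  · rw [le_antisymm hx.2 hx.1]
  symm
  refine h.eq_of_component_eq (h.mem_body φ) ?_
  have h1 := h.support φ x
  have h2 := h.support ψ x
  rw [← he] at h2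
  have h3 := component_mul_sin (γ x - γ φ) φ ψ x
  have s1 : 0 < Real.sin (ψ - φ) := Real.sin_pos_of_pos_of_lt_pi (by linarith) (by linarith)
  have s2 : 0 ≤ Real.sin (ψ - x) :=
    Real.sin_nonneg_of_nonneg_of_le_pi (by linarith [hx.2]) (by linarith [hx.1])
  have s3 : 0 ≤ Real.sin (x - φ) :=
    Real.sin_nonneg_of_nonneg_of_le_pi (by linarith [hx.1]) (by linarith [hx.2])
  have h4 : component (γ x - γ φ) x * Real.sin (ψ - φ) ≤ 0 := by
    rw [h3]
    nlinarith
  have h5 : component (γ x - γ φ) x ≤ 0 := by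
    by_contra! hc
    nlinarith
  rw [component_sub] at *
  linarith

/-- Shift `ψ` into `(φ - π, φ + π]`; the end `φ + π` is excluded because antipodal points differ. -/
lemma exists_int_abs_lt (h : IsSupportCurve γ r) {φ ψ : ℝ} (he : γ φ = γ ψ) :
    ∃ m : ℤ, |ψ + m * (2 * Real.pi) - φ| < Real.pi := by
  have h2 : 0 < 2 * Real.pi := by linarith [Real.pi_pos]
  have h1 := toIocMod_mem_Ioc h2 (φ - Real.pi) ψ
  have h3 := self_sub_toIocDiv_zsmul h2 (φ - Real.pi) ψ
  rw [zsmul_eq_mul] at h3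
  refine ⟨-toIocDiv h2 (φ - Real.pi) ψ, ?_⟩
  have h4 : ψ + ((-toIocDiv h2 (φ - Real.pi) ψ : ℤ) : ℝ) * (2 * Real.pi) =
      toIocMod h2 (φ - Real.pi) ψ := by push_cast; linarith
  have h5 : γ (toIocMod h2 (φ - Real.pi) ψ) = γ φ := by rw [← h4, h.add_int_mul, he]
  rw [h4, abs_lt]
  refine ⟨by linarith [h1.1], lt_of_le_of_ne (by linarith [h1.2]) fun h6 => ?_⟩
  rw [show toIocMod h2 (φ - Real.pi) ψ = φ + Real.pi by linarith] at h5
  exact h.ne_antipodal φ h5.symm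

/-- On `[ν - π, ν]` the height in the direction `ν` is monotone. -/
lemma eq_of_component_le (h : IsSupportCurve γ r) {a p ν : ℝ} (hap : a ≤ p) (hpν : p < ν)
    (hν : ν ≤ a + Real.pi) (hd : 0 ≤ component (γ a - γ p) ν) : γ a = γ p := by
  rcases hap.eq_or_lt with rfl | hap
  · rfl
  have h1 : 0 ≤ component (γ a - γ p) a := by
    have := h.support a p
    rw [component_sub] at *
    linarith
  rcases hν.eq_or_lt with rfl | hν
  · rw [component_add_pi] at hd
    refine (h.eq_of_component_eq (h.mem_body p) ?_).symm
    rw [component_sub] at *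
    linarith
  · have h2 := component_mul_sin (γ a - γ p) a ν p
    have s1 : 0 < Real.sin (ν - a) := Real.sin_pos_of_pos_of_lt_pi (by linarith) (by linarith)
    have s2 : 0 ≤ Real.sin (ν - p) :=
      Real.sin_nonneg_of_nonneg_of_le_pi (by linarith) (by linarith)
    have s3 : 0 ≤ Real.sin (p - a) :=
      Real.sin_nonneg_of_nonneg_of_le_pi (by linarith) (by linarith)
    refine h.eq_of_component_eq (h.mem_body a) ?_
    by_contra! hc
    nlinarith [mul_nonneg h1 s2, mul_nonneg hd s3]

/-- On `[ν, ν + π]` the height in the direction `ν` is antitone. -/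
lemma eq_of_component_le' (h : IsSupportCurve γ r) {a p ν : ℝ} (hap : p ≤ a) (hpν : ν < p)
    (hν : a ≤ ν + Real.pi) (hd : 0 ≤ component (γ a - γ p) ν) : γ a = γ p := by
  rcases hap.eq_or_lt with rfl | hap
  · rfl
  have h1 : 0 ≤ component (γ a - γ p) a := by
    have := h.support a p
    rw [component_sub] at *
    linarith
  rcases hν.eq_or_lt with rfl | hν
  · rw [component_add_pi] at h1
    refine (h.eq_of_component_eq (h.mem_body p) ?_).symm
    rw [component_add_pi]
    rw [component_sub] at *
    linarith
  · have h2 := component_mul_sin (γ a - γ p) ν a p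
    have s1 : 0 < Real.sin (a - ν) := Real.sin_pos_of_pos_of_lt_pi (by linarith) (by linarith)
    have s2 : 0 ≤ Real.sin (p - ν) :=
      Real.sin_nonneg_of_nonneg_of_le_pi (by linarith) (by linarith)
    have s3 : 0 ≤ Real.sin (a - p) :=
      Real.sin_nonneg_of_nonneg_of_le_pi (by linarith) (by linarith)
    refine h.eq_of_component_eq (h.mem_body a) ?_
    by_contra! hc
    nlinarith [mul_nonneg h1 s2, mul_nonneg hd s3]

/-- The increment `d` of the curve and the reversed increment `f` of its antipode add up to the
chord of the circle. By the support inequalities both lie in the same cone, of opening angle `|ψ -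
φ| < π / 2`, so their inner product is nonnegative and `‖d‖ ≤ ‖d + f‖`. This is what makes `γ`
continuous. -/
lemma norm_sub_le_chord (h : IsSupportCurve γ r) {φ ψ : ℝ} (hne : |ψ - φ| < Real.pi / 2) :
    ‖γ ψ - γ φ‖ ≤ ‖circleMap 0 r ψ - circleMap 0 r φ‖ := by
  rcases eq_or_ne φ ψ with rfl | hφψ
  · simp
  have hs : Real.sin (ψ - φ) ≠ 0 := by
    intro h0
    rw [abs_lt] at hne
    rw [Real.sin_eq_zero_iff_of_lt_of_lt (by linarith) (by linarith)] at h0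
    exact hφψ (by linarith)
  have hc : 0 ≤ Real.cos (ψ - φ) := by
    rw [abs_lt] at hne
    exact Real.cos_nonneg_of_mem_Icc ⟨hne.1.le, hne.2.le⟩
  set d := γ ψ - γ φ with hd
  set f := γ (φ + Real.pi) - γ (ψ + Real.pi) with hf
  have hsum : circleMap 0 r ψ - circleMap 0 r φ = d + f := by
    rw [hd, hf, h.antipodal φ, h.antipodal ψ]
    simp only [circleMap]
    ring
  have hA : component d φ ≤ 0 := h.support φ ψ
  have hB : 0 ≤ component d ψ := by
    have := h.support ψ φ
    rw [hd]; rw [component_sub] at *; linarith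
  have hA' : component f φ ≤ 0 := by
    have := h.support (φ + Real.pi) (ψ + Real.pi)
    rw [component_add_pi] at this
    rw [hf]; rw [component_sub] at *; linarith
  have hB' : 0 ≤ component f ψ := by
    have := h.support (ψ + Real.pi) (φ + Real.pi)
    rw [component_add_pi] at this
    rw [hf]; rw [component_sub] at *; linarith
  have rd := component_rotate d φ ψ
  have rf := component_rotate f φ ψ
  have hsc := Real.sin_sq_add_cos_sq (ψ - φ)
  rw [hsum]
  rw [← pow_le_pow_iff_left₀ (norm_nonneg _) (norm_nonneg _) two_ne_zero]
  rw [norm_sq_eq_component d φ, norm_sq_eq_component (d + f) φ, component_add, component_add]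
  generalize component d (φ + Real.pi / 2) = q at *
  generalize component f (φ + Real.pi / 2) = q' at *
  generalize component d φ = A at *
  generalize component f φ = A' at *
  generalize component d ψ = B at *
  generalize component f ψ = B' at *
  generalize Real.sin (ψ - φ) = s at *
  generalize Real.cos (ψ - φ) = c at *
  -- The inner product of `d` and `f`, rewritten in their components along `φ` and `ψ`, whose signs
  -- are known.
  have key : s ^ 2 * (A * A' + q * q') = A * A' + B * B' - c * (A * B' + A' * B) := by
    rw [rd, rf]
    linear_combination (A * A') * hsc
  have hdot : 0 ≤ A * A' + q * q' := by
    have h1 : 0 ≤ s ^ 2 * (A * A' + q * q') := by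
      rw [key]
      have h2 : 0 ≤ A * A' := mul_nonneg_of_nonpos_of_nonpos hA hA'
      have h3 : 0 ≤ B * B' := mul_nonneg hB hB'
      have h4 : A * B' + A' * B ≤ 0 :=
        add_nonpos (mul_nonpos_of_nonpos_of_nonneg hA hB') (mul_nonpos_of_nonpos_of_nonneg hA' hB)
      nlinarith [mul_nonneg hc (neg_nonneg.2 h4)]
    exact nonneg_of_mul_nonneg_right h1 (by positivity)
  nlinarith [sq_nonneg A', sq_nonneg q']

lemma continuous (h : IsSupportCurve γ r) : Continuous γ := by
  rw [continuous_iff_continuousAt]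
  intro φ
  rw [ContinuousAt, tendsto_iff_norm_sub_tendsto_zero]
  have hlim : Filter.Tendsto (fun ψ => ‖circleMap 0 r ψ - circleMap 0 r φ‖) (nhds φ) (nhds 0) :=
    tendsto_iff_norm_sub_tendsto_zero.1 ((continuous_circleMap 0 r).tendsto φ)
  refine squeeze_zero' (Filter.Eventually.of_forall fun _ => norm_nonneg _) ?_ hlim
  filter_upwards [Metric.ball_mem_nhds φ (half_pos Real.pi_pos)] with ψ hψ
  exact h.norm_sub_le_chord (by simpa [Real.dist_eq] using hψ)

/-! ### The body bounded by a support curve -/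

lemma convex_body : Convex ℝ (supportBody γ) := by
  intro z hz w hw a b ha hb hab φ
  have h1 := hz φ
  have h2 := hw φ
  have : component (a • z + b • w - γ φ) φ =
      a * component (z - γ φ) φ + b * component (w - γ φ) φ := by
    simp only [component_sub, component_add, component_smul]
    linear_combination component (γ φ) φ * hab
  rw [this]
  nlinarith

lemma isClosed_body : IsClosed (supportBody γ) := by
  rw [supportBody, Set.ofPred_forall]
  refine isClosed_iInter fun φ => isClosed_le ?_ continuous_const
  unfold component
  fun_prop

lemma isCompact_body (h : IsSupportCurve γ r) : IsCompact (supportBody γ) := by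
  refine (isCompact_closedBall (γ 0) r).of_isClosed_subset isClosed_body fun z hz => ?_
  rw [mem_closedBall_iff_norm]
  exact h.norm_sub_le hz (h.mem_body 0)

/-- A point of the body off the curve is strictly below all support lines, hence below them by a
uniform margin by compactness, and is interior. A point of the curve leaves the body when moved
outwards along its normal. -/
lemma frontier_body (h : IsSupportCurve γ r) : frontier (supportBody γ) = Set.range γ := by
  rw [isClosed_body.frontier_eq]
  ext z
  constructor
  · rintro ⟨hz, hint⟩
    by_contra hr
    apply hint
    have hneg : ∀ φ, component (z - γ φ) φ < 0 := fun φ =>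
      lt_of_not_ge fun h0 => hr ⟨φ, (h.eq_of_component_eq hz h0).symm⟩
    have hcont : Continuous fun φ => component (z - γ φ) φ :=
      continuous_component.comp ((continuous_const.sub h.continuous).prodMk continuous_id)
    obtain ⟨φ₀, -, hmax⟩ := (isCompact_Icc (a := (0 : ℝ)) (b := 2 * Real.pi)).exists_isMaxOn
      ⟨0, by simp [Real.pi_pos.le]⟩ hcont.continuousOn
    rw [mem_interior_iff_mem_nhds]
    refine Filter.mem_of_superset (Metric.ball_mem_nhds z (neg_pos.2 (hneg φ₀))) fun w hw φ => ?_
    obtain ⟨y, hy, hyφ⟩ : ∃ y ∈ Set.Icc 0 (2 * Real.pi), component (z - γ y) y =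
        component (z - γ φ) φ := by
      have h2 : 0 < 2 * Real.pi := by linarith [Real.pi_pos]
      have h1 := toIcoMod_mem_Ico h2 0 φ
      have h3 := self_sub_toIcoDiv_zsmul h2 0 φ
      rw [zsmul_eq_mul] at h3
      refine ⟨toIcoMod h2 0 φ, ⟨h1.1, by linarith [h1.2]⟩, ?_⟩
      rw [show toIcoMod h2 0 φ = φ + ((-toIcoDiv h2 0 φ : ℤ) : ℝ) * (2 * Real.pi) by
        push_cast; linarith, h.add_int_mul, component_add_int_mul_two_pi]
    have h1 : component (z - γ y) y ≤ component (z - γ φ₀) φ₀ := hmax hy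
    have h2 := component_le_norm (w - z) φ
    rw [mem_ball_iff_norm] at hw
    rw [hyφ] at h1
    have h3 : component (w - γ φ) φ = component (w - z) φ + component (z - γ φ) φ := by
      simp only [component_sub]; ring
    rw [h3]
    linarith
  · rintro ⟨φ, rfl⟩
    refine ⟨h.mem_body φ, fun hint => ?_⟩
    obtain ⟨ε, hε, hball⟩ := Metric.mem_nhds_iff.1 (mem_interior_iff_mem_nhds.1 hint)
    have hmem : circleMap (γ φ) (ε / 2) φ ∈ Metric.ball (γ φ) ε := by
      rw [mem_ball_iff_norm]
      simp [circleMap, Complex.norm_exp_ofReal_mul_I, abs_of_pos hε]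
      linarith
    have := hball hmem φ
    rw [component_sub, component_circleMap, sub_self, Real.cos_zero] at this
    linarith

/-- If the midpoint of `γ 0` and `γ π` lay on a support line, so would both ends, and they would
coincide by strict convexity. -/
lemma nonempty_interior_body (h : IsSupportCurve γ r) : (interior (supportBody γ)).Nonempty := by
  set m : ℂ := (1 / 2 : ℝ) • γ 0 + (1 / 2 : ℝ) • γ Real.pi with hm
  have hmem : m ∈ supportBody γ :=
    convex_body (h.mem_body 0) (h.mem_body Real.pi) (by norm_num) (by norm_num) (by norm_num)
  refine ⟨m, ?_⟩
  by_contra hint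
  have hfr : m ∈ frontier (supportBody γ) := by
    rw [isClosed_body.frontier_eq]; exact ⟨hmem, hint⟩
  rw [h.frontier_body] at hfr
  obtain ⟨ψ, hψ⟩ := hfr
  have h1 := h.support ψ 0
  have h2 := h.support ψ Real.pi
  have h3 : component (γ 0 - γ ψ) ψ + component (γ Real.pi - γ ψ) ψ = 0 := by
    rw [hψ, hm]
    simp only [component_sub, component_add, component_smul]
    ring
  have e1 := h.eq_of_component_eq (h.mem_body 0) (φ := ψ) (by linarith)
  have e2 := h.eq_of_component_eq (h.mem_body Real.pi) (φ := ψ) (by linarith)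
  refine h.ne_antipodal 0 ?_
  rw [zero_add, e1, e2]

lemma setWidth_body (h : IsSupportCurve γ r) (ω : ℝ) : setWidth (supportBody γ) ω = r := by
  have hsup : IsGreatest ((fun z : ℂ => (z * Complex.exp (-(ω * Complex.I))).re) '' supportBody γ)
      (component (γ ω) ω) := by
    refine ⟨⟨γ ω, h.mem_body ω, re_mul_exp_neg _ _⟩, ?_⟩
    rintro _ ⟨z, hz, rfl⟩
    have := hz ω
    simp only [re_mul_exp_neg]
    rw [component_sub] at this
    linarith
  have hinf : IsLeast ((fun z : ℂ => (z * Complex.exp (-(ω * Complex.I))).re) '' supportBody γ)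
      (component (γ (ω + Real.pi)) ω) := by
    refine ⟨⟨γ (ω + Real.pi), h.mem_body _, re_mul_exp_neg _ _⟩, ?_⟩
    rintro _ ⟨z, hz, rfl⟩
    have := hz (ω + Real.pi)
    simp only [re_mul_exp_neg]
    rw [component_add_pi, component_sub] at this
    linarith
  rw [setWidth, hsup.csSup_eq, hinf.csInf_eq]
  linarith [h.component_antipodal ω]

end IsSupportCurve

/-! ### Unrolled polygons -/

/-- The vertices, edge directions and edge lengths of a convex polygon, indexed by `ℕ` instead of
residues modulo `n`. -/
structure IsUnrolling {n : ℕ} (α : Fin n → ℂ) (a : ℕ → ℂ) (θ ρ : ℕ → ℝ) : Prop where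
  apply : ∀ j : Fin n, a j = α j
  edge_eq : ∀ j : Fin n, edge α j = a (j + 1) - a j
  mem_range : ∀ i, a i ∈ Set.range α
  add_n : ∀ i, a (i + n) = a i
  angle_add_n : ∀ i, θ (i + n) = θ i + 2 * Real.pi
  length_eq : ∀ j : Fin n, ∀ i, i % n = j → ρ i = ‖edge α j‖
  mono : Monotone θ
  pos : ∀ i, 0 < ρ i
  step : ∀ i, a (i + 1) = circleMap (a i) (ρ i) (θ i)

lemma finRotate_mk_mod {n : ℕ} (hn : 0 < n) (i : ℕ) :
    finRotate n ⟨i % n, Nat.mod_lt _ hn⟩ = ⟨(i + 1) % n, Nat.mod_lt _ hn⟩ := by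
  obtain ⟨m, rfl⟩ := Nat.exists_eq_succ_of_ne_zero hn.ne'
  rw [finRotate_apply]
  ext
  simp [Fin.val_add]

lemma IsConvexNGon.exists_unrolling {n : ℕ} {α : Fin n → ℂ} (h : IsConvexNGon α) :
    ∃ a θ ρ, IsUnrolling α a θ ρ := by
  have hn : 0 < n := by have := h.two_le; omega
  obtain ⟨θ, hθ, hmono, hwrap⟩ := h.counterclockwise
  have hedge : ∀ i : ℕ, α ⟨(i + 1) % n, Nat.mod_lt _ hn⟩ - α ⟨i % n, Nat.mod_lt _ hn⟩ =
      edge α ⟨i % n, Nat.mod_lt _ hn⟩ := fun i => by rw [edge, finRotate_mk_mod hn]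
  refine ⟨fun i => α ⟨i % n, Nat.mod_lt _ hn⟩,
    fun i => θ ⟨i % n, Nat.mod_lt _ hn⟩ + (i / n : ℕ) * (2 * Real.pi),
    fun i => ‖edge α ⟨i % n, Nat.mod_lt _ hn⟩‖, ?_, ?_, ?_, ?_, ?_, ?_, ?_, ?_, ?_⟩
  · intro j
    simp only [Nat.mod_eq_of_lt j.2]
  · intro j
    rw [hedge]
    simp only [Nat.mod_eq_of_lt j.2]
  · exact fun i => ⟨_, rfl⟩
  · intro i
    simp only [Nat.add_mod_right]
  · intro i
    simp only [Nat.add_mod_right, Nat.add_div_right i hn]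
    push_cast
    ring
  · intro j i hij
    simp only [hij]
  · refine monotone_nat_of_le_succ fun i => ?_
    have hi := Nat.mod_lt i hn
    rcases Nat.lt_or_ge (i % n + 1) n with hlt | hge
    · have e1 : (i + 1) % n = i % n + 1 := by
        rw [Nat.add_mod, Nat.mod_eq_of_lt (show 1 < n by omega), Nat.mod_eq_of_lt hlt]
      have e2 : (i + 1) / n = i / n := by
        have := Nat.div_add_mod i n
        rw [Nat.div_eq_iff hn]
        constructor
        · rw [mul_comm]; omega
        · rw [mul_comm]; omega
      simp only [e1, e2]
      gcongr
      exact hmono (Fin.mk_le_mk.2 (by omega))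
    · have e1 : (i + 1) % n = 0 := by
        have := Nat.div_add_mod i n
        have h3 : i + 1 = n * (i / n + 1) := by rw [mul_add]; omega
        rw [h3, Nat.mul_mod_right]
      have e2 : (i + 1) / n = i / n + 1 := by
        have := Nat.div_add_mod i n
        have h3 : i + 1 = n * (i / n + 1) := by rw [mul_add]; omega
        rw [h3, Nat.mul_div_cancel_left _ hn]
      simp only [e1, e2]
      push_cast
      have := hwrap ⟨i % n, hi⟩ ⟨0, hn⟩
      linarith
  · exact fun i => norm_pos_iff.2 (h.edge_ne_zero _)
  · intro i
    have h1 : Complex.exp (((θ ⟨i % n, Nat.mod_lt _ hn⟩ + (i / n : ℕ) * (2 * Real.pi) : ℝ) : ℂ) *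
        Complex.I) = Complex.exp ((edge α ⟨i % n, Nat.mod_lt _ hn⟩).arg * Complex.I) := by
      obtain ⟨m, hm⟩ := Real.Angle.angle_eq_iff_two_pi_dvd_sub.1
        (hθ ⟨i % n, Nat.mod_lt _ hn⟩)
      rw [Complex.exp_eq_exp_iff_exists_int]
      generalize i / n = k
      refine ⟨m + (k : ℤ), ?_⟩
      rw [show θ ⟨i % n, Nat.mod_lt _ hn⟩ =
        (edge α ⟨i % n, Nat.mod_lt _ hn⟩).arg + 2 * Real.pi * m by linarith]
      push_cast
      ring
    simp only [circleMap]
    rw [h1, Complex.norm_mul_exp_arg_mul_I, ← hedge]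
    ring

namespace IsUnrolling

variable {n : ℕ} {α : Fin n → ℂ} {a : ℕ → ℂ} {θ ρ : ℕ → ℝ}

lemma component_step (h : IsUnrolling α a θ ρ) (i k : ℕ) :
    component (a (k + 1)) (θ i - Real.pi / 2) =
      component (a k) (θ i - Real.pi / 2) - ρ k * Real.sin (θ k - θ i) := by
  rw [h.step, component_circleMap, show θ k - (θ i - Real.pi / 2) = θ k - θ i + Real.pi / 2 by ring,
    Real.cos_add_pi_div_two]
  ring

/-- The polygon lies to the left of its edges. -/
lemma component_le (h : IsUnrolling α a θ ρ) {i k : ℕ} (hik : i ≤ k) (hk : k ≤ i + n) :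
    component (a k) (θ i - Real.pi / 2) ≤ component (a i) (θ i - Real.pi / 2) := by
  have hlast := h.angle_add_n i
  -- Seen from edge `i`, the height of the vertices goes down while the turning angle is at most
  -- `π`, then goes up and is back at its initial value after `n` steps.
  rcases le_total (θ k - θ i) Real.pi with hc | hc
  · induction k, hik using Nat.le_induction with
    | base => exact le_rfl
    | succ k hik ih =>
      have h1 := h.mono (Nat.le_succ k)
      have h2 := h.mono hik
      have h3 := ih (by omega) (by linarith [show θ k ≤ θ (k + 1) from h1])
      rw [h.component_step]
      have h4 : 0 ≤ Real.sin (θ k - θ i) := Real.sin_nonneg_of_nonneg_of_le_pi (by linarith)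
        (by linarith [show θ k ≤ θ (k + 1) from h1])
      nlinarith [h.pos k]
  · have key : ∀ m, m ≤ i + n → k ≤ m → component (a k) (θ i - Real.pi / 2) ≤
        component (a m) (θ i - Real.pi / 2) := by
      intro m hm hkm
      induction m, hkm using Nat.le_induction with
      | base => exact le_rfl
      | succ m hkm ih =>
        have h2 := h.mono hkm
        have h5 := h.mono (show m ≤ i + n by omega)
        refine (ih (by omega)).trans ?_
        rw [h.component_step]
        have h4 : Real.sin (θ m - θ i) ≤ 0 := by
          rw [show θ m - θ i = (θ m - θ i - Real.pi) + Real.pi by ring, Real.sin_add_pi,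
            neg_nonpos]
          exact Real.sin_nonneg_of_nonneg_of_le_pi (by linarith) (by linarith)
        nlinarith [h.pos m]
    have := key (i + n) le_rfl hk
    rwa [h.add_n] at this

lemma component_vertex_le (h : IsUnrolling α a θ ρ) (j k : Fin n) :
    component (α k) (θ j - Real.pi / 2) ≤ component (α j) (θ j - Real.pi / 2) := by
  rw [← h.apply, ← h.apply]
  rcases le_total j k with hjk | hjk
  · exact h.component_le hjk (by omega)
  · rw [← h.add_n k]
    exact h.component_le (by omega) (by have : (k : ℕ) ≤ j := hjk; omega)

end IsUnrolling

/-! ### Arcs in the frontier -/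

/-- If the arc lies on both circles, the component of `c' - c` along the radius, times `2r`, is
constantly `-‖c' - c‖²`. Components satisfy `f (x + h) + f (x - h) = 2 cos h · f x`, so a constant
one forces `‖c' - c‖² (1 - cos h) = 0`. -/
lemma center_eq_of_forall_norm {c c' : ℂ} {r u v : ℝ} (huv : u < v)
    (h : ∀ x ∈ Set.Icc u v, ‖circleMap c' r x - c‖ = r) : c' = c := by
  have h1 : ∀ x ∈ Set.Icc u v, 2 * r * component (c' - c) x = -‖c' - c‖ ^ 2 := by
    intro x hx
    have h2 : ‖circleMap c' r x - c‖ ^ 2 = r ^ 2 := by rw [h x hx]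
    rw [norm_sq_eq_re_im] at h2 ⊢
    simp only [Complex.sub_re, Complex.sub_im, re_circleMap, im_circleMap, component] at *
    linear_combination h2 - r ^ 2 * Real.sin_sq_add_cos_sq x
  set h := min ((v - u) / 2) 1
  have hpos : 0 < h := lt_min (by linarith) one_pos
  have hle : h ≤ (v - u) / 2 := min_le_left _ _
  have hle1 : h ≤ 1 := min_le_right _ _
  have hcos : Real.cos h < 1 := by
    rw [← Real.cos_zero]
    exact Real.cos_lt_cos_of_nonneg_of_le_pi le_rfl (by linarith [Real.pi_gt_three]) hpos
  set x := (u + v) / 2 with hx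
  have e0 := h1 x ⟨by linarith, by linarith⟩
  have e1 := h1 (x + h) ⟨by linarith, by linarith⟩
  have e2 := h1 (x - h) ⟨by linarith, by linarith⟩
  have e3 : component (c' - c) (x + h) + component (c' - c) (x - h) =
      2 * Real.cos h * component (c' - c) x := by
    simp only [component, Real.cos_add, Real.sin_add, Real.cos_sub, Real.sin_sub]
    ring
  have e4 : ‖c' - c‖ ^ 2 * (1 - Real.cos h) = 0 := by
    linear_combination (1 / 2) * e1 + (1 / 2) * e2 - Real.cos h * e0 - r * e3
  have e5 : ‖c' - c‖ ^ 2 = 0 := by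
    rcases mul_eq_zero.1 e4 with e | e
    · exact e
    · linarith
  exact sub_eq_zero.1 (norm_eq_zero.1 (pow_eq_zero_iff two_ne_zero |>.1 e5))

lemma circleMap_ne {c : ℂ} {r x y : ℝ} (hr : 0 < r) (hxy : x < y) (hy : y < x + 2 * Real.pi) :
    circleMap c r x ≠ circleMap c r y := by
  intro he
  have h1 := congrArg (fun z => component z x) he
  simp only [component_circleMap, sub_self, Real.cos_zero] at h1
  have h2 : Real.cos (y - x) = 1 := by
    have : r * (Real.cos (y - x) - 1) = 0 := by linarith
    rcases mul_eq_zero.1 this with h | h <;> linarith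
  obtain ⟨m, hm⟩ := (Real.cos_eq_one_iff _).1 h2
  have h3 : (0 : ℝ) < m := by
    by_contra! hc
    nlinarith
  have h4 : (m : ℝ) < 1 := by
    by_contra! hc
    nlinarith
  have h5 : (0 : ℤ) < m := by exact_mod_cast h3
  have h6 : m < (1 : ℤ) := by exact_mod_cast h4
  omega

namespace IsSupportCurve

variable {γ : ℝ → ℂ} {r : ℝ}

/-- A point in the interior of an arc is attained for a single direction. -/
lemma eq_add_int_mul_of_arc (h : IsSupportCurve γ r) {c : ℂ} {p q t x : ℝ}
    (harc : ∀ y ∈ Set.Icc p q, γ y = circleMap c r y) (ht : t ∈ Set.Ioo p q) (he : γ t = γ x) :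
    ∃ m : ℤ, t = x + m * (2 * Real.pi) := by
  obtain ⟨m, hm⟩ := h.exists_int_abs_lt he
  refine ⟨m, ?_⟩
  have he' : γ t = γ (x + m * (2 * Real.pi)) := by rw [h.add_int_mul, he]
  set y := x + m * (2 * Real.pi)
  rw [abs_lt] at hm
  rcases lt_trichotomy t y with hlt | heq | hgt
  · exfalso
    have h1 : t < min y q := lt_min hlt ht.2
    have h2 := h.eq_of_mem_Icc he' (x := min y q) ⟨h1.le, min_le_left _ _⟩ (by linarith)
    rw [harc t ⟨ht.1.le, ht.2.le⟩, harc _ ⟨by linarith [ht.1], min_le_right _ _⟩] at h2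
    exact circleMap_ne h.pos h1 (by linarith [min_le_left y q]) h2.symm
  · exact heq
  · exfalso
    have h1 : max y p < t := max_lt hgt ht.1
    have h2 := h.eq_of_mem_Icc he'.symm (x := max y p) ⟨le_max_left _ _, h1.le⟩ (by linarith)
    rw [← he', harc t ⟨ht.1.le, ht.2.le⟩, harc _ ⟨le_max_right _ _, by linarith [ht.2]⟩] at h2
    exact circleMap_ne h.pos h1 (by linarith [le_max_left y p]) h2

lemma exists_mem_Ico (h : IsSupportCurve γ r) (p t : ℝ) :
    ∃ y ∈ Set.Ico p (p + 2 * Real.pi), γ y = γ t := by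
  have h2 : 0 < 2 * Real.pi := by linarith [Real.pi_pos]
  have h1 := toIcoMod_mem_Ico h2 p t
  have h3 := self_sub_toIcoDiv_zsmul h2 p t
  rw [zsmul_eq_mul] at h3
  refine ⟨toIcoMod h2 p t, h1, ?_⟩
  rw [show toIcoMod h2 p t = t + ((-toIcoDiv h2 p t : ℤ) : ℝ) * (2 * Real.pi) by
    push_cast; linarith, h.add_int_mul]

/-- The points with normals outside `(p, q)` form a compact set `K` that misses `γ t`. Near `γ t`
the frontier therefore lies on the circle around `c`, and any frontier arc of radius `r` that ends
or starts there has center `c`. -/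
lemma not_isEssentialEndpoint (h : IsSupportCurve γ r) {c : ℂ} {p q t : ℝ}
    (harc : ∀ y ∈ Set.Icc p q, γ y = circleMap c r y) (ht : t ∈ Set.Ioo p q) :
    ¬ IsEssentialEndpoint (supportBody γ) r (γ t) := by
  set K := γ '' Set.Icc q (p + 2 * Real.pi)
  have hKc : IsClosed K := (isCompact_Icc.image h.continuous).isClosed
  have htK : γ t ∉ K := by
    rintro ⟨x, hx, hxe⟩
    obtain ⟨m, hm⟩ := h.eq_add_int_mul_of_arc harc ht hxe.symm
    have hpi := Real.pi_pos
    have h3 : (m : ℝ) < 0 := by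
      by_contra! hc
      nlinarith [ht.2, hx.1]
    have h4 : (-1 : ℝ) < m := by
      by_contra! hc
      nlinarith [ht.1, hx.2]
    have h5 : m < (0 : ℤ) := by exact_mod_cast h3
    have h6 : (-1 : ℤ) < m := by exact_mod_cast h4
    omega
  have key : ∀ c' x, circleMap c' r x ∈ frontier (supportBody γ) → circleMap c' r x ∉ K →
      ‖circleMap c' r x - c‖ = r := by
    intro c' x hx hxK
    rw [h.frontier_body] at hx
    obtain ⟨y, hy⟩ := hx
    obtain ⟨y', hy', hye⟩ := h.exists_mem_Ico p y
    rw [← hy, ← hye] at hxK ⊢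
    have hlt : y' < q := by
      by_contra! hc
      exact hxK ⟨y', ⟨hc, hy'.2.le⟩, rfl⟩
    rw [harc y' ⟨hy'.1, hlt.le⟩, circleMap_sub_center, norm_circleMap_zero, abs_of_pos h.pos]
  rintro ⟨c₁, c₂, a₁, b₁, a₂, b₂, hne, h1, h2, hs1, hs2, e1, e2⟩
  apply hne
  trans c
  · have hopen : {x | circleMap c₁ r x ∉ K} ∈ nhds b₁ :=
      (hKc.isOpen_compl.preimage (continuous_circleMap c₁ r)).mem_nhds (by
        change circleMap c₁ r b₁ ∉ K
        rwa [← e1])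
    obtain ⟨ε, hε, hball⟩ := Metric.mem_nhds_iff.1 hopen
    refine center_eq_of_forall_norm (u := max a₁ (b₁ - ε / 2)) (v := b₁)
      (max_lt h1 (by linarith)) fun x hx => key _ _ ?_ ?_
    · exact hs1 ⟨x, ⟨(le_max_left _ _).trans hx.1, hx.2⟩, rfl⟩
    · apply hball
      rw [Metric.mem_ball, Real.dist_eq, abs_lt]
      exact ⟨by linarith [(le_max_right a₁ (b₁ - ε / 2)).trans hx.1], by linarith [hx.2]⟩
  · have hopen : {x | circleMap c₂ r x ∉ K} ∈ nhds a₂ :=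
      (hKc.isOpen_compl.preimage (continuous_circleMap c₂ r)).mem_nhds (by
        change circleMap c₂ r a₂ ∉ K
        rwa [← e2])
    obtain ⟨ε, hε, hball⟩ := Metric.mem_nhds_iff.1 hopen
    refine (center_eq_of_forall_norm (u := a₂) (v := min b₂ (a₂ + ε / 2))
      (lt_min h2 (by linarith)) fun x hx => key _ _ ?_ ?_).symm
    · exact hs2 ⟨x, ⟨hx.1, hx.2.trans (min_le_left _ _)⟩, rfl⟩
    · apply hball
      rw [Metric.mem_ball, Real.dist_eq, abs_lt]
      exact ⟨by linarith [hx.1], by linarith [hx.2.trans (min_le_right b₂ (a₂ + ε / 2))]⟩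

end IsSupportCurve

/-! ### Curves with prescribed radius of curvature -/

lemma intervalIntegrable_of_mem_Icc {D : ℝ → ℝ} {A : ℝ} (hm : Measurable D) (h0 : ∀ t, 0 ≤ D t)
    (hA : ∀ t, D t ≤ A) (x y : ℝ) : IntervalIntegrable D volume x y :=
  (intervalIntegrable_const (c := A)).mono_fun' hm.aestronglyMeasurable
    (Filter.Eventually.of_forall fun t => by
      change ‖D t‖ ≤ A
      rw [Real.norm_eq_abs, abs_of_nonneg (h0 t)]
      exact hA t)

/-- `γ` moves in the direction `φ + π/2` with speed `D φ` (the radius of curvature). -/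
structure HasCurvatureRadius (γ : ℝ → ℂ) (D : ℝ → ℝ) (A : ℝ) : Prop where
  pos : 0 < A
  measurable : Measurable D
  nonneg : ∀ t, 0 ≤ D t
  le : ∀ t, D t ≤ A
  add_pi : ∀ t, D (t + Real.pi) = A - D t
  sub_eq : ∀ x y, γ y - γ x = ∫ t in x..y, D t • (circleMap 0 1 t * Complex.I)

namespace HasCurvatureRadius

variable {γ : ℝ → ℂ} {D : ℝ → ℝ} {A : ℝ}

lemma intervalIntegrable (h : HasCurvatureRadius γ D A) (x y : ℝ) :
    IntervalIntegrable D volume x y :=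
  intervalIntegrable_of_mem_Icc h.measurable h.nonneg h.le x y

lemma intervalIntegrable_smul (h : HasCurvatureRadius γ D A) (x y : ℝ) :
    IntervalIntegrable (fun t => D t • (circleMap 0 1 t * Complex.I)) volume x y :=
  (h.intervalIntegrable x y).smul_continuousOn (by fun_prop)

lemma integral_circleMap (r x y : ℝ) :
    ∫ t in x..y, circleMap 0 r t * Complex.I = circleMap 0 r y - circleMap 0 r x :=
  intervalIntegral.integral_eq_sub_of_hasDerivAt (fun t _ => hasDerivAt_circleMap 0 r t)
    (Continuous.intervalIntegrable (by fun_prop) _ _)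

lemma smul_circleMap (r t : ℝ) :
    r • (circleMap 0 1 t * Complex.I) = circleMap 0 r t * Complex.I := by
  simp only [circleMap, Complex.real_smul]
  push_cast
  ring

lemma sub_of_eq_const (h : HasCurvatureRadius γ D A) {x y d : ℝ} (hxy : x ≤ y)
    (hD : ∀ t ∈ Set.Ioo x y, D t = d) : γ y - γ x = circleMap 0 d y - circleMap 0 d x := by
  rw [h.sub_eq, ← integral_circleMap]
  refine intervalIntegral.integral_congr_Ioo_of_le hxy fun t ht => ?_
  simp only [hD t ht, smul_circleMap]

lemma component_sub_eq (h : HasCurvatureRadius γ D A) (φ ψ : ℝ) :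
    component (γ ψ - γ φ) φ = ∫ t in φ..ψ, -(D t * Real.sin (t - φ)) := by
  set L : ℂ →L[ℝ] ℝ := Real.cos φ • Complex.reCLM + Real.sin φ • Complex.imCLM with hL
  have hLc : ∀ z, component z φ = L z := fun z => by
    simp [hL, component]; ring
  rw [hLc, h.sub_eq, ← L.intervalIntegral_comp_comm (h.intervalIntegrable_smul φ ψ)]
  refine intervalIntegral.integral_congr fun t _ => ?_
  simp only [← hLc, component_smul]
  simp [component, Real.sin_sub]
  ring

/-- `D t + D (t + π) = A` says that the derivatives of the two sides of the antipodal relation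
agree. -/
lemma const_of_add_pi (h : HasCurvatureRadius γ D A) (x y : ℝ) :
    γ y - γ (y + Real.pi) - circleMap 0 A y = γ x - γ (x + Real.pi) - circleMap 0 A x := by
  have h1 := h.sub_eq x y
  have h2 := h.sub_eq (x + Real.pi) (y + Real.pi)
  rw [← intervalIntegral.integral_comp_add_right
    (fun t => D t • (circleMap 0 1 t * Complex.I)) Real.pi] at h2
  have h3 : ∀ t, D (t + Real.pi) • (circleMap 0 1 (t + Real.pi) * Complex.I) =
      D t • (circleMap 0 1 t * Complex.I) - circleMap 0 A t * Complex.I := by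
    intro t
    rw [← smul_circleMap A t, h.add_pi]
    have : circleMap 0 1 (t + Real.pi) = -circleMap 0 1 t := by
      apply Complex.ext <;> simp [Real.cos_add_pi, Real.sin_add_pi]
    rw [this, sub_smul, neg_mul, smul_neg, smul_neg]
    ring
  simp only [h3] at h2
  rw [intervalIntegral.integral_sub (h.intervalIntegrable_smul x y)
    (Continuous.intervalIntegrable (by fun_prop) _ _), ← h1, integral_circleMap] at h2
  linear_combination -h2

/-- The constant of `const_of_add_pi` changes sign between `p` and `p + π` once the curve closes up,
so it vanishes. The support inequality is `-∫ D t sin (t - φ) ≤ 0` over normals within `π` of `φ`.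
-/
lemma isSupportCurve (h : HasCurvatureRadius γ D A) {p : ℝ} (hp : γ (p + 2 * Real.pi) = γ p) :
    IsSupportCurve γ A := by
  have hneg : ∀ t, circleMap 0 A (t + Real.pi) = -circleMap 0 A t := fun t => by
    apply Complex.ext <;> simp [Real.cos_add_pi, Real.sin_add_pi]
  have hzero : ∀ y, γ y - γ (y + Real.pi) - circleMap 0 A y = 0 := by
    intro y
    have h1 := h.const_of_add_pi p y
    have h2 := h.const_of_add_pi p (p + Real.pi)
    rw [show p + Real.pi + Real.pi = p + 2 * Real.pi by ring, hp, hneg] at h2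
    rw [h1]
    linear_combination (-1 / 2 : ℂ) * h2
  have hanti : ∀ φ, γ φ = circleMap (γ (φ + Real.pi)) A φ := fun φ => by
    have := hzero φ
    simp only [circleMap] at *
    linear_combination this
  have hper : Function.Periodic γ (2 * Real.pi) := fun φ => by
    have h1 := hzero φ
    have h2 := hzero (φ + Real.pi)
    rw [hneg, show φ + Real.pi + Real.pi = φ + 2 * Real.pi by ring] at h2
    linear_combination -h1 - h2
  refine ⟨h.pos, hanti, fun φ ψ => ?_⟩
  obtain ⟨y, hy, hye⟩ : ∃ y ∈ Set.Ico (φ - Real.pi) (φ + Real.pi), γ y = γ ψ := by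
    have h2 : 0 < 2 * Real.pi := by linarith [Real.pi_pos]
    have h1 := toIcoMod_mem_Ico h2 (φ - Real.pi) ψ
    have h3 := self_sub_toIcoDiv_zsmul h2 (φ - Real.pi) ψ
    rw [zsmul_eq_mul] at h3
    refine ⟨toIcoMod h2 (φ - Real.pi) ψ, ⟨h1.1, by linarith [h1.2]⟩, ?_⟩
    rw [show toIcoMod h2 (φ - Real.pi) ψ =
      ψ + ((-toIcoDiv h2 (φ - Real.pi) ψ : ℤ) : ℝ) * (2 * Real.pi) by push_cast; linarith]
    exact hper.int_mul _ ψ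
  rw [← hye, h.component_sub_eq]
  rcases le_total φ y with hle | hle
  · rw [intervalIntegral.integral_neg, neg_nonpos]
    refine intervalIntegral.integral_nonneg hle fun t ht => mul_nonneg (h.nonneg t) ?_
    exact Real.sin_nonneg_of_nonneg_of_le_pi (by linarith [ht.1]) (by linarith [ht.2, hy.2])
  · rw [intervalIntegral.integral_symm, neg_nonpos]
    refine intervalIntegral.integral_nonneg hle fun t ht => ?_
    rw [neg_nonneg]
    refine mul_nonpos_of_nonneg_of_nonpos (h.nonneg t) ?_
    rw [← neg_nonneg, ← Real.sin_neg]
    exact Real.sin_nonneg_of_nonneg_of_le_pi (by linarith [ht.2]) (by linarith [ht.1, hy.1])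

end HasCurvatureRadius

/-! ### Indexing equally spaced directions -/

/-- An increasing sequence of integers, `2n`-periodic with `n` steps per period, that meets every
residue class modulo `n` in one class modulo `2n`. -/
structure IsIndexing (n : ℕ) (K : ℕ → ℤ) : Prop where
  strictMono : StrictMono K
  add_n : ∀ i, K (i + n) = K i + 2 * n
  dvd_sub : ∀ i k, (n : ℤ) ∣ K i - K k → (2 * n : ℤ) ∣ K i - K k
  exists_dvd : ∀ M : ℤ, ∃ i, (n : ℤ) ∣ M - K i

/-- `M` agrees modulo `2n` with a term of `K`. -/
def IsOccupied (n : ℕ) (K : ℕ → ℤ) (M : ℤ) : Prop := ∃ i, (2 * n : ℤ) ∣ M - K i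

namespace IsIndexing

variable {n : ℕ} {K : ℕ → ℤ}

/-- Discrete form of constant width: every residue modulo `n` is attained, but by only one of its
two lifts modulo `2n`. -/
lemma isOccupied_add (h : IsIndexing n K) (hn : 0 < n) (M : ℤ) :
    IsOccupied n K (M + n) ↔ ¬ IsOccupied n K M := by
  have hn' : (0 : ℤ) < n := by exact_mod_cast hn
  constructor
  · rintro ⟨i, c, hc⟩ ⟨k, d, hd⟩
    obtain ⟨e, he⟩ := h.dvd_sub k i ⟨1 + 2 * c - 2 * d - 2, by linear_combination hc - hd⟩
    have h1 : (n : ℤ) * (2 * e) = n * (2 * c - 2 * d - 1) := by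
      linear_combination hc - hd - he
    have := mul_left_cancel₀ hn'.ne' h1
    omega
  · intro hM
    obtain ⟨i, c, hc⟩ := h.exists_dvd M
    refine ⟨i, ?_⟩
    rcases Int.even_or_odd' c with ⟨d, hd | hd⟩
    · exact absurd ⟨i, d, by rw [hc, hd]; ring⟩ hM
    · exact ⟨d + 1, by rw [hd] at hc; linear_combination hc⟩

lemma add_mul (h : IsIndexing n K) (i c : ℕ) : K (i + n * c) = K i + 2 * n * c := by
  induction c with
  | zero => simp
  | succ c ih => rw [Nat.mul_succ, ← add_assoc, h.add_n, ih]; push_cast; ring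

lemma not_isOccupied (h : IsIndexing n K) {i : ℕ} {M : ℤ} (h1 : K i < M) (h2 : M < K (i + 1)) :
    ¬ IsOccupied n K M := by
  rintro ⟨k, c, hc⟩
  have key : ∀ m, M + 2 * n * (m : ℕ) ≠ K k := by
    intro m hm
    have h3 := h.add_mul i m
    have h4 := h.add_mul (i + 1) m
    have h5 : i + n * m < k := h.strictMono.lt_iff_lt.1 (by linarith)
    have h6 : k < i + 1 + n * m := h.strictMono.lt_iff_lt.1 (by linarith)
    omega
  -- Since `K` is indexed by `ℕ`, periods can only be added; the sign of `c` decides whether they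
  -- are added to `K k` or to the interval containing `M`.
  rcases le_total 0 c with h0 | h0
  · obtain ⟨m, rfl⟩ := Int.eq_ofNat_of_zero_le h0
    have h3 := h.add_mul k m
    have h4 : K (k + n * m) = M := by rw [h3]; linarith
    rw [← h4] at h1 h2
    have h5 := h.strictMono.lt_iff_lt.1 h1
    have h6 := h.strictMono.lt_iff_lt.1 h2
    omega
  · obtain ⟨m, hm⟩ := Int.eq_ofNat_of_zero_le (neg_nonneg.2 h0)
    exact key m (by rw [← hm]; linear_combination hc)

end IsIndexing

/-- The residue of `K i` modulo `n` is `σ (i % n)`, so it determines `i % n`. This turns the weak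
monotonicity of the angles into strict monotonicity, consecutive indices being different modulo `n >
1`. -/
lemma IsUnrolling.exists_indexing {n : ℕ} {α : Fin n → ℂ} {a : ℕ → ℂ} {θ ρ : ℕ → ℝ} (hn : 1 < n)
    (h : IsUnrolling α a θ ρ) (he : IsEquidirected α) :
    ∃ (s β : ℝ) (K : ℕ → ℤ), 0 < s ∧ (∀ i, ρ i = s) ∧ IsIndexing n K ∧
      ∀ i, θ i = β + K i * (Real.pi / n) := by
  have hn0 : 0 < n := by omega
  have hz : (0 : ℤ) < n := by exact_mod_cast hn0
  have hpi := Real.pi_pos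
  obtain ⟨s, β, σ, hs, hα⟩ := (isEquidirected_iff α).1 he
  have hρ : ∀ i, ρ i = s := fun i => by
    rw [h.length_eq ⟨i % n, Nat.mod_lt _ hn0⟩ i rfl]
    exact (hα _).1
  have hθmul : ∀ i c : ℕ, θ (i + n * c) = θ i + c * (2 * Real.pi) := by
    intro i c
    induction c with
    | zero => simp
    | succ c ih => rw [Nat.mul_succ, ← add_assoc, h.angle_add_n, ih]; push_cast; ring
  have hex : ∀ i, ∃ k : ℤ, θ i = β + k * (Real.pi / n) ∧
      (n : ℤ) ∣ k - (σ ⟨i % n, Nat.mod_lt _ hn0⟩ : ℕ) := by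
    intro i
    set j : Fin n := ⟨i % n, Nat.mod_lt _ hn0⟩ with hj
    have hedge : edge α j = (ρ j : ℂ) * Complex.exp ((θ j : ℂ) * Complex.I) := by
      rw [h.edge_eq, h.step]; simp [circleMap]
    obtain ⟨-, m, hm⟩ := eq_norm_and_arg (h.pos j) hedge
    obtain ⟨-, m', hm'⟩ := hα j
    have h1 := hθmul j (i / n)
    rw [show (j : ℕ) + n * (i / n) = i from Nat.mod_add_div i n] at h1
    refine ⟨(σ j : ℕ) + n * (m' - 2 * m + 2 * (i / n : ℕ)), ?_,
      ⟨m' - 2 * m + 2 * (i / n : ℕ), by ring⟩⟩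
    rw [h1, show θ j = β + (σ j : ℕ) * (Real.pi / n) + m' * Real.pi - m * (2 * Real.pi) by linarith]
    generalize i / n = c
    push_cast
    field_simp
    ring
  choose K hK hKσ using hex
  have hmod : ∀ i k, (n : ℤ) ∣ K i - K k → i % n = k % n := by
    intro i k hik
    have h1 : (n : ℤ) ∣ ((σ ⟨i % n, Nat.mod_lt _ hn0⟩ : ℕ) : ℤ) -
        (σ ⟨k % n, Nat.mod_lt _ hn0⟩ : ℕ) := by
      have := (hik.sub (hKσ i)).add (hKσ k)
      rwa [show K i - K k - (K i - (σ ⟨i % n, Nat.mod_lt _ hn0⟩ : ℕ)) +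
        (K k - (σ ⟨k % n, Nat.mod_lt _ hn0⟩ : ℕ)) = ((σ ⟨i % n, Nat.mod_lt _ hn0⟩ : ℕ) : ℤ) -
        (σ ⟨k % n, Nat.mod_lt _ hn0⟩ : ℕ) by ring] at this
    have h2 := (σ ⟨i % n, Nat.mod_lt _ hn0⟩).2
    have h3 := (σ ⟨k % n, Nat.mod_lt _ hn0⟩).2
    have h4 := Int.eq_zero_of_abs_lt_dvd h1 (by rw [abs_lt]; omega)
    have h5 : σ ⟨i % n, Nat.mod_lt _ hn0⟩ = σ ⟨k % n, Nat.mod_lt _ hn0⟩ := Fin.ext (by omega)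
    simpa using σ.injective h5
  have hinj : ∀ i k : ℕ, ∀ x : ℝ, θ i = θ k + x * Real.pi → (K i : ℝ) = K k + x * n := by
    intro i k x hx
    rw [hK, hK k] at hx
    field_simp at hx
    refine mul_left_cancel₀ hpi.ne' ?_
    linear_combination hx
  have hmul : ∀ i c : ℕ, K (i + n * c) = K i + 2 * n * c := by
    intro i c
    have := hinj (i + n * c) i (2 * c) (by rw [hθmul]; ring)
    have h2 : (K (i + n * c) : ℝ) = ((K i + 2 * n * c : ℤ) : ℝ) := by rw [this]; push_cast; ring
    exact_mod_cast h2
  refine ⟨s, β, K, hs, hρ, ⟨?_, ?_, ?_, ?_⟩, hK⟩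
  · refine strictMono_nat_of_lt_succ fun i => lt_of_le_of_ne ?_ fun heq => ?_
    · have h1 := h.mono (Nat.le_succ i)
      rw [hK, hK (i + 1)] at h1
      have h2 : (K i : ℝ) * (Real.pi / n) ≤ K (i + 1) * (Real.pi / n) := by linarith
      have h3 := le_of_mul_le_mul_right h2 (by positivity)
      exact_mod_cast h3
    · have h1 := hmod i (i + 1) (by rw [heq]; simp)
      have h2 : (i + 1) % n = (i % n + 1) % n := by rw [Nat.add_mod, Nat.mod_eq_of_lt hn]
      rcases Nat.lt_or_ge (i % n + 1) n with hlt | hge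
      · rw [Nat.mod_eq_of_lt hlt] at h2; omega
      · have h3 : i % n + 1 = n := le_antisymm (Nat.mod_lt _ hn0) hge
        rw [h3, Nat.mod_self] at h2
        omega
  · intro i
    have := hmul i 1
    simpa using this
  · intro i k hik
    have h1 := hmod i k hik
    have h2 := hmul (i % n) (i / n)
    have h3 := hmul (k % n) (k / n)
    rw [Nat.mod_add_div] at h2 h3
    rw [h2, h3, h1]
    exact ⟨(i / n : ℕ) - (k / n : ℕ), by ring⟩
  · intro M
    have h0 := Int.emod_nonneg M hz.ne'
    have h1 := Int.emod_lt_of_pos M hz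
    set j := σ.symm ⟨(M % n).toNat, by omega⟩ with hj
    refine ⟨j, ?_⟩
    have h2 := hKσ j
    have h3 : (⟨(j : ℕ) % n, Nat.mod_lt _ hn0⟩ : Fin n) = j := Fin.ext (Nat.mod_eq_of_lt j.2)
    rw [h3, hj, Equiv.apply_symm_apply, ← hj] at h2
    simp only [Int.toNat_of_nonneg h0] at h2
    have h4 : (n : ℤ) ∣ M - M % n := Int.dvd_self_sub_emod
    have := h4.sub h2
    rwa [show M - M % n - (K j - M % n) = M - K j by ring] at this

/-! ### The Reuleaux body of an equilateral polygon with equally spaced directions -/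

open Classical in
/-- The radius of curvature: `A` on the arcs starting at `t₀ + K i * (π / n)`, and `0` elsewhere. -/
def stepRadius (n : ℕ) (K : ℕ → ℤ) (t₀ A t : ℝ) : ℝ :=
  if IsOccupied n K ⌊(t - t₀) / (Real.pi / n)⌋ then A else 0

lemma measurable_stepRadius (n : ℕ) (K : ℕ → ℤ) (t₀ A : ℝ) : Measurable (stepRadius n K t₀ A) := by
  classical
  exact (measurable_of_countable fun M : ℤ => if IsOccupied n K M then A else 0).comp
    (Int.measurable_floor.comp (by fun_prop))

lemma stepRadius_nonneg (n : ℕ) (K : ℕ → ℤ) (t₀ : ℝ) {A : ℝ} (hA : 0 < A) (t : ℝ) :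
    0 ≤ stepRadius n K t₀ A t := by
  unfold stepRadius
  split_ifs
  · exact hA.le
  · exact le_rfl

lemma stepRadius_le (n : ℕ) (K : ℕ → ℤ) (t₀ : ℝ) {A : ℝ} (hA : 0 < A) (t : ℝ) :
    stepRadius n K t₀ A t ≤ A := by
  unfold stepRadius
  split_ifs
  · exact le_rfl
  · exact hA.le

lemma stepRadius_add_pi {n : ℕ} {K : ℕ → ℤ} (h : IsIndexing n K) (hn : 0 < n) (t₀ A t : ℝ) :
    stepRadius n K t₀ A (t + Real.pi) = A - stepRadius n K t₀ A t := by
  have h1 : (t + Real.pi - t₀) / (Real.pi / n) = (t - t₀) / (Real.pi / n) + (n : ℤ) := by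
    push_cast
    field_simp
    ring
  unfold stepRadius
  rw [h1, Int.floor_add_intCast]
  by_cases hM : IsOccupied n K ⌊(t - t₀) / (Real.pi / n)⌋
  · rw [if_pos hM, if_neg (fun h2 => (h.isOccupied_add hn _).1 h2 hM), sub_self]
  · rw [if_neg hM, if_pos ((h.isOccupied_add hn _).2 hM), sub_zero]

lemma stepRadius_of_mem_arc {n : ℕ} {K : ℕ → ℤ} (hn : 0 < n) {t₀ A t : ℝ} {i : ℕ}
    (ht : t ∈ Set.Ico (t₀ + K i * (Real.pi / n)) (t₀ + K i * (Real.pi / n) + Real.pi / n)) :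
    stepRadius n K t₀ A t = A := by
  have hℓ : 0 < Real.pi / n := by have := Real.pi_pos; positivity
  have h1 : ⌊(t - t₀) / (Real.pi / n)⌋ = K i := by
    rw [Int.floor_eq_iff, le_div_iff₀ hℓ, div_lt_iff₀ hℓ]
    exact ⟨by linarith [ht.1], by linarith [ht.2]⟩
  rw [stepRadius, h1, if_pos ⟨i, by simp⟩]

lemma stepRadius_of_mem_gap {n : ℕ} {K : ℕ → ℤ} (h : IsIndexing n K) (hn : 0 < n) {t₀ A t : ℝ}
    {i : ℕ} (ht : t ∈ Set.Ico (t₀ + K i * (Real.pi / n) + Real.pi / n)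
      (t₀ + K (i + 1) * (Real.pi / n))) :
    stepRadius n K t₀ A t = 0 := by
  have hℓ : 0 < Real.pi / n := by have := Real.pi_pos; positivity
  rw [stepRadius, if_neg]
  apply h.not_isOccupied (i := i)
  · rw [← Int.add_one_le_iff, Int.le_floor, le_div_iff₀ hℓ]
    push_cast
    linarith [ht.1]
  · rw [Int.floor_lt, div_lt_iff₀ hℓ]
    linarith [ht.2]

/-- An edge of length `s` is the chord of an arc of angle `ℓ` and radius `s / (2 sin (ℓ / 2))`,
perpendicular to the middle normal `p + ℓ / 2`. -/
lemma chord_eq (p : ℝ) {ℓ s : ℝ} (hs : Real.sin (ℓ / 2) ≠ 0) (z : ℂ) :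
    circleMap z s (p + ℓ / 2 + Real.pi / 2) =
      z + (circleMap 0 (s / (2 * Real.sin (ℓ / 2))) (p + ℓ) -
        circleMap 0 (s / (2 * Real.sin (ℓ / 2))) p) := by
  have e1 : Real.cos (p + ℓ) - Real.cos p = -2 * Real.sin (p + ℓ / 2) * Real.sin (ℓ / 2) := by
    rw [Real.cos_sub_cos]
    congr 3 <;> ring_nf
  have e2 : Real.sin (p + ℓ) - Real.sin p = 2 * Real.sin (ℓ / 2) * Real.cos (p + ℓ / 2) := by
    rw [Real.sin_sub_sin]
    congr 3 <;> ring_nf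
  apply Complex.ext
  · simp only [re_circleMap, Complex.add_re, Complex.sub_re, Real.cos_add_pi_div_two,
      Complex.zero_re, zero_add]
    rw [← mul_sub, e1]
    field_simp
  · simp only [im_circleMap, Complex.add_im, Complex.sub_im, Real.sin_add_pi_div_two,
      Complex.zero_im, zero_add]
    rw [← mul_sub, e2]
    field_simp

lemma exists_le_lt_succ {p : ℕ → ℝ} {n : ℕ} {t : ℝ} (h0 : p 0 ≤ t) (hn : t < p n) :
    ∃ i < n, p i ≤ t ∧ t < p (i + 1) := by
  induction n with
  | zero => linarith
  | succ n ih =>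
    rcases lt_or_ge t (p n) with h | h
    · obtain ⟨i, hi, h1⟩ := ih h
      exact ⟨i, by omega, h1⟩
    · exact ⟨n, by omega, h, hn⟩

/-- The curve is obtained by integrating `stepRadius`: it follows an arc over each edge and rests at
the vertices in the gaps. Constant width is `stepRadius_add_pi`, and the curve closes because the
polygon does. -/
lemma isReinhardtNGon_of_isEquidirected {n : ℕ} {α : Fin n → ℂ} (hα : IsConvexNGon α)
    (he : IsEquidirected α) : IsReinhardtNGon α := by
  have hn : 1 < n := hα.two_le
  have hn0 : 0 < n := by omega
  have hpi := Real.pi_pos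
  obtain ⟨a, θ, ρ, hU⟩ := hα.exists_unrolling
  obtain ⟨s, β, K, hs, hρ, hK, hθ⟩ := hU.exists_indexing hn he
  refine ⟨hα, fun j k => ?_, ?_⟩
  · obtain ⟨s', _, _, _, h⟩ := (isEquidirected_iff α).1 he
    rw [(h j).1, (h k).1]
  set ℓ := Real.pi / n with hℓ
  have hℓ0 : 0 < ℓ := by positivity
  have hℓπ : ℓ ≤ Real.pi := div_le_self hpi.le (by exact_mod_cast hn0)
  have hsin : 0 < Real.sin (ℓ / 2) := Real.sin_pos_of_pos_of_lt_pi (by linarith) (by linarith)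
  set A := s / (2 * Real.sin (ℓ / 2)) with hA
  have hA0 : 0 < A := by positivity
  -- The outer normal of an edge is its direction minus `π / 2`, and it is the middle of an arc of
  -- angle `ℓ`.
  set t₀ := β - Real.pi / 2 - ℓ / 2 with ht₀
  set p : ℕ → ℝ := fun i => t₀ + K i * ℓ with hp
  set D := stepRadius n K t₀ A
  have hDi := intervalIntegrable_of_mem_Icc (measurable_stepRadius n K t₀ A)
    (stepRadius_nonneg n K t₀ hA0) (stepRadius_le n K t₀ hA0)
  have hDs : ∀ x y, IntervalIntegrable (fun t => D t • (circleMap 0 1 t * Complex.I)) volume x y :=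
    fun x y => (hDi x y).smul_continuousOn (by fun_prop)
  set γ : ℝ → ℂ := fun t => a 0 + ∫ x in p 0..t, D x • (circleMap 0 1 x * Complex.I) with hγ
  have hcurv : HasCurvatureRadius γ D A := by
    refine ⟨hA0, measurable_stepRadius n K t₀ A, stepRadius_nonneg n K t₀ hA0,
      stepRadius_le n K t₀ hA0, stepRadius_add_pi hK hn0 t₀ A, fun x y => ?_⟩
    simp only [hγ]
    rw [add_sub_add_left_eq_sub, intervalIntegral.integral_interval_sub_left (hDs _ _) (hDs _ _)]
  have harc : ∀ i, ∀ t ∈ Set.Icc (p i) (p i + ℓ),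
      γ t - γ (p i) = circleMap 0 A t - circleMap 0 A (p i) := fun i t ht =>
    hcurv.sub_of_eq_const ht.1 fun x hx =>
      stepRadius_of_mem_arc hn0 ⟨hx.1.le, hx.2.trans_le ht.2⟩
  have hgap : ∀ i, ∀ t ∈ Set.Icc (p i + ℓ) (p (i + 1)), γ t = γ (p i + ℓ) := by
    intro i t ht
    have := hcurv.sub_of_eq_const (d := 0) ht.1 fun x hx =>
      stepRadius_of_mem_gap hK hn0 ⟨hx.1.le, hx.2.trans_le ht.2⟩
    simpa [sub_eq_zero] using this
  have hpstep : ∀ i, p i + ℓ ≤ p (i + 1) := by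
    intro i
    have h1 : K i + 1 ≤ K (i + 1) := hK.strictMono (Nat.lt_succ_self i)
    have h2 : (K i : ℝ) + 1 ≤ K (i + 1) := by exact_mod_cast h1
    simp only [hp]
    nlinarith
  have hvertex_end : ∀ i, γ (p i) = a i → γ (p i + ℓ) = a (i + 1) := by
    intro i hi
    have h1 := harc i (p i + ℓ) ⟨by linarith, le_rfl⟩
    rw [hU.step, hρ, hθ, show β + K i * ℓ = p i + ℓ / 2 + Real.pi / 2 by simp only [hp, ht₀]; ring,
      chord_eq _ hsin.ne', ← hA, ← h1, hi]
    ring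
  have hvertex : ∀ i, γ (p i) = a i := by
    intro i
    induction i with
    | zero => simp [hγ]
    | succ i ih => rw [hgap i _ ⟨hpstep i, le_rfl⟩, hvertex_end i ih]
  have hpn : p (0 + n) = p 0 + 2 * Real.pi := by
    simp only [hp, hK.add_n]
    push_cast
    rw [hℓ]
    field_simp
    ring
  have hS : IsSupportCurve γ A := hcurv.isSupportCurve (p := p 0) (by
    rw [← hpn, hvertex, hvertex, hU.add_n])
  have harc' : ∀ i, ∀ t ∈ Set.Icc (p i) (p i + ℓ), γ t = circleMap (γ (p i + Real.pi)) A t := by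
    intro i t ht
    have h1 := harc i t ht
    have h2 := hS.antipodal (p i)
    simp only [circleMap, zero_add] at h1 h2 ⊢
    linear_combination h1 + h2
  have hfind : ∀ t, ∃ y i, i < n ∧ γ y = γ t ∧ p i ≤ y ∧ y < p (i + 1) := by
    intro t
    obtain ⟨y, hy, hyt⟩ := hS.exists_mem_Ico (p 0) t
    obtain ⟨i, hi, h1⟩ := exists_le_lt_succ (n := 0 + n) hy.1 (by rw [hpn]; exact hy.2)
    exact ⟨y, i, by omega, hyt, h1⟩
  refine ⟨supportBody γ, A, ⟨IsSupportCurve.convex_body, hS.isCompact_body,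
    hS.nonempty_interior_body, hA0, hS.setWidth_body, n, fun i => γ (p i + Real.pi),
    fun i => p i, fun i => p i + ℓ, fun i => by linarith, fun i => ?_, ?_⟩, fun j => ?_, ?_⟩
  · rw [hS.frontier_body]
    exact ⟨_, rfl⟩
  · rw [hS.frontier_body]
    ext z
    rw [Set.mem_iUnion]
    constructor
    · rintro ⟨t, rfl⟩
      obtain ⟨y, i, hi, hyt, hy1, hy2⟩ := hfind t
      refine ⟨⟨i, hi⟩, ?_⟩
      rcases le_total y (p i + ℓ) with h | h
      · exact ⟨y, ⟨hy1, h⟩, by rw [← hyt, harc' i y ⟨hy1, h⟩]⟩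
      · refine ⟨p i + ℓ, ⟨by simp only; linarith, le_rfl⟩, ?_⟩
        rw [← hyt, hgap i y ⟨h, hy2.le⟩, harc' i _ ⟨by linarith, le_rfl⟩]
    · rintro ⟨i, t, ht, rfl⟩
      exact ⟨t, harc' i t ht⟩
  -- The vertices are the starting points of the arcs.
  · rw [hS.frontier_body]
    exact ⟨p j, by rw [hvertex, hU.apply]⟩
  · intro z hz
    have hzf : z ∈ frontier (supportBody γ) := by
      obtain ⟨c₁, _, a₁, b₁, _, _, _, h1, _, h2, _, h3, _⟩ := hz
      exact h2 ⟨b₁, ⟨h1.le, le_rfl⟩, h3.symm⟩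
    rw [hS.frontier_body] at hzf
    obtain ⟨t, rfl⟩ := hzf
    obtain ⟨y, i, hi, hyt, hy1, hy2⟩ := hfind t
    rw [← hyt] at hz ⊢
    rcases hy1.eq_or_lt with rfl | hy1
    · rw [hvertex]
      exact hU.mem_range i
    rcases lt_or_ge y (p i + ℓ) with h | h
    · exact absurd hz (hS.not_isEssentialEndpoint (harc' i) ⟨hy1, h⟩)
    · rw [hgap i y ⟨h, hy2.le⟩, hvertex_end i (hvertex i)]
      exact hU.mem_range _

/-! ### The support curve of a Reuleaux body -/

lemma exists_eq_mul_component (f : ℂ →L[ℝ] ℝ) : ∃ φ, ∀ w,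
    f w = ‖(⟨f 1, f Complex.I⟩ : ℂ)‖ * component w φ := by
  refine ⟨(⟨f 1, f Complex.I⟩ : ℂ).arg, fun w => ?_⟩
  have h1 := Complex.norm_mul_cos_arg (⟨f 1, f Complex.I⟩ : ℂ)
  have h2 := Complex.norm_mul_sin_arg (⟨f 1, f Complex.I⟩ : ℂ)
  have h3 : f w = w.re * f 1 + w.im * f Complex.I := by
    conv_lhs => rw [show w = w.re • (1 : ℂ) + w.im • Complex.I by
      simp [Complex.re_add_im]]
    rw [map_add, map_smul, map_smul, smul_eq_mul, smul_eq_mul]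
  rw [h3, component]
  simp only at h1 h2
  linear_combination -w.re * h1 - w.im * h2

/-- Let `γ φ` be a highest point in the direction `φ`. Constant width bounds the diameter by `r`,
and two points at distance at most `r` and height difference `r` along `φ` differ by exactly `r
exp(iφ)`. A frontier point is separated from the interior by a functional, that is, by a component,
so it is some `γ φ`. -/
lemma IsReuleauxBody.exists_isSupportCurve {D : Set ℂ} {r : ℝ} (h : IsReuleauxBody D r) :
    ∃ γ, IsSupportCurve γ r ∧ frontier D = Set.range γ := by
  obtain ⟨z₀, hz₀⟩ := h.nonempty_interior
  have hne : D.Nonempty := ⟨z₀, interior_subset hz₀⟩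
  have hmax : ∀ φ, ∃ z ∈ D, ∀ w ∈ D, component w φ ≤ component z φ := fun φ => by
    obtain ⟨z, hz, hzm⟩ := h.isCompact.exists_isMaxOn hne
      (f := fun w => component w φ) (by unfold component; fun_prop)
    exact ⟨z, hz, fun w hw => hzm hw⟩
  choose γ hγD hγmax using hmax
  have hwidth : ∀ φ, component (γ φ) φ - component (γ (φ + Real.pi)) φ = r := by
    intro φ
    have hsup : IsGreatest ((fun z : ℂ => (z * Complex.exp (-(φ * Complex.I))).re) '' D)
        (component (γ φ) φ) := by
      refine ⟨⟨γ φ, hγD φ, re_mul_exp_neg _ _⟩, ?_⟩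
      rintro _ ⟨z, hz, rfl⟩
      simp only [re_mul_exp_neg]
      exact hγmax φ z hz
    have hinf : IsLeast ((fun z : ℂ => (z * Complex.exp (-(φ * Complex.I))).re) '' D)
        (component (γ (φ + Real.pi)) φ) := by
      refine ⟨⟨γ (φ + Real.pi), hγD _, re_mul_exp_neg _ _⟩, ?_⟩
      rintro _ ⟨z, hz, rfl⟩
      simp only [re_mul_exp_neg]
      have := hγmax (φ + Real.pi) z hz
      rw [component_add_pi, component_add_pi] at this
      linarith
    have := h.constant_width φ
    rwa [setWidth, hsup.csSup_eq, hinf.csInf_eq] at this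
  have hdiam : ∀ z ∈ D, ∀ w ∈ D, ‖z - w‖ ≤ r := by
    intro z hz w hw
    rw [← component_arg]
    set η := (z - w).arg
    have h1 := hγmax η z hz
    have h2 := hγmax (η + Real.pi) w hw
    rw [component_add_pi, component_add_pi] at h2
    rw [component_sub]
    linarith [hwidth η]
  have hS : IsSupportCurve γ r := by
    refine ⟨h.width_pos, fun φ => ?_, fun φ ψ => ?_⟩
    · refine eq_circleMap_of_norm_le (hdiam _ (hγD _) _ (hγD _)) ?_
      rw [component_sub, hwidth]
    · rw [component_sub]
      linarith [hγmax φ (γ ψ) (hγD ψ)]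
  have hsub : D ⊆ supportBody γ := fun z hz φ => by
    rw [component_sub]
    linarith [hγmax φ z hz]
  refine ⟨γ, hS, ?_⟩
  rw [h.isCompact.isClosed.frontier_eq]
  ext z
  constructor
  · rintro ⟨hz, hzi⟩
    obtain ⟨f, hf⟩ := geometric_hahn_banach_open_point h.convex.interior isOpen_interior hzi
    have hle : ∀ w ∈ D, f w ≤ f z := by
      have hcl : D ⊆ closure (interior D) := by
        rw [h.convex.closure_interior_eq_closure_of_nonempty_interior h.nonempty_interior]
        exact subset_closure
      intro w hw
      have hclosed : IsClosed {w | f w ≤ f z} := isClosed_le f.continuous continuous_const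
      exact closure_minimal (fun a ha => (hf a ha).le) hclosed (hcl hw)
    obtain ⟨φ, hφ⟩ := exists_eq_mul_component f
    have hpos : 0 < ‖(⟨f 1, f Complex.I⟩ : ℂ)‖ := by
      refine lt_of_le_of_ne (norm_nonneg _) fun h0 => ?_
      have := hf z₀ hz₀
      rw [hφ, hφ z, ← h0] at this
      simp at this
    have h1 := hle _ (hγD φ)
    rw [hφ, hφ z] at h1
    have h2 := le_of_mul_le_mul_left h1 hpos
    refine ⟨φ, (hS.eq_of_component_eq (hsub hz) ?_).symm⟩
    rw [component_sub]
    linarith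
  · rintro ⟨φ, rfl⟩
    refine ⟨hγD φ, fun hi => ?_⟩
    have h1 : γ φ ∈ frontier (supportBody γ) := by rw [hS.frontier_body]; exact ⟨φ, rfl⟩
    rw [IsSupportCurve.isClosed_body.frontier_eq] at h1
    exact h1.2 (interior_mono hsub hi)

/-! ### Local structure of the support curve of a Reuleaux body -/

lemma eq_of_eventually_eq {f : ℝ → ℂ} (hf : Continuous f) {u v : ℝ}
    (h : ∀ x ∈ Set.Ioo u v, ∀ᶠ y in nhds x, f y = f x) :
    ∀ x ∈ Set.Icc u v, ∀ y ∈ Set.Icc u v, f x = f y := by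
  have hd : ∀ x ∈ Set.Ioo u v, HasDerivAt f 0 x := fun x hx =>
    (hasDerivAt_const x (f x)).congr_of_eventuallyEq (h x hx)
  intro x hx y hy
  rcases lt_or_ge u v with huv | huv
  · have hm : (u + v) / 2 ∈ Set.Ioo u v := ⟨by linarith, by linarith⟩
    have hconst : ∀ x ∈ Set.Ioo u v, f x = f ((u + v) / 2) := fun x hx =>
      isOpen_Ioo.is_const_of_deriv_eq_zero isPreconnected_Ioo
        (fun x hx => (hd x hx).differentiableAt.differentiableWithinAt)
        (fun x hx => (hd x hx).deriv) hx hm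
    have hcl : ∀ x ∈ Set.Icc u v, f x = f ((u + v) / 2) := by
      rw [← closure_Ioo huv.ne]
      exact fun x hx => closure_minimal (s := Set.Ioo u v) (t := {x | f x = f ((u + v) / 2)})
        hconst (isClosed_eq hf continuous_const) hx
    rw [hcl x hx, hcl y hy]
  · rw [show x = y by linarith [hx.1, hx.2, hy.1, hy.2]]

/-- The support curve of a body whose boundary is a finite union of arcs. -/
structure IsPiecewiseArc (γ : ℝ → ℂ) (r : ℝ) {m : ℕ} (c : Fin m → ℂ) (a b : Fin m → ℝ) : Prop
    extends IsSupportCurve γ r where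
  arc : ∀ i, ∀ φ ∈ Set.Icc (a i) (b i), γ φ = circleMap (c i) r φ
  cover : ∀ φ, ∃ i, ∃ ψ ∈ Set.Icc (a i) (b i), γ φ = circleMap (c i) r ψ

/-- The arcs are already parametrized by their normals: the point at angle `φ` is `r` above the
center, which lies in a body of diameter at most `r`, so it is highest in the direction `φ`. -/
lemma IsReuleauxBody.exists_isPiecewiseArc {D : Set ℂ} {r : ℝ} (h : IsReuleauxBody D r) :
    ∃ γ, frontier D = Set.range γ ∧ ∃ (m : ℕ) (c : Fin m → ℂ) (a b : Fin m → ℝ),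
      IsPiecewiseArc γ r c a b := by
  obtain ⟨γ, hS, hfr⟩ := h.exists_isSupportCurve
  obtain ⟨m, c, a, b, -, hc, hu⟩ := h.arcs
  refine ⟨γ, hfr, m, c, a, b, ⟨hS, fun i φ hφ => ?_, fun φ => ?_⟩⟩
  · have hz : circleMap (c i) r φ ∈ frontier D := by
      rw [hu]
      exact Set.mem_iUnion.2 ⟨i, φ, hφ, rfl⟩
    have hci := hc i
    rw [hfr] at hz hci
    obtain ⟨x, hx⟩ := hz
    obtain ⟨y, hy⟩ := hci
    symm
    rw [← hx]
    refine hS.eq_of_component_eq (hS.mem_body x) ?_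
    have h1 := (component_le_norm (γ φ - γ y) φ).trans
      (hS.norm_sub_le (hS.mem_body φ) (hS.mem_body y))
    rw [hx, component_sub, component_circleMap, sub_self, Real.cos_zero, mul_one]
    rw [component_sub, hy] at h1
    linarith
  · have hz : γ φ ∈ frontier D := by rw [hfr]; exact ⟨φ, rfl⟩
    rw [hu] at hz
    obtain ⟨i, ψ, hψ, he⟩ := Set.mem_iUnion.1 hz
    exact ⟨i, ψ, hψ, he.symm⟩

namespace IsPiecewiseArc

variable {γ : ℝ → ℂ} {r : ℝ} {m : ℕ} {c : Fin m → ℂ} {a b : Fin m → ℝ}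

/-- The endpoints of the arcs. -/
def ends (r : ℝ) {m : ℕ} (c : Fin m → ℂ) (a b : Fin m → ℝ) : Set ℂ :=
  Set.range (fun i => circleMap (c i) r (a i)) ∪ Set.range (fun i => circleMap (c i) r (b i))

lemma finite_ends (r : ℝ) {m : ℕ} (c : Fin m → ℂ) (a b : Fin m → ℝ) : (ends r c a b).Finite :=
  (Set.finite_range _).union (Set.finite_range _)

/-- Around such a direction the curve runs inside one arc, and its antipode stays at the center of
that arc. -/
lemma eventually_antipodal_eq (h : IsPiecewiseArc γ r c a b) {φ : ℝ} (hφ : γ φ ∉ ends r c a b) :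
    ∀ᶠ x in nhds φ, γ (x + Real.pi) = γ (φ + Real.pi) := by
  obtain ⟨i, ψ, hψ, he⟩ := h.cover φ
  have hψ' : ψ ∈ Set.Ioo (a i) (b i) := by
    refine ⟨lt_of_le_of_ne hψ.1 ?_, lt_of_le_of_ne hψ.2 ?_⟩
    · rintro rfl
      exact hφ (Or.inl ⟨i, he.symm⟩)
    · rintro rfl
      exact hφ (Or.inr ⟨i, he.symm⟩)
  obtain ⟨k, hk⟩ := h.eq_add_int_mul_of_arc (h.arc i) hψ' (x := φ) (by rw [h.arc i ψ hψ, he])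
  have hc : ∀ x, x + k * (2 * Real.pi) ∈ Set.Ioo (a i) (b i) → γ (x + Real.pi) = c i := by
    intro x hx
    have h1 := h.arc i _ ⟨hx.1.le, hx.2.le⟩
    rw [h.antipodal, show x + k * (2 * Real.pi) + Real.pi = x + Real.pi + k * (2 * Real.pi) by ring,
      h.add_int_mul] at h1
    simp only [circleMap] at h1
    exact add_right_cancel h1
  have hcont : Continuous fun x : ℝ => x + k * (2 * Real.pi) := by fun_prop
  filter_upwards [hcont.tendsto φ (isOpen_Ioo.mem_nhds (by rw [← hk]; exact hψ'))] with x hx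
  rw [hc x hx, hc φ (by rw [← hk]; exact hψ')]

/-- If `γ x` and `γ (x + π)` are both endpoints, then `r exp(ix)` is a difference of two endpoints.
There are finitely many of these, and `x ↦ r exp(ix)` is injective near `φ`. -/
lemma exists_isolated (h : IsPiecewiseArc γ r c a b) (φ : ℝ) :
    ∃ η > 0, ∀ x, x ≠ φ → |x - φ| < η →
      γ x ∉ ends r c a b ∨ γ (x + Real.pi) ∉ ends r c a b := by
  have hpi := Real.pi_gt_three
  set G : Set ℂ := (fun z : ℂ × ℂ => z.1 - z.2) '' (ends r c a b ×ˢ ends r c a b)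
  have hGfin : G.Finite := ((finite_ends r c a b).prod (finite_ends r c a b)).image _
  have hinj : Set.InjOn (circleMap 0 r) (Set.Icc (φ - 1) (φ + 1)) := by
    intro x hx y hy he
    rcases lt_trichotomy x y with h1 | h1 | h1
    · exact absurd he (circleMap_ne h.pos h1 (by linarith [hx.1, hy.2]))
    · exact h1
    · exact absurd he.symm (circleMap_ne h.pos h1 (by linarith [hy.1, hx.2]))
  have hfin : (Set.Icc (φ - 1) (φ + 1) ∩ circleMap 0 r ⁻¹' G).Finite :=
    Set.Finite.of_finite_image (hGfin.subset (by rintro _ ⟨x, hx, rfl⟩; exact hx.2))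
      (hinj.mono Set.inter_subset_left)
  have hopen : IsOpen ((Set.Icc (φ - 1) (φ + 1) ∩ circleMap 0 r ⁻¹' G) \ {φ})ᶜ :=
    (hfin.subset Set.sdiff_subset).isClosed.isOpen_compl
  obtain ⟨ε, hε, hball⟩ := Metric.isOpen_iff.1 hopen φ (by simp)
  refine ⟨min ε 1, lt_min hε one_pos, fun x hx hd => ?_⟩
  by_contra! hc
  have h1 : x ∈ Metric.ball φ ε := by
    rw [Metric.mem_ball, Real.dist_eq]
    exact hd.trans_le (min_le_left _ _)
  have h2 := abs_lt.1 (hd.trans_le (min_le_right _ _))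
  refine hball h1 ⟨⟨⟨by linarith, by linarith⟩, ⟨(γ x, γ (x + Real.pi)), hc, ?_⟩⟩, hx⟩
  simp only
  rw [h.antipodal x]
  simp [circleMap]

/-- The sets where `γ`, respectively its antipode, is locally constant are open and cover the
interval. They are disjoint because `γ x - γ (x + π) = r exp(ix)` is not locally constant, so
connectedness selects one of them. -/
lemma const_or_const (h : IsPiecewiseArc γ r c a b) {u v : ℝ}
    (hx : ∀ x ∈ Set.Ioo u v, γ x ∉ ends r c a b ∨ γ (x + Real.pi) ∉ ends r c a b) :
    (∀ x ∈ Set.Icc u v, ∀ y ∈ Set.Icc u v, γ x = γ y) ∨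
    (∀ x ∈ Set.Icc u v, ∀ y ∈ Set.Icc u v, γ (x + Real.pi) = γ (y + Real.pi)) := by
  have hcont' : Continuous fun x => γ (x + Real.pi) := h.continuous.comp (by fun_prop)
  set U₁ : Set ℝ := {x | ∀ᶠ y in nhds x, γ y = γ x}
  set U₂ : Set ℝ := {x | ∀ᶠ y in nhds x, γ (y + Real.pi) = γ (x + Real.pi)}
  have hopen : ∀ f : ℝ → ℂ, IsOpen {x | ∀ᶠ y in nhds x, f y = f x} := by
    intro f
    rw [isOpen_iff_mem_nhds]
    intro x hx
    filter_upwards [eventually_eventually_nhds.2 hx, hx] with y hy hyx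
    filter_upwards [hy] with z hz
    rw [hz, hyx]
  have hdisj : Disjoint U₁ U₂ := by
    rw [Set.disjoint_left]
    intro x h1 h2
    obtain ⟨ε, hε, hball⟩ := Metric.mem_nhds_iff.1 (Filter.inter_mem h1 h2)
    set d := min (ε / 2) 1
    have hd0 : 0 < d := lt_min (by linarith) one_pos
    have h3 : x + d ∈ Metric.ball x ε := by
      rw [Metric.mem_ball, Real.dist_eq, add_sub_cancel_left, abs_of_pos hd0]
      linarith [min_le_left (ε / 2) 1]
    obtain ⟨h4, h5⟩ := hball h3
    simp only [Set.mem_ofPred_eq] at h4 h5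
    rw [h.antipodal x, h.antipodal (x + d), h5] at h4
    exact circleMap_ne h.pos (by linarith) (by linarith [min_le_right (ε / 2) 1, Real.pi_gt_three])
      h4.symm
  have hcover : Set.Ioo u v ⊆ U₁ ∪ U₂ := by
    intro x hxm
    rcases hx x hxm with h1 | h1
    · exact Or.inr (h.eventually_antipodal_eq h1)
    · left
      have h2 := h.eventually_antipodal_eq h1
      have h3 : Filter.Tendsto (fun y : ℝ => y + Real.pi) (nhds x) (nhds (x + Real.pi)) :=
        (continuous_add_const Real.pi).tendsto x
      filter_upwards [h3.eventually h2] with y hy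
      rwa [show y + Real.pi + Real.pi = y + 2 * Real.pi by ring,
        show x + Real.pi + Real.pi = x + 2 * Real.pi by ring, h.add_two_pi, h.add_two_pi] at hy
  rcases isPreconnected_Ioo.subset_or_subset (hopen γ) (hopen fun x => γ (x + Real.pi)) hdisj
    hcover with h1 | h1
  · exact Or.inl (eq_of_eventually_eq h.continuous fun x hx => h1 hx)
  · exact Or.inr (eq_of_eventually_eq hcont' fun x hx => h1 hx)

/-- On each side of a direction, the curve or its antipode is constant. -/
lemma exists_side_const (h : IsPiecewiseArc γ r c a b) (φ : ℝ) : ∃ η > 0,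
    ((∀ x ∈ Set.Icc φ (φ + η), γ x = γ φ) ∨
      (∀ x ∈ Set.Icc φ (φ + η), γ (x + Real.pi) = γ (φ + Real.pi))) ∧
    ((∀ x ∈ Set.Icc (φ - η) φ, γ x = γ φ) ∨
      (∀ x ∈ Set.Icc (φ - η) φ, γ (x + Real.pi) = γ (φ + Real.pi))) := by
  obtain ⟨η, hη, hiso⟩ := h.exists_isolated φ
  refine ⟨η, hη, ?_, ?_⟩
  · have := h.const_or_const (u := φ) (v := φ + η) fun x hx =>
      hiso x hx.1.ne' (abs_lt.2 ⟨by linarith [hx.1], by linarith [hx.2]⟩)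
    have hm : φ ∈ Set.Icc φ (φ + η) := ⟨le_rfl, by linarith⟩
    exact this.imp (fun h1 x hx => h1 x hx φ hm) (fun h1 x hx => h1 x hx φ hm)
  · have := h.const_or_const (u := φ - η) (v := φ) fun x hx =>
      hiso x hx.2.ne (abs_lt.2 ⟨by linarith [hx.1], by linarith [hx.2]⟩)
    have hm : φ ∈ Set.Icc (φ - η) φ := ⟨by linarith, le_rfl⟩
    exact this.imp (fun h1 x hx => h1 x hx φ hm) (fun h1 x hx => h1 x hx φ hm)

/-- A corner: let `y ≤ u < x` be the extreme normals within `π` of `u` at this point. Just outside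
of them `γ` moves, so the antipode rests; an arc around `γ (y + π)` arrives and one around `γ (x +
π)` departs. Equal centers would give `r exp(iy) = r exp(ix)`. -/
lemma isEssentialEndpoint_of_const (h : IsPiecewiseArc γ r c a b) {D : Set ℂ}
    (hD : frontier D = Set.range γ) {u v : ℝ} (huv : u < v)
    (hconst : ∀ x ∈ Set.Icc u v, γ x = γ u) : IsEssentialEndpoint D r (γ u) := by
  have hpi := Real.pi_pos
  have hclosed : IsClosed {x | γ x = γ u} := isClosed_eq h.continuous continuous_const
  have hright : (Set.Icc u (u + Real.pi) ∩ {x | γ x = γ u}).Nonempty :=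
    ⟨u, ⟨le_rfl, by linarith⟩, rfl⟩
  have hleft : (Set.Icc (u - Real.pi) u ∩ {x | γ x = γ u}).Nonempty :=
    ⟨u, ⟨by linarith, le_rfl⟩, rfl⟩
  obtain ⟨x, ⟨hx, hxe⟩, hxmax⟩ := (isCompact_Icc.inter_right hclosed).exists_isGreatest hright
  obtain ⟨y, ⟨hy, hye⟩, hymin⟩ := (isCompact_Icc.inter_right hclosed).exists_isLeast hleft
  simp only [Set.mem_ofPred_eq] at hxe hye
  have hx1 : u < x := by
    set w := min v (u + Real.pi)
    have h1 : u < w := lt_min huv (by linarith)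
    exact h1.trans_le (hxmax ⟨⟨h1.le, min_le_right _ _⟩, hconst w ⟨h1.le, min_le_left _ _⟩⟩)
  have hx2 : x < u + Real.pi := lt_of_le_of_ne hx.2 fun h1 =>
    h.ne_antipodal u (by rw [← h1, hxe])
  have hy2 : u - Real.pi < y := lt_of_le_of_ne hy.1 fun h1 =>
    h.ne_antipodal y (by rw [← h1, sub_add_cancel, h1, hye])
  obtain ⟨η₁, hη₁, h1, -⟩ := h.exists_side_const x
  obtain ⟨η₂, hη₂, -, h2⟩ := h.exists_side_const y
  have h1' : ∀ t ∈ Set.Icc x (x + η₁), γ (t + Real.pi) = γ (x + Real.pi) := by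
    refine h1.resolve_left fun h3 => ?_
    set w := min (x + η₁) (u + Real.pi)
    have h4 : x < w := lt_min (by linarith) hx2
    have h5 := h3 w ⟨h4.le, min_le_left _ _⟩
    exact absurd (hxmax ⟨⟨by linarith, min_le_right _ _⟩, h5.trans hxe⟩) (not_le.2 h4)
  have h2' : ∀ t ∈ Set.Icc (y - η₂) y, γ (t + Real.pi) = γ (y + Real.pi) := by
    refine h2.resolve_left fun h3 => ?_
    set w := max (y - η₂) (u - Real.pi)
    have h4 : w < y := max_lt (by linarith) hy2
    have h5 := h3 w ⟨le_max_left _ _, h4.le⟩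
    exact absurd (hymin ⟨⟨le_max_right _ _, by linarith [hy.2]⟩, h5.trans hye⟩) (not_le.2 h4)
  refine ⟨γ (y + Real.pi), γ (x + Real.pi), y - η₂, y, x, x + η₁, ?_, by linarith, by linarith,
    ?_, ?_, ?_, ?_⟩
  · intro he
    have h3 := h.antipodal x
    have h4 := h.antipodal y
    rw [hxe] at h3
    rw [hye, he] at h4
    exact circleMap_ne h.pos (by linarith [hy.2]) (by linarith) (h4.symm.trans h3)
  · rintro _ ⟨t, ht, rfl⟩
    rw [hD]
    exact ⟨t, by rw [h.antipodal t, h2' t ht]⟩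
  · rintro _ ⟨t, ht, rfl⟩
    rw [hD]
    exact ⟨t, by rw [h.antipodal t, h1' t ht]⟩
  · rw [← h.antipodal, hye]
  · rw [← h.antipodal, hxe]

end IsPiecewiseArc

/-! ### Tilings of the line by intervals of equal length -/

/-- Closure under `+ ℓ` and gaps of at least `ℓ` make `S`, from `x₀` on, the progression `x₀ + ℓ ℕ`.
It contains `x₀ + π`, so `π = N ℓ`. There are `N` classes modulo `π`, in bijection with the `n`
indices; hence `N = n`. -/
lemma exists_perm_of_tiling {n : ℕ} (hn : 0 < n) {p : Fin n → ℝ} {ℓ : ℝ} (hℓ : 0 < ℓ)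
    {S : Set ℝ} (hS : ∀ x, x ∈ S ↔ ∃ j, ∃ m : ℤ, x = p j + m * Real.pi)
    (hadd : ∀ x ∈ S, x + ℓ ∈ S) (hgap : ∀ x ∈ S, ∀ y ∈ S, x < y → x + ℓ ≤ y)
    (hinj : ∀ j k, ∀ m : ℤ, p j = p k + m * Real.pi → j = k) :
    ∃ (β : ℝ) (σ : Equiv.Perm (Fin n)), ∀ j, ∃ m : ℤ,
      p j = β + (σ j : ℕ) * (Real.pi / n) + m * Real.pi := by
  have hpi := Real.pi_pos
  set x₀ := p ⟨0, hn⟩ with hx₀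
  have hmul : ∀ k : ℕ, x₀ + k * ℓ ∈ S := by
    intro k
    induction k with
    | zero => exact (hS _).2 ⟨⟨0, hn⟩, 0, by simp [hx₀]⟩
    | succ k ih =>
      have := hadd _ ih
      rwa [show x₀ + k * ℓ + ℓ = x₀ + (k + 1 : ℕ) * ℓ by push_cast; ring] at this
  have hchar : ∀ x ∈ S, x₀ ≤ x → ∃ k : ℕ, x = x₀ + k * ℓ := by
    intro x hx hle
    have h0 : 0 ≤ (x - x₀) / ℓ := div_nonneg (by linarith) hℓ.le
    refine ⟨⌊(x - x₀) / ℓ⌋₊, ?_⟩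
    have h1 := Nat.floor_le h0
    have h2 := Nat.lt_floor_add_one ((x - x₀) / ℓ)
    rw [le_div_iff₀ hℓ] at h1
    rw [div_lt_iff₀ hℓ] at h2
    by_contra hne
    have h3 : x₀ + ⌊(x - x₀) / ℓ⌋₊ * ℓ < x := lt_of_le_of_ne (by linarith) (Ne.symm hne)
    have h4 := hgap _ (hmul _) x hx h3
    linarith
  obtain ⟨N, hN⟩ := hchar (x₀ + Real.pi) ((hS _).2 ⟨⟨0, hn⟩, 1, by simp [hx₀]⟩) (by linarith)
  have hN' : (N : ℝ) * ℓ = Real.pi := by linarith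
  have hex : ∀ j, ∃ k : ℕ, k < N ∧ ∃ m : ℤ, p j = x₀ + k * ℓ + m * Real.pi := by
    intro j
    have h1 := toIcoMod_mem_Ico hpi x₀ (p j)
    have h3 := self_sub_toIcoDiv_zsmul hpi x₀ (p j)
    rw [zsmul_eq_mul] at h3
    obtain ⟨k, hk⟩ := hchar (toIcoMod hpi x₀ (p j))
      ((hS _).2 ⟨j, -toIcoDiv hpi x₀ (p j), by push_cast; linarith⟩) h1.1
    refine ⟨k, ?_, toIcoDiv hpi x₀ (p j), by linarith⟩
    have h4 : (k : ℝ) * ℓ < N * ℓ := by linarith [h1.2]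
    exact_mod_cast lt_of_mul_lt_mul_right h4 hℓ.le
  choose k hkN hk using hex
  have hbij : Function.Bijective (fun j => (⟨k j, hkN j⟩ : Fin N)) := by
    constructor
    · intro i j hij
      have hij' : k i = k j := congrArg Fin.val hij
      obtain ⟨m, hm⟩ := hk i
      obtain ⟨m', hm'⟩ := hk j
      refine hinj i j (m - m') ?_
      rw [hm, hm', hij']
      push_cast
      ring
    · rintro ⟨q, hq⟩
      obtain ⟨j, m, hm⟩ := (hS _).1 (hmul q)
      obtain ⟨m', hm'⟩ := hk j
      refine ⟨j, Fin.ext ?_⟩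
      have h1 : (q : ℝ) = k j + (m + m') * N := by
        refine mul_right_cancel₀ hℓ.ne' ?_
        linear_combination hm + hm' - (m + m' : ℝ) * hN'
      have h2 : (q : ℤ) = k j + (m + m') * N := by exact_mod_cast h1
      have h3 := hkN j
      have h4 : (N : ℤ) ∣ (q : ℤ) - k j := ⟨m + m', by linarith⟩
      have h5 := Int.eq_zero_of_abs_lt_dvd h4 (by rw [abs_lt]; omega)
      simp only
      omega
  have hcard := Fintype.card_of_bijective hbij
  rw [Fintype.card_fin, Fintype.card_fin] at hcard
  subst hcard
  refine ⟨x₀, Equiv.ofBijective _ hbij, fun j => ?_⟩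
  obtain ⟨m, hm⟩ := hk j
  refine ⟨m, ?_⟩
  have hn' : (0 : ℝ) < n := by exact_mod_cast hn
  rw [hm, ← hN', mul_div_cancel_left₀ _ hn'.ne']
  simp

/-! ### Edges of polygons inscribed in a Reuleaux body -/

/-- The arc of a Reuleaux body cut off by an edge `z w` with outer normal `exp(i(p + h))`. -/
structure IsArcOver (γ : ℝ → ℂ) (r : ℝ) (V : Set ℂ) (p h : ℝ) (z w : ℂ) : Prop where
  pos : 0 < h
  lt : h < Real.pi / 2
  start_eq : γ p = z
  end_eq : γ (p + 2 * h) = w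
  not_mem : ∀ x ∈ Set.Ioo p (p + 2 * h), γ x ∉ V
  antipode : ∀ x ∈ Set.Icc p (p + 2 * h), γ (x + Real.pi) = γ (p + Real.pi)
  antipode_mem : γ (p + Real.pi) ∈ V

section

variable {γ : ℝ → ℂ} {r : ℝ} {m : ℕ} {c : Fin m → ℂ} {a b : Fin m → ℝ} {V : Set ℂ}

/-- Away from `V` the curve has no corner, so it is the antipode that rests on either side. -/
lemma IsPiecewiseArc.exists_antipode_const (h : IsPiecewiseArc γ r c a b)
    (hconst : ∀ u v, u < v → (∀ x ∈ Set.Icc u v, γ x = γ u) → γ u ∈ V) {φ : ℝ} (hφ : γ φ ∉ V) :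
    ∃ η > 0, ∀ x ∈ Set.Icc (φ - η) (φ + η), γ (x + Real.pi) = γ (φ + Real.pi) := by
  obtain ⟨η, hη, h1, h2⟩ := h.exists_side_const φ
  have h1' := h1.resolve_left fun h3 => hφ (hconst φ (φ + η) (by linarith) h3)
  have h2' := h2.resolve_left fun h3 => hφ (by
    have h4 := hconst (φ - η) φ (by linarith) fun x hx => by
      rw [h3 x hx, h3 (φ - η) ⟨le_rfl, by linarith⟩]
    rwa [h3 (φ - η) ⟨le_rfl, by linarith⟩] at h4)
  refine ⟨η, hη, fun x hx => ?_⟩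
  rcases le_total φ x with hle | hle
  · exact h1' x ⟨hle, hx.2⟩
  · exact h2' x ⟨hx.1, hle⟩

/-- From the outer normal `ν` of the edge, go both ways to the nearest normals `p < ν < q` of points
of `V`. In between there is no corner, so the antipode rests and the curve is one arc. Heights along
`ν` decrease away from `ν`, so the highest points of `V`, which include `z` and `w`, are among `γ p`
and `γ q`. Their equal heights place `ν` at the midpoint. -/
lemma IsPiecewiseArc.exists_isArcOver (h : IsPiecewiseArc γ r c a b)
    (hVclosed : IsClosed V) (hVγ : V ⊆ Set.range γ)
    (hconst : ∀ u v, u < v → (∀ x ∈ Set.Icc u v, γ x = γ u) → γ u ∈ V)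
    {z w : ℂ} (hz : z ∈ V) (hw : w ∈ V) {ν ρ : ℝ} (hρ : 0 < ρ)
    (hzw : w = circleMap z ρ (ν + Real.pi / 2))
    (hleft : ∀ v ∈ V, component v ν ≤ component z ν) :
    ∃ d, IsArcOver γ r V (ν - d) d z w ∧ ρ = 2 * r * Real.sin d := by
  have hpi := Real.pi_pos
  have hr := h.pos
  have hwz : component w ν = component z ν := by
    rw [hzw, component_circleMap, add_sub_cancel_left, Real.cos_pi_div_two, mul_zero, add_zero]
  have hne : z ≠ w := by
    intro he
    have := congrArg (fun v => component v (ν + Real.pi / 2)) hzw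
    simp only [component_circleMap, sub_self, Real.cos_zero, ← he] at this
    linarith
  -- Otherwise `z` and `w` would both be on the support line with normal `ν`, hence both equal to `γ
  -- ν`.
  have hν : γ ν ∉ V := by
    intro hmem
    have h1 := hleft _ hmem
    obtain ⟨x, hx⟩ := hVγ hz
    obtain ⟨y, hy⟩ := hVγ hw
    apply hne
    rw [← hx, ← hy]
    rw [h.eq_of_component_eq (h.mem_body x) (φ := ν) (by rw [component_sub, hx]; linarith),
      h.eq_of_component_eq (h.mem_body y) (φ := ν) (by rw [component_sub, hy]; linarith)]
  -- The antipode rests near `ν`, so it is a corner and belongs to `V`; this also bounds the search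
  -- for `p` and `q` by `π`.
  have hcenter : γ (ν + Real.pi) ∈ V := by
    obtain ⟨η, hη, h1⟩ := h.exists_antipode_const hconst hν
    refine hconst (ν + Real.pi) (ν + Real.pi + η) (by linarith) fun x hx => ?_
    have := h1 (x - Real.pi) ⟨by linarith [hx.1], by linarith [hx.2]⟩
    rwa [sub_add_cancel] at this
  have hcenter' : γ (ν - Real.pi) = γ (ν + Real.pi) := by
    rw [← h.add_two_pi (ν - Real.pi)]; congr 1; ring
  have hclosed : IsClosed {x | γ x ∈ V} := hVclosed.preimage h.continuous
  obtain ⟨p, ⟨hp, hpV⟩, hpmax⟩ := (isCompact_Icc.inter_right hclosed).exists_isGreatest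
    (⟨ν - Real.pi, ⟨le_rfl, by linarith⟩, by
      change γ (ν - Real.pi) ∈ V
      rwa [hcenter']⟩ : (Set.Icc (ν - Real.pi) ν ∩ {x | γ x ∈ V}).Nonempty)
  obtain ⟨q, ⟨hq, hqV⟩, hqmin⟩ := (isCompact_Icc.inter_right hclosed).exists_isLeast
    (⟨ν + Real.pi, ⟨by linarith, le_rfl⟩, hcenter⟩ :
      (Set.Icc ν (ν + Real.pi) ∩ {x | γ x ∈ V}).Nonempty)
  change γ p ∈ V at hpV
  change γ q ∈ V at hqV
  have hpν : p < ν := lt_of_le_of_ne hp.2 (by rintro rfl; exact hν hpV)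
  have hνq : ν < q := lt_of_le_of_ne hq.1 (by rintro rfl; exact hν hqV)
  have hnot : ∀ x ∈ Set.Ioo p q, γ x ∉ V := by
    intro x hx hxV
    rcases le_total x ν with hle | hle
    · exact absurd (hpmax ⟨⟨by linarith [hp.1, hx.1], hle⟩, hxV⟩) (not_le.2 hx.1)
    · exact absurd (hqmin ⟨⟨hle, by linarith [hq.2, hx.2]⟩, hxV⟩) (not_le.2 hx.2)
  have hanti : ∀ x ∈ Set.Icc p q, ∀ y ∈ Set.Icc p q, γ (x + Real.pi) = γ (y + Real.pi) := by
    refine eq_of_eventually_eq (f := fun x => γ (x + Real.pi))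
      (h.continuous.comp (by fun_prop)) fun x hx => ?_
    obtain ⟨η, hη, h1⟩ := h.exists_antipode_const hconst (hnot x hx)
    filter_upwards [Icc_mem_nhds (show x - η < x by linarith) (show x < x + η by linarith)]
      with y hy using h1 y hy
  have hνm : ν ∈ Set.Icc p q := ⟨hpν.le, hνq.le⟩
  have hpm : p ∈ Set.Icc p q := ⟨le_rfl, by linarith⟩
  have hqm : q ∈ Set.Icc p q := ⟨by linarith, le_rfl⟩
  have hγp : γ p = circleMap (γ (ν + Real.pi)) r p := by rw [h.antipodal p, hanti p hpm ν hνm]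
  have hγq : γ q = circleMap (γ (ν + Real.pi)) r q := by rw [h.antipodal q, hanti q hqm ν hνm]
  have hmax : ∀ v ∈ V, component v ν = component z ν → v = γ p ∨ v = γ q := by
    intro v hv hve
    obtain ⟨x', hx'⟩ := hVγ hv
    obtain ⟨x, hx, hxe⟩ := h.exists_mem_Ico (ν - Real.pi) x'
    rw [show ν - Real.pi + 2 * Real.pi = ν + Real.pi by ring] at hx
    rw [← hx', ← hxe] at hv hve ⊢
    rcases le_or_gt x p with h1 | h1
    · left
      refine h.eq_of_component_le h1 hpν (by linarith [hx.1]) ?_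
      rw [component_sub]
      linarith [hleft _ hpV]
    · right
      have h2 : q ≤ x := by
        by_contra! h3
        exact hnot x ⟨h1, h3⟩ hv
      refine h.eq_of_component_le' h2 hνq hx.2.le ?_
      rw [component_sub]
      linarith [hleft _ hqV]
  have hends : (z = γ p ∧ w = γ q) ∨ (z = γ q ∧ w = γ p) := by
    rcases hmax z hz rfl with h1 | h1 <;> rcases hmax w hw hwz with h2 | h2
    · exact absurd (h1.trans h2.symm) hne
    · exact Or.inl ⟨h1, h2⟩
    · exact Or.inr ⟨h1, h2⟩
    · exact absurd (h1.trans h2.symm) hne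
  have hheight : component (γ p) ν = component (γ q) ν := by
    rcases hends with ⟨h1, h2⟩ | ⟨h1, h2⟩
    · rw [← h1, ← h2, hwz]
    · rw [← h1, ← h2, hwz]
  have hmid : q - ν = ν - p := by
    rw [hγp, hγq, component_circleMap, component_circleMap] at hheight
    have h1 : Real.cos (ν - p) = Real.cos (q - ν) := by
      rw [← Real.cos_neg (ν - p), neg_sub]
      exact mul_left_cancel₀ hr.ne' (by linarith)
    exact (Real.injOn_cos ⟨by linarith, by linarith [hp.1]⟩ ⟨by linarith, by linarith [hq.2]⟩
      h1).symm
  -- On a longer interval the resting antipode would identify two antipodal points.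
  have hlt : q - p < Real.pi := by
    by_contra! hge
    have h1 := hanti p hpm (p + Real.pi) ⟨by linarith, by linarith⟩
    rw [show p + Real.pi + Real.pi = p + 2 * Real.pi by ring, h.add_two_pi] at h1
    exact h.ne_antipodal p h1.symm
  set d := ν - p
  have hd0 : 0 < d := by linarith
  have hd2 : d < Real.pi / 2 := by linarith
  have hpd : ν - d = p := by linarith
  have hqd : p + 2 * d = q := by linarith
  have hsin : 0 < Real.sin d := Real.sin_pos_of_pos_of_lt_pi hd0 (by linarith)
  have hchord : component (γ q) (ν + Real.pi / 2) - component (γ p) (ν + Real.pi / 2) =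
      2 * r * Real.sin d := by
    rw [hγp, hγq, component_circleMap, component_circleMap,
      show q - (ν + Real.pi / 2) = d - Real.pi / 2 by linarith,
      show p - (ν + Real.pi / 2) = -(d + Real.pi / 2) by linarith, Real.cos_neg,
      Real.cos_sub_pi_div_two, Real.cos_add_pi_div_two]
    ring
  have hedge : component w (ν + Real.pi / 2) - component z (ν + Real.pi / 2) = ρ := by
    rw [hzw, component_circleMap, sub_self, Real.cos_zero]
    ring
  rcases hends with ⟨h1, h2⟩ | ⟨h1, h2⟩
  · refine ⟨d, ?_, by rw [← hedge, ← hchord, h1, h2]⟩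
    rw [hpd]
    refine ⟨hd0, hd2, h1.symm, by rw [hqd, h2], ?_, ?_, ?_⟩
    · rw [hqd]; exact hnot
    · rw [hqd]; exact fun x hx => hanti x hx p hpm
    · rw [hanti p hpm ν hνm]; exact hcenter
  -- The reversed orientation would make the edge length negative.
  · rw [h1, h2] at hedge
    exfalso
    have : 0 < 2 * r * Real.sin d := by positivity
    linarith

/-- A point of `V` after which the curve leaves `V` is the start of an arc. -/
lemma IsSupportCurve.eq_start_add (h : IsSupportCurve γ r) {p d y η : ℝ} {z w : ℂ}
    (harc : IsArcOver γ r V p d z w) (hV : z ∈ V) (hη : 0 < η) (hy : γ y = z)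
    (hnot : ∀ x ∈ Set.Ioo y (y + η), γ x ∉ V) : ∃ k : ℤ, y = p + k * (2 * Real.pi) := by
  obtain ⟨k, hk⟩ := h.exists_int_abs_lt (φ := y) (ψ := p) (hy.trans harc.start_eq.symm)
  refine ⟨k, ?_⟩
  set p' := p + k * (2 * Real.pi) with hp'
  have hγp' : γ p' = z := by rw [hp', h.add_int_mul, harc.start_eq]
  rw [abs_lt] at hk
  have hd := harc.pos
  rcases lt_trichotomy y p' with h1 | h1 | h1
  · exfalso
    set x := min p' (y + η / 2)
    have h2 : y < x := lt_min h1 (by linarith)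
    have h3 := h.eq_of_mem_Icc (hy.trans hγp'.symm) ⟨h2.le, min_le_left _ _⟩ (by linarith)
    refine hnot x ⟨h2, by linarith [min_le_right p' (y + η / 2)]⟩ ?_
    rw [h3, hy]
    exact hV
  · exact h1
  · exfalso
    set x := min y (p' + d)
    have h2 : p' < x := lt_min h1 (by linarith)
    have h3 := h.eq_of_mem_Icc (hγp'.trans hy.symm) ⟨h2.le, min_le_left _ _⟩ (by linarith)
    have h4 := harc.not_mem (x - k * (2 * Real.pi))
      ⟨by linarith, by linarith [min_le_right y (p' + d)]⟩
    rw [← h.add_int_mul _ k, sub_add_cancel, h3, hγp'] at h4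
    exact h4 hV

/-- Just after `y`, either the curve or its antipode runs injectively along an arc, and so meets the
finite set `V` only finitely often. -/
lemma IsPiecewiseArc.exists_notMem_right (h : IsPiecewiseArc γ r c a b) (hV : V.Finite) (y : ℝ) :
    ∃ η > 0, (∀ x ∈ Set.Ioo y (y + η), γ x ∉ V) ∨
      (∀ x ∈ Set.Ioo y (y + η), γ (x + Real.pi) ∉ V) := by
  have key : ∀ (ψ η : ℝ), 0 < η → (∀ x ∈ Set.Icc ψ (ψ + η), γ (x + Real.pi) = γ (ψ + Real.pi)) →
      ∃ ε > 0, ∀ x ∈ Set.Ioo ψ (ψ + ε), γ x ∉ V := by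
    intro ψ η hη hconst
    set δ := min η 1
    have hδ0 : 0 < δ := lt_min hη one_pos
    have hδ1 : δ ≤ 1 := min_le_right _ _
    have harc : ∀ x ∈ Set.Icc ψ (ψ + δ), γ x = circleMap (γ (ψ + Real.pi)) r x := fun x hx => by
      rw [h.antipodal x, hconst x ⟨hx.1, by linarith [hx.2, min_le_left η 1]⟩]
    have hinj : Set.InjOn γ (Set.Icc ψ (ψ + δ)) := by
      intro x hx y hy he
      rw [harc x hx, harc y hy] at he
      have hpi := Real.pi_gt_three
      rcases lt_trichotomy x y with h1 | h1 | h1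
      · exact absurd he (circleMap_ne h.pos h1 (by linarith [hx.1, hy.2]))
      · exact h1
      · exact absurd he.symm (circleMap_ne h.pos h1 (by linarith [hy.1, hx.2]))
    have hfin : (Set.Icc ψ (ψ + δ) ∩ γ ⁻¹' V).Finite :=
      Set.Finite.of_finite_image (hV.subset (by rintro _ ⟨x, hx, rfl⟩; exact hx.2))
        (hinj.mono Set.inter_subset_left)
    have hopen : IsOpen ((Set.Icc ψ (ψ + δ) ∩ γ ⁻¹' V) \ {ψ})ᶜ :=
      (hfin.subset Set.sdiff_subset).isClosed.isOpen_compl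
    obtain ⟨ε, hε, hball⟩ := Metric.isOpen_iff.1 hopen ψ (by simp)
    refine ⟨min ε δ, lt_min hε hδ0, fun x hx hxV => ?_⟩
    have hxε : x ∈ Metric.ball ψ ε := by
      rw [Metric.mem_ball, Real.dist_eq, abs_lt]
      exact ⟨by linarith [hx.1], by linarith [hx.2, min_le_left ε δ]⟩
    exact hball hxε ⟨⟨⟨hx.1.le, by linarith [hx.2, min_le_right ε δ]⟩, hxV⟩, hx.1.ne'⟩
  obtain ⟨η, hη, h1, -⟩ := h.exists_side_const y
  rcases h1 with h1 | h1
  · obtain ⟨ε, hε, h2⟩ := key (y + Real.pi) η hη fun x hx => by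
      have := h1 (x - Real.pi) ⟨by linarith [hx.1], by linarith [hx.2]⟩
      rw [show x + Real.pi = x - Real.pi + 2 * Real.pi by ring,
        show y + Real.pi + Real.pi = y + 2 * Real.pi by ring, h.add_two_pi, h.add_two_pi, this]
    exact ⟨ε, hε, Or.inr fun x hx => h2 _ ⟨by linarith [hx.1], by linarith [hx.2]⟩⟩
  · obtain ⟨ε, hε, h2⟩ := key y η hη h1
    exact ⟨ε, hε, Or.inl h2⟩

end

/-! ### Reinhardt polygons have equally spaced directions -/

lemma exists_two_mul_or (m : ℤ) : ∃ k : ℤ, (m : ℝ) * Real.pi = k * (2 * Real.pi) ∨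
    (m : ℝ) * Real.pi = Real.pi + k * (2 * Real.pi) := by
  rcases Int.even_or_odd' m with ⟨k, hk | hk⟩
  · exact ⟨k, Or.inl (by rw [hk]; push_cast; ring)⟩
  · exact ⟨k, Or.inr (by rw [hk]; push_cast; ring)⟩

/-- All edges have length `2 r sin e` with the same half-angle `e < π / 2`. The set `S` of initial
normals of the arcs modulo `π` satisfies `exists_perm_of_tiling` with step `2e`: a new arc starts,
on the curve or opposite to it, exactly where one ends. -/
lemma IsReinhardtNGon.isEquidirected {n : ℕ} {α : Fin n → ℂ} (hα : IsReinhardtNGon α) :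
    IsEquidirected α := by
  have hn : 1 < n := hα.convex.two_le
  have hn0 : 0 < n := by omega
  have hpi := Real.pi_pos
  obtain ⟨D, r, hD, hmem, hess⟩ := hα.inscribed
  obtain ⟨a, θ, ρ, hU⟩ := hα.convex.exists_unrolling
  obtain ⟨γ, hfr, m, c, u, v, hγ⟩ := hD.exists_isPiecewiseArc
  set V := Set.range α
  have hVfin : V.Finite := Set.finite_range α
  have hVγ : V ⊆ Set.range γ := by
    rintro _ ⟨j, rfl⟩
    rw [← hfr]
    exact hmem j
  have hconst : ∀ x y, x < y → (∀ t ∈ Set.Icc x y, γ t = γ x) → γ x ∈ V := fun x y hxy h =>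
    hess _ (hγ.isEssentialEndpoint_of_const hfr hxy h)
  have hex : ∀ j : Fin n, ∃ d, IsArcOver γ r V (θ j - Real.pi / 2 - d) d (a j) (a (j + 1)) ∧
      ρ j = 2 * r * Real.sin d := fun j => by
    refine hγ.exists_isArcOver hVfin.isClosed hVγ hconst (hU.mem_range _) (hU.mem_range _)
      (hU.pos j) ?_ ?_
    · rw [hU.step, sub_add_cancel]
    · rintro _ ⟨k, rfl⟩
      rw [hU.apply]
      exact hU.component_vertex_le j k
  choose d hd hρ using hex
  set j₀ : Fin n := ⟨0, hn0⟩
  have hρeq : ∀ j : Fin n, ρ j = ρ j₀ := fun j => by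
    rw [hU.length_eq j j (Nat.mod_eq_of_lt j.2), hU.length_eq j₀ j₀ (Nat.mod_eq_of_lt j₀.2)]
    exact hα.equilateral _ _
  have hdeq : ∀ j, d j = d j₀ := fun j => by
    have h1 := hρeq j
    rw [hρ, hρ] at h1
    have h2 := mul_left_cancel₀ (mul_ne_zero two_ne_zero hγ.pos.ne') h1
    exact Real.injOn_sin ⟨by linarith [(hd j).pos], (hd j).lt.le⟩
      ⟨by linarith [(hd j₀).pos], (hd j₀).lt.le⟩ h2
  set e := d j₀
  have he0 : 0 < e := (hd j₀).pos
  simp only [hdeq] at hd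
  set p : Fin n → ℝ := fun j => θ j - Real.pi / 2 - e with hp
  have hd' : ∀ j : Fin n, IsArcOver γ r V (p j) e (a j) (a (j + 1)) := hd
  have hcenter : ∀ j, ∀ x ∈ Set.Icc (p j) (p j + 2 * e), γ (x + Real.pi) ∈ V := fun j x hx => by
    rw [(hd j).antipode x hx]
    exact (hd j).antipode_mem
  have hstart : ∀ j, γ (p j) = α j := fun j => by rw [(hd j).start_eq, hU.apply]
  have hfin : ∀ j, γ (p j + 2 * e) ∈ V := fun j => by
    rw [(hd j).end_eq]
    exact hU.mem_range _
  set S : Set ℝ := {x | ∃ j, ∃ m : ℤ, x = p j + m * Real.pi}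
  have hSmem : ∀ y η, 0 < η → γ y ∈ V → (∀ x ∈ Set.Ioo y (y + η), γ x ∉ V) → y ∈ S := by
    intro y η hη hy hnot
    obtain ⟨j, hj⟩ := hy
    obtain ⟨k, hk⟩ := hγ.eq_start_add (hd j) (hU.mem_range j) hη
      (by rw [← hj, hU.apply]) hnot
    exact ⟨j, 2 * k, by rw [hk]; push_cast; ring⟩
  have hadd : ∀ x ∈ S, x + 2 * e ∈ S := by
    rintro _ ⟨j, m, rfl⟩
    have hboth : γ (p j + m * Real.pi + 2 * e) ∈ V ∧
        γ (p j + m * Real.pi + 2 * e + Real.pi) ∈ V := by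
      have h1 := hcenter j (p j + 2 * e) ⟨by linarith, le_rfl⟩
      have h2 := hfin j
      obtain ⟨k, hk | hk⟩ := exists_two_mul_or m
      · rw [hk, show p j + k * (2 * Real.pi) + 2 * e + Real.pi =
          p j + 2 * e + Real.pi + k * (2 * Real.pi) by ring,
          show p j + k * (2 * Real.pi) + 2 * e = p j + 2 * e + k * (2 * Real.pi) by ring,
          hγ.add_int_mul, hγ.add_int_mul]
        exact ⟨h2, h1⟩
      · rw [hk, show p j + (Real.pi + k * (2 * Real.pi)) + 2 * e + Real.pi =
          p j + 2 * e + ((k + 1 : ℤ) : ℝ) * (2 * Real.pi) by push_cast; ring,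
          show p j + (Real.pi + k * (2 * Real.pi)) + 2 * e =
          p j + 2 * e + Real.pi + k * (2 * Real.pi) by ring, hγ.add_int_mul, hγ.add_int_mul]
        exact ⟨h1, h2⟩
    -- At the end of an arc both the point and its antipode are in `V`; the one that leaves `V` next
    -- starts an arc.
    obtain ⟨η, hη, h | h⟩ := hγ.exists_notMem_right hVfin (p j + m * Real.pi + 2 * e)
    · exact hSmem _ η hη hboth.1 h
    · obtain ⟨k, m', hk⟩ := hSmem _ η hη hboth.2 fun x hx => by
        have := h (x - Real.pi) ⟨by linarith [hx.1], by linarith [hx.2]⟩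
        rwa [sub_add_cancel] at this
      exact ⟨k, m' - 1, by push_cast; linarith⟩
  have hgap : ∀ x ∈ S, ∀ y ∈ S, x < y → x + 2 * e ≤ y := by
    rintro _ ⟨j, m, rfl⟩ _ ⟨k, m', rfl⟩ hlt
    -- At a normal in `S` the point and its antipode are both in `V`, but inside an arc the point is
    -- not.
    by_contra! hc
    have h1 := (hd' j).not_mem (p k + (m' - m : ℤ) * Real.pi)
      ⟨by push_cast; linarith, by push_cast; linarith⟩
    apply h1
    obtain ⟨q, hq | hq⟩ := exists_two_mul_or (m' - m)
    · rw [hq, hγ.add_int_mul, hstart]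
      exact ⟨k, rfl⟩
    · rw [hq, ← add_assoc, hγ.add_int_mul]
      exact hcenter k (p k) ⟨le_rfl, by linarith⟩
  have hinj : ∀ j k, ∀ m : ℤ, p j = p k + m * Real.pi → j = k := by
    intro j k m hjk
    obtain ⟨q, hq | hq⟩ := exists_two_mul_or m
    · apply hα.convex.injective
      rw [← hstart, ← hstart, hjk, hq, hγ.add_int_mul]
    -- Two opposite arcs are impossible: the points inside one would be the antipode of the other,
    -- which is in `V`.
    · exfalso
      have h1 := (hd' j).not_mem (p j + e) ⟨by linarith, by linarith⟩
      rw [hjk, hq, show p k + (Real.pi + q * (2 * Real.pi)) + e =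
        p k + e + Real.pi + q * (2 * Real.pi) by ring, hγ.add_int_mul] at h1
      exact h1 (hcenter k (p k + e) ⟨by linarith, by linarith⟩)
  obtain ⟨β, σ, hσ⟩ := exists_perm_of_tiling hn0 (by linarith : 0 < 2 * e) (S := S)
    (fun x => Iff.rfl) hadd hgap hinj
  refine ⟨ρ j₀, β + Real.pi / 2 + e, σ, hU.pos _, fun j => ?_⟩
  obtain ⟨k, hk⟩ := hσ j
  refine ⟨k, ?_⟩
  rw [hU.edge_eq, hU.step, hρeq, show β + Real.pi / 2 + e + (σ j : ℕ) * (Real.pi / n) +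
    k * Real.pi = θ j by simp only [hp] at hk; linarith]
  simp [circleMap]

/-! ### Existence and nonexistence of equidirected polygons -/

/-- Unit vectors with strictly increasing directions which wind once around the origin and add up
to zero are the edges of a convex polygon. -/
theorem exists_isConvexNGon_of_directions {n : ℕ} (hn : 2 ≤ n) {θ : ℕ → ℝ} (hmono : StrictMono θ)
    (hstep : ∀ i, θ (i + 1) < θ i + Real.pi) (hper : ∀ i, θ (i + n) = θ i + 2 * Real.pi)
    (hsum : ∑ i ∈ Finset.range n, Complex.exp ((θ i : ℂ) * Complex.I) = 0) :
    ∃ α : Fin n → ℂ, IsConvexNGon α ∧ ∀ j : Fin n, edge α j = Complex.exp (θ j * Complex.I) := by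
  have hn0 : 0 < n := by omega
  set z : ℕ → ℂ := fun i => Complex.exp ((θ i : ℂ) * Complex.I) with hz
  set A : ℕ → ℂ := fun j => ∑ i ∈ Finset.range j, z i with hA
  have hzper : ∀ i, z (n + i) = z i := fun i => by
    simp only [hz]
    rw [add_comm n, hper, Complex.ofReal_add, add_mul, Complex.exp_add]
    simp [Complex.exp_two_pi_mul_I]
  have hAper : Function.Periodic A n := fun j => by
    simp only [hA]
    rw [add_comm, Finset.sum_range_add, hsum, zero_add]
    exact Finset.sum_congr rfl fun i _ => hzper i
  have hedge : ∀ j : Fin n, edge (fun j : Fin n => A j) j = z j := fun j => by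
    have h := finRotate_mk_mod hn0 (j : ℕ)
    simp only [Nat.mod_eq_of_lt j.2, Fin.eta] at h
    rw [edge, h]
    simp only [hAper.map_mod_nat]
    simp only [hA, Finset.sum_range_succ, add_sub_cancel_left]
  have hsin : ∀ j k, j ≤ k → A j = A k → ∑ i ∈ Finset.Ico j k, Real.sin (θ i - θ j) = 0 := by
    intro j k hjk h
    have h1 : ∑ i ∈ Finset.Ico j k, z i * Complex.exp ((-θ j : ℝ) * Complex.I) = 0 := by
      rw [← Finset.sum_mul, Finset.sum_Ico_eq_sub _ hjk]
      change (A k - A j) * _ = 0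
      rw [h, sub_self, zero_mul]
    have h2 := congrArg Complex.im h1
    rw [Complex.im_sum] at h2
    rw [← Complex.zero_im, ← h2]
    refine Finset.sum_congr rfl fun i _ => ?_
    simp only [hz]
    rw [← Complex.exp_add, ← add_mul, ← Complex.ofReal_add, Complex.exp_ofReal_mul_I_im,
      ← sub_eq_add_neg]
  have hne : ∀ j k, j < k → k < n → A j ≠ A k := by
    intro j k hjk hkn h
    obtain ⟨l, rfl⟩ : ∃ l, k = l + 1 := ⟨k - 1, by omega⟩
    -- If two vertices coincided, the edges between them, and also the complementary ones, would sum
    -- to zero. Perpendicular to edge `j`, one of these two sums has terms of a single sign, not all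
    -- zero.
    rcases le_or_gt (θ l - θ j) Real.pi with hle | hgt
    · have h0 : ∀ i ∈ Finset.Ico j (l + 1), 0 ≤ Real.sin (θ i - θ j) := fun i hi => by
        rw [Finset.mem_Ico] at hi
        have h1 := hmono.monotone hi.1
        have h2 := hmono.monotone (Nat.lt_succ_iff.1 hi.2)
        exact Real.sin_nonneg_of_nonneg_of_le_pi (by linarith) (by linarith)
      rcases (Nat.lt_succ_iff.1 hjk).eq_or_lt with rfl | hlt
      · simp only [hA, Finset.sum_range_succ, left_eq_add] at h
        exact Complex.exp_ne_zero _ h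
      · have h1 := (Finset.sum_eq_zero_iff_of_nonneg h0).1 (hsin _ _ hjk.le h) (j + 1)
          (Finset.mem_Ico.2 ⟨by omega, by omega⟩)
        have h2 := hmono (Nat.lt_succ_self j)
        exact (Real.sin_pos_of_pos_of_lt_pi (by simpa using h2) (by linarith [hstep j])).ne' h1
    · have h1 : ∑ i ∈ Finset.Ico (l + 1) (j + n), Real.sin (θ i - θ j) = 0 := by
        have h2 := hsin j (j + n) (by omega) (hAper j).symm
        rwa [← Finset.sum_Ico_consecutive _ hjk.le (by omega : l + 1 ≤ j + n),
          hsin _ _ hjk.le h, zero_add] at h2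
      refine (Finset.sum_neg (fun i hi => ?_) ⟨l + 1, Finset.mem_Ico.2 ⟨le_rfl, by omega⟩⟩).ne h1
      rw [Finset.mem_Ico] at hi
      have h2 := hmono (show l < i by omega)
      have h3 := hmono hi.2
      rw [hper] at h3
      have h4 := Real.sin_neg_of_neg_of_neg_pi_lt (x := θ i - θ j - 2 * Real.pi) (by linarith)
        (by linarith)
      rwa [Real.sin_sub_two_pi] at h4
  refine ⟨fun j => A j, ⟨hn, fun j k h => ?_, fun j => θ j, fun j => ?_, fun j k h => ?_,
    fun j k => ?_⟩, hedge⟩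
  · rcases lt_trichotomy (j : ℕ) k with hlt | heq | hlt
    · exact absurd h (hne _ _ hlt k.2)
    · exact Fin.ext heq
    · exact absurd h.symm (hne _ _ hlt j.2)
  · obtain ⟨-, m, hm⟩ := eq_norm_and_arg one_pos
      (show edge (fun j : Fin n => A j) j = (1 : ℝ) * Complex.exp ((θ j : ℂ) * Complex.I) by
        rw [hedge, Complex.ofReal_one, one_mul])
    exact Real.Angle.angle_eq_iff_two_pi_dvd_sub.2 ⟨-m, by rw [hm]; push_cast; ring⟩
  · exact hmono.monotone h
  · have h1 := hmono.monotone (show (j : ℕ) ≤ k + n by omega)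
    rwa [hper] at h1

/-- If `n` is not a power of two, there is a convex `n`-gon with unit edges whose directions modulo
`π` are equidistributed. -/
theorem exists_isConvexNGon_isEquidirected {n : ℕ} (hn : 1 < n) (hpow : ¬∃ k : ℕ, n = 2 ^ k) :
    ∃ α : Fin n → ℂ, IsConvexNGon α ∧ IsEquidirected α := by
  obtain ⟨k, p, hp, hnp⟩ := Nat.exists_eq_two_pow_mul_odd (n := n) (by omega)
  set m := 2 ^ k with hm
  have hm0 : 0 < m := by positivity
  have hp3 : 3 ≤ p := by
    rcases hp with ⟨c, rfl⟩
    rcases Nat.eq_zero_or_pos c with rfl | hc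
    · exact absurd ⟨k, by simpa using hnp⟩ hpow
    · omega
  clear_value m
  subst hnp
  have hN : (0 : ℝ) < (m * p : ℕ) := by exact_mod_cast (by omega : 0 < m * p)
  -- Blocks of `m` consecutive multiples of `π / n` alternate with gaps of the same length; this
  -- gives `p` copies of a block, rotated by `2π / p`.
  set M : ℕ → ℕ := fun i => i + m * (i / m) with hM
  have hMmono : StrictMono M := fun i j h =>
    add_lt_add_of_lt_of_le h (Nat.mul_le_mul_left _ (Nat.div_le_div_right h.le))
  have hMstep : ∀ i, M (i + 1) < M i + m * p := fun i => by
    have h1 : (i + 1) / m ≤ i / m + 1 := by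
      rw [← Nat.add_div_right _ hm0]
      exact Nat.div_le_div_right (by omega)
    have h2 := Nat.mul_le_mul_left m h1
    have h3 := Nat.mul_le_mul_left m hp3
    simp only [hM]
    rw [mul_add, mul_one] at h2
    omega
  have hMper : ∀ i, M (i + m * p) = M i + 2 * (m * p) := fun i => by
    simp only [hM, Nat.add_mul_div_left _ _ hm0]
    ring
  have hMblock : ∀ b r, r < m → M (m * b + r) = 2 * m * b + r := fun b r hr => by
    simp only [hM, Nat.mul_add_div hm0, Nat.div_eq_of_lt hr]
    ring
  have hsum : ∑ i ∈ Finset.range (m * p), Complex.exp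
      (((M i * (Real.pi / (m * p : ℕ)) : ℝ) : ℂ) * Complex.I) = 0 := by
    set f : ℕ → ℂ := fun i => Complex.exp (((M i * (Real.pi / (m * p : ℕ)) : ℝ) : ℂ) * Complex.I)
    set w : ℂ := Complex.exp (2 * Real.pi * Complex.I / p) with hw
    have hblock : ∀ b r, r < m → f (m * b + r) =
        w ^ b * Complex.exp (((r * (Real.pi / (m * p : ℕ)) : ℝ) : ℂ) * Complex.I) := by
      intro b r hr
      simp only [f, hMblock b r hr, hw]
      rw [← Complex.exp_nat_mul, ← Complex.exp_add]
      congr 1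
      have h1 : (m : ℂ) ≠ 0 := by exact_mod_cast hm0.ne'
      have h2 : (p : ℂ) ≠ 0 := by exact_mod_cast (by omega : p ≠ 0)
      push_cast
      field_simp
    -- The sum factors into a geometric sum over the blocks, which vanishes for `q = p` as `w` is a
    -- primitive `p`-th root of unity, and the sum over one block.
    have hall : ∀ q, ∑ i ∈ Finset.range (m * q), f i = (∑ b ∈ Finset.range q, w ^ b) *
        ∑ r ∈ Finset.range m, Complex.exp (((r * (Real.pi / (m * p : ℕ)) : ℝ) : ℂ) * Complex.I) := by
      intro q
      induction q with
      | zero => simp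
      | succ q ih =>
        rw [mul_add, mul_one, Finset.sum_range_add, ih, Finset.sum_range_succ, add_mul]
        congr 1
        rw [Finset.mul_sum]
        exact Finset.sum_congr rfl fun r hr => hblock q r (Finset.mem_range.1 hr)
    rw [hall, (Complex.isPrimitiveRoot_exp p (by omega)).geom_sum_eq_zero (by omega), zero_mul]
  obtain ⟨α, hα, hedge⟩ := exists_isConvexNGon_of_directions (n := m * p)
    (θ := fun i => M i * (Real.pi / (m * p : ℕ))) hn
    (fun i j h => by
      have : (M i : ℝ) < M j := by exact_mod_cast hMmono h
      exact mul_lt_mul_of_pos_right this (by positivity))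
    (fun i => by
      have : (M (i + 1) : ℝ) < M i + (m * p : ℕ) := by exact_mod_cast hMstep i
      have h2 := mul_lt_mul_of_pos_right this (show 0 < Real.pi / (m * p : ℕ) by positivity)
      rwa [add_mul, mul_div_cancel₀ _ hN.ne'] at h2)
    (fun i => by
      have : (M (i + m * p) : ℝ) = M i + 2 * (m * p : ℕ) := by exact_mod_cast hMper i
      simp only [this]
      field_simp) hsum
  -- Modulo `m` the position in the block is recovered; then `2 b` modulo `p` determines the block
  -- `b < p` because `p` is odd.
  have hinj : Function.Injective fun j : Fin (m * p) =>
      (⟨M j % (m * p), Nat.mod_lt _ (by omega)⟩ : Fin (m * p)) := by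
    intro i j h
    have h1 : M i ≡ M j [MOD m * p] := Fin.mk.inj_iff.1 h
    have hdecomp : ∀ i, M i = 2 * m * (i / m) + i % m := fun i => by
      conv_lhs => rw [← Nat.div_add_mod i m]
      exact hMblock _ _ (Nat.mod_lt _ hm0)
    have h2 : (i : ℕ) % m = j % m := by
      have h3 := h1.of_mul_right p
      rw [hdecomp, hdecomp, mul_assoc, mul_left_comm, mul_assoc 2, mul_left_comm 2 m] at h3
      simpa [Nat.ModEq] using h3
    rw [hdecomp, hdecomp, h2] at h1
    have h3 := Nat.ModEq.add_right_cancel' _ h1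
    rw [mul_comm 2 m, mul_assoc, mul_assoc] at h3
    have h4 := (Nat.ModEq.mul_left_cancel' hm0.ne' h3).cancel_left_of_coprime
      (by simpa using hp.coprime_two_right)
    have hlt : ∀ i : Fin (m * p), (i : ℕ) / m < p := fun i => Nat.div_lt_of_lt_mul i.2
    have h5 := h4.eq_of_lt_of_lt (hlt i) (hlt j)
    ext
    rw [← Nat.div_add_mod i m, ← Nat.div_add_mod j m, h2, h5]
  refine ⟨α, hα, 1, 0, Equiv.ofBijective _ (Finite.injective_iff_bijective.1 hinj), one_pos,
    fun j => ⟨(M j / (m * p) : ℕ), ?_⟩⟩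
  rw [hedge, Complex.ofReal_one, one_mul]
  congr 3
  have h1 : (M j : ℝ) = (m * p : ℕ) * (M j / (m * p) : ℕ) + (M j % (m * p) : ℕ) := by
    exact_mod_cast (Nat.div_add_mod (M j) (m * p)).symm
  simp only [Equiv.ofBijective_apply, Int.cast_natCast]
  rw [zero_add]
  nth_rewrite 1 [h1]
  field_simp
  ring

/-- A relation with nonzero rational coefficients between the first `2 ^ k` powers of a primitive
`2 ^ (k + 1)`-th root of unity is trivial. -/
theorem sum_mul_pow_ne_zero_of_isPrimitiveRoot {k : ℕ} {ζ : ℂ}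
    (hζ : IsPrimitiveRoot ζ (2 ^ (k + 1))) {c : ℕ → ℚ} (hc : c 0 ≠ 0) :
    ∑ i ∈ Finset.range (2 ^ k), (c i : ℂ) * ζ ^ i ≠ 0 := by
  intro h
  set q : Polynomial ℚ := ∑ i ∈ Finset.range (2 ^ k), Polynomial.C (c i) * Polynomial.X ^ i with hq
  have hroot : Polynomial.aeval ζ q = 0 := by
    simpa [hq] using h
  have hdvd := minpoly.dvd ℚ ζ hroot
  rw [← Polynomial.cyclotomic_eq_minpoly_rat hζ (by positivity)] at hdvd
  -- The cyclotomic polynomial, which is minimal for `ζ`, has degree `2 ^ k`; so `q` would have to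
  -- vanish identically.
  have hdeg : q.degree < (Polynomial.cyclotomic (2 ^ (k + 1)) ℚ).degree := by
    rw [Polynomial.degree_cyclotomic, Nat.totient_prime_pow_succ Nat.prime_two]
    simpa [hq] using Polynomial.degree_sum_fin_lt (fun i : Fin (2 ^ k) => c i) |>.trans_eq' (by
      rw [Finset.sum_range])
  have h0 := congrArg (fun p => Polynomial.coeff p 0)
    (Polynomial.eq_zero_of_dvd_of_degree_lt hdvd hdeg)
  simp [hq, Polynomial.coeff_X_pow] at h0
  exact hc h0

/-- Adding `m π` to a direction only changes a sign, and the multiples of `π / 2 ^ k` are powers of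
`ζ`. As `σ` is a permutation, each power below `2 ^ k` occurs once, so a closed polygon would give a
relation with coefficients `±1`. -/
theorem not_isEquidirected_two_pow {k : ℕ} (α : Fin (2 ^ k) → ℂ) : ¬IsEquidirected α := by
  rintro ⟨s, β, σ, hs, h⟩
  choose m hm using h
  set ζ : ℂ := Complex.exp (2 * Real.pi * Complex.I / (2 ^ (k + 1) : ℕ)) with hζ
  have hprim := Complex.isPrimitiveRoot_exp (2 ^ (k + 1)) (by positivity)
  have hedge : ∀ j, edge α j = s * Complex.exp (β * Complex.I) *
      ((((-1 : ℚ) ^ m j : ℚ) : ℂ) * ζ ^ (σ j : ℕ)) := fun j => by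
    rw [hm, hζ, ← Complex.exp_nat_mul]
    push_cast
    rw [add_mul, add_mul, Complex.exp_add, Complex.exp_add, mul_assoc (m j : ℂ),
      Complex.exp_int_mul, Complex.exp_pi_mul_I]
    have : ((σ j : ℕ) : ℂ) * (Real.pi / 2 ^ k) * Complex.I =
        (σ j : ℕ) * (2 * Real.pi * Complex.I / 2 ^ (k + 1)) := by
      rw [pow_succ]
      field_simp
    rw [this]
    ring
  have hsum := sum_edge α
  simp only [hedge] at hsum
  rw [← Finset.mul_sum] at hsum
  have hne : (s : ℂ) * Complex.exp (β * Complex.I) ≠ 0 :=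
    mul_ne_zero (by exact_mod_cast hs.ne') (Complex.exp_ne_zero _)
  have h0 := (mul_eq_zero.1 hsum).resolve_left hne
  have hpos : 0 < 2 ^ k := by positivity
  refine sum_mul_pow_ne_zero_of_isPrimitiveRoot (k := k) hprim
    (c := fun i => (-1 : ℚ) ^ m (σ.symm ⟨i % 2 ^ k, Nat.mod_lt _ hpos⟩)) (by positivity) ?_
  rw [Finset.sum_range, ← h0, ← Equiv.sum_comp σ]
  refine Finset.sum_congr rfl fun j _ => ?_
  simp only [Nat.mod_eq_of_lt (σ j).2, Fin.eta, Equiv.symm_apply_apply]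
  rfl

end

end WidthDeviation

/-! ### Minimizing, equidirected and Reinhardt polygons compared. -/

theorem mainTheorem2 (n : ℕ) (hn : 1 < n) :
    ((¬ ∃ k : ℕ, n = 2 ^ k) → ∀ α : Fin n → ℂ,
      WidthDeviation.IsMinimizingNGon α ↔ WidthDeviation.IsReinhardtNGon α) ∧
    ((∃ α : Fin n → ℂ, WidthDeviation.IsReinhardtNGon α) ↔ ¬ ∃ k : ℕ, n = 2 ^ k) := by
  refine ⟨fun hpow α => ⟨fun ⟨hα, hmin⟩ => ?_, fun hα => ⟨hα.convex, fun β hβ => ?_⟩⟩, ?_, ?_⟩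
  -- An equidirected competitor exists and attains the bound, so the minimizer attains it too and is
  -- itself equidirected.
  · obtain ⟨β, hβ, he⟩ := WidthDeviation.exists_isConvexNGon_isEquidirected hn hpow
    exact WidthDeviation.isReinhardtNGon_of_isEquidirected hα
      (WidthDeviation.isEquidirected_of_deviationRate_le hβ he hα (hmin β hβ))
  · exact WidthDeviation.deviationRate_le_of_isEquidirected hα.convex hα.isEquidirected hβ
  · rintro ⟨α, hα⟩ ⟨k, rfl⟩
    exact WidthDeviation.not_isEquidirected_two_pow α hα.isEquidirected
  · intro hpow
    obtain ⟨α, hα, he⟩ := WidthDeviation.exists_isConvexNGon_isEquidirected hn hpow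
    exact ⟨α, WidthDeviation.isReinhardtNGon_of_isEquidirected hα he⟩
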